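/- Let $X$ be a complex Banach space, let $A:D(A)\subset X\to X$ be a sectorial operator of some angle $\omega\in[0,\pi)$ (that is, $\sigma(A)\subset\overline{S_\omega}$ and $\sup_{z\notin\overline{S_{\omega'}}}\|z(z-A)^{-1}\|<\infty$ for every $\omega'\in(\omega,\pi)$, where $\overline{S_\omega}=\{0\}\cup\{|\arg z|\le\omega\}$), and suppose that $\{z\in\mathbb C:\operatorname{Re}z\le 0\}\subset\rho(A)$. Put $B:=1+A$. Let $\beta>0$, $a\ge 0$, and let $\ell,\kappa:(0,\infty)\to(0,\infty)$ be increasing (non-decreasing) slowly varying functions, i.e. measurable with $\ell(cs)/\ell(s)\to1$ as $s\to\infty$ for every $c>0$, and likewise for $\kappa$. For increasing slowly varying $g$ put $S_g(t)=\int_0^\infty \frac{g(s)}{(s+t)^2}\,ds$, $t>0$. For $\varepsilon>0$ put $h_\varepsilon(s)=\ell(s^{1/\varepsilon})$, $\Psi_\varepsilon(s)=\dfrac{s^\varepsilon}{S_{h_\varepsilon}(1/s^\varepsilon)}$, and put $\Phi(t)=t\,S_\kappa(t)$. A function $f$ on $(0,\infty)$ is a complete Bernstein function if $f(t)=c+bt+\int_{(0,\infty)}\frac{t}{t+s}\,d\mu(s)$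 for all $t>0$, with $c,b\ge0$ and $\mu$ a positive measure on $(0,\infty)$ with $\int\frac{d\mu(s)}{1+s}<\infty$. For such $f$ and a densely defined sectorial operator $T$, $f(T)$ denotes the closure of the operator $x\mapsto cx+bTx+\int_{(0,\infty)}T(T+s)^{-1}x\,d\mu(s)$ on $D(T)$. Powers of sectorial operators with positive exponent are the usual fractional powers, and $(1+A)^{-\beta}=(B^{-1})^\beta$. 1. Suppose that there is $C$ with $\|(i\xi+A)^{-1}\|\le C(1+|\xi|)^\beta\ell(1+|\xi|)$ for all $\xi\in\mathbb R$. Then for each $\varepsilon>0$ for which $\Psi_\varepsilon$ is a complete Bernstein function, and this is the case for every $\varepsilon\in(0,1]$, $\Psi_\varepsilon(B^{-1})$ is a bounded operator on $X$ and $$\sup\big\{\ell(|\lambda|)^a\,\|(\lambda+A)^{-1}(1+A)^{-\beta}\,\Psi_\varepsilon(B^{-1})^{1+a}\|_{\mathcal L(X)} : \lambda\in i\mathbb R,\ |\lambda|\ge1\big\}<\infty .$$ 2. Suppose that $A$ is densely defined and that there is $C$ with $\|(i\xi+A)^{-1}\|\le C(1+|\xi|)^\beta/\kappa(1+|\xi|)$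 for all $\xi\in\mathbb R$. Then $\Phi$ is a complete Bernstein function, $0\in\rho(\Phi(B))$, the operator $\Phi(B)^{1+a}$ is densely defined, for each $\lambda\in i\mathbb R$ with $|\lambda|\ge1$ the operator $(\lambda+A)^{-1}(1+A)^{-\beta}\Phi(B)^{1+a}$, defined on $D(\Phi(B)^{1+a})$, extends to a bounded operator on $X$ (denoted in the same way), and $$\sup\big\{\kappa(|\lambda|)^{-a}\,\|(\lambda+A)^{-1}(1+A)^{-\beta}\,\Phi(B)^{1+a}\|_{\mathcal L(X)} : \lambda\in i\mathbb R,\ |\lambda|\ge1\big\}<\infty .$$ -/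

import Mathlib

open Set Filter Topology MeasureTheory

noncomputable section

namespace SectorialCalculus

/-! ### Unbounded operators, resolvents, sectoriality -/

section Operators

variable {X : Type*} [NormedAddCommGroup X] [NormedSpace ℂ X]

/-- `S` is a bounded, everywhere defined, two-sided inverse of the linear operator `T`. -/
def IsBoundedInverse (T : X →ₗ.[ℂ] X) (S : X →L[ℂ] X) : Prop :=
  (∀ x : T.domain, S (T x) = (x : X)) ∧ ∀ y : X, ∃ h : S y ∈ T.domain, T ⟨S y, h⟩ = y

open Classical in
/-- The inverse `T⁻¹ ∈ L(X)` of a linear operator having a bounded everywhere defined inverse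
(the value is `0` if there is none; the inverse is unique if it exists). -/
def binv (T : X →ₗ.[ℂ] X) : X →L[ℂ] X :=
  if h : ∃ S : X →L[ℂ] X, IsBoundedInverse T S then h.choose else 0

/-- The operator `z + A` with domain `D(A)`. -/
def shift (A : X →ₗ.[ℂ] X) (z : ℂ) : X →ₗ.[ℂ] X where
  domain := A.domain
  toFun := z • A.domain.subtype + A.toFun

/-- The resolvent set of `A`: those `z` for which `z - A` (equivalently `-z + A`) has a bounded
everywhere defined inverse. -/
def resolventSet (A : X →ₗ.[ℂ] X) : Set ℂ :=
  {z | ∃ S : X →L[ℂ] X, IsBoundedInverse (shift A (-z)) S}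

/-- The closure of the open sector of half-angle `ω` (for `0 ≤ ω < π`): the origin and all `z`
with `|arg z| ≤ ω`. -/
def closedSector (ω : ℝ) : Set ℂ := {z | z = 0 ∨ |z.arg| ≤ ω}

/-- `A` is sectorial of angle `ω`: the spectrum lies in the closed sector of half-angle `ω`, and
`z ↦ z (z - A)⁻¹` is bounded outside every larger closed sector. The operator `z - A` is the
negative of `shift A (-z)`, so the norms of the inverses agree. -/
def IsSectorial (A : X →ₗ.[ℂ] X) (ω : ℝ) : Prop :=
  (∀ z : ℂ, z ∉ closedSector ω → z ∈ resolventSet A) ∧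
  ∀ ω' : ℝ, ω < ω' → ω' < Real.pi →
    ∃ M : ℝ, ∀ z : ℂ, z ∉ closedSector ω' → ‖z‖ * ‖binv (shift A (-z))‖ ≤ M

/-- A bounded operator, as a linear operator with full domain. -/
def ofBounded (T : X →L[ℂ] X) : X →ₗ.[ℂ] X := (T : X →ₗ[ℂ] X).toPMap ⊤

end Operators

/-! ### Fractional powers -/

section Powers

variable {X : Type*} [NormedAddCommGroup X] [NormedSpace ℂ X]

/-- The fractional power `T ^ α`, `α > 0`, of a bounded sectorial operator `T`, by the Balakrishnan
formula
`T ^ α = Γ(n) / (Γ(α) Γ(n - α)) ∫₀^∞ t ^ (α - 1) (T (t + T)⁻¹) ^ n dt`, where `n = ⌊α⌋ + 1 > α`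
(the integral converges in `L(X)`, and the value is the same for every integer `n > α`). -/
def fracPow (T : X →L[ℂ] X) (α : ℝ) : X →L[ℂ] X :=
  ((Real.Gamma ((⌊α⌋₊ : ℝ) + 1) / (Real.Gamma α * Real.Gamma ((⌊α⌋₊ : ℝ) + 1 - α)) : ℝ) : ℂ) •
    ∫ t in Ioi (0 : ℝ), ((t ^ (α - 1) : ℝ) : ℂ) •
      (T * Ring.inverse (((t : ℂ) • (1 : X →L[ℂ] X)) + T)) ^ (⌊α⌋₊ + 1)

/-- The fractional power `T ^ α := ((T⁻¹) ^ α)⁻¹`, `α > 0`, of a (possibly unbounded) sectorial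
operator `T` with `0 ∈ ρ(T)`; its domain is the range of `(T⁻¹) ^ α`. -/
def unboundedPow (T : X →ₗ.[ℂ] X) (α : ℝ) : X →ₗ.[ℂ] X :=
  (ofBounded (fracPow (binv T) α)).inverse

end Powers

/-! ### Complete Bernstein functions and their functional calculus -/

/-- `(a, b, μ)` is a Stieltjes representation of `f : (0,∞) → ℝ`:
`f(t) = a + b t + ∫_{(0,∞)} t / (t + s) dμ(s)` with `a, b ≥ 0` and `∫_{(0,∞)} 1/(1+s) dμ(s) < ∞`.
Only the restriction of `μ` to `(0,∞)` plays a role. -/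
def IsStieltjesRep (f : ℝ → ℝ) (a b : ℝ) (μ : Measure ℝ) : Prop :=
  0 ≤ a ∧ 0 ≤ b ∧ (∫⁻ s in Ioi (0 : ℝ), ENNReal.ofReal (1 / (1 + s)) ∂μ) < ⊤ ∧
  ∀ t : ℝ, 0 < t → f t = a + b * t + ∫ s in Ioi (0 : ℝ), t / (t + s) ∂μ

/-- `f` (on `(0,∞)`) is a complete Bernstein function, i.e. has a (necessarily unique) Stieltjes
representation. -/
def IsCBF (f : ℝ → ℝ) : Prop := ∃ (a b : ℝ) (μ : Measure ℝ), IsStieltjesRep f a b μ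

section Calculus

variable {X : Type*} [NormedAddCommGroup X] [NormedSpace ℂ X]

/-- The operator `f₀(A) x = a x + b A x + ∫_{(0,∞)} A (A + s)⁻¹ x dμ(s)`. For `x ∈ D(A)` one has
`A (A + s)⁻¹ x = (A + s)⁻¹ A x`. The domain consists of the `x ∈ D(A)` for which the integral
converges absolutely, which is all of `D(A)` if `A` is sectorial and `∫ 1/(1+s) dμ(s) < ∞`. -/
def cbfPre (A : X →ₗ.[ℂ] X) (a b : ℝ) (μ : Measure ℝ) : X →ₗ.[ℂ] X where
  domain :=
    { carrier := {x | ∃ h : x ∈ A.domain,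
        IntegrableOn (fun s : ℝ => binv (shift A (s : ℂ)) (A ⟨x, h⟩)) (Ioi 0) μ}
      zero_mem' := by
        refine ⟨A.domain.zero_mem, ?_⟩
        have h0 : A ⟨0, A.domain.zero_mem⟩ = 0 := A.map_zero
        simp [h0]
      add_mem' := by
        rintro x y ⟨hx, ix⟩ ⟨hy, iy⟩
        refine ⟨A.domain.add_mem hx hy, ?_⟩
        have h0 : A ⟨x + y, A.domain.add_mem hx hy⟩ = A ⟨x, hx⟩ + A ⟨y, hy⟩ :=
          A.map_add ⟨x, hx⟩ ⟨y, hy⟩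
        simp only [h0, map_add]
        exact ix.add iy
      smul_mem' := by
        rintro c x ⟨hx, ix⟩
        refine ⟨A.domain.smul_mem c hx, ?_⟩
        have h0 : A ⟨c • x, A.domain.smul_mem c hx⟩ = c • A ⟨x, hx⟩ := A.map_smul c ⟨x, hx⟩
        simp only [h0, map_smul]
        exact Integrable.smul c (show Integrable _ (μ.restrict (Ioi 0)) from ix) }
  toFun :=
    { toFun := fun x => (a : ℂ) • (x : X) + (b : ℂ) • A ⟨x, x.2.choose⟩ +
        ∫ s in Ioi (0 : ℝ), binv (shift A (s : ℂ)) (A ⟨x, x.2.choose⟩) ∂μ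
      map_add' := by
        rintro ⟨x, hx, ix⟩ ⟨y, hy, iy⟩
        have h0 : A ⟨x + y, A.domain.add_mem hx hy⟩ = A ⟨x, hx⟩ + A ⟨y, hy⟩ :=
          A.map_add ⟨x, hx⟩ ⟨y, hy⟩
        change (a : ℂ) • (x + y) + (b : ℂ) • A ⟨x + y, A.domain.add_mem hx hy⟩ +
            ∫ s in Ioi (0 : ℝ), binv (shift A (s : ℂ)) (A ⟨x + y, A.domain.add_mem hx hy⟩) ∂μ =
          ((a : ℂ) • x + (b : ℂ) • A ⟨x, hx⟩ +
            ∫ s in Ioi (0 : ℝ), binv (shift A (s : ℂ)) (A ⟨x, hx⟩) ∂μ) +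
          ((a : ℂ) • y + (b : ℂ) • A ⟨y, hy⟩ +
            ∫ s in Ioi (0 : ℝ), binv (shift A (s : ℂ)) (A ⟨y, hy⟩) ∂μ)
        simp only [h0, map_add, smul_add]
        rw [integral_add ix iy]
        abel
      map_smul' := by
        rintro c ⟨x, hx, ix⟩
        have h0 : A ⟨c • x, A.domain.smul_mem c hx⟩ = c • A ⟨x, hx⟩ := A.map_smul c ⟨x, hx⟩
        change (a : ℂ) • (c • x) + (b : ℂ) • A ⟨c • x, A.domain.smul_mem c hx⟩ +
            ∫ s in Ioi (0 : ℝ), binv (shift A (s : ℂ)) (A ⟨c • x, A.domain.smul_mem c hx⟩) ∂μ =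
          c • ((a : ℂ) • x + (b : ℂ) • A ⟨x, hx⟩ +
            ∫ s in Ioi (0 : ℝ), binv (shift A (s : ℂ)) (A ⟨x, hx⟩) ∂μ)
        simp only [h0, map_smul]
        rw [integral_smul]
        simp only [smul_add, smul_comm c] }

open Classical in
/-- The operator `f(A)`, the closure of `f₀(A)`, for a complete Bernstein function `f` and a
densely defined sectorial operator `A` (the zero operator on `{0}` if `f` is not complete
Bernstein). -/
def cbf (A : X →ₗ.[ℂ] X) (f : ℝ → ℝ) : X →ₗ.[ℂ] X :=
  if h : ∃ p : ℝ × ℝ × Measure ℝ, IsStieltjesRep f p.1 p.2.1 p.2.2 then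
    (cbfPre A h.choose.1 h.choose.2.1 h.choose.2.2).closure
  else ⊥

end Calculus

/-! ### Slowly varying functions and the associated functions `S_g`, `Ψ_ε`, `Φ` -/

/-- An increasing (i.e. non-decreasing) slowly varying function `ℓ : (0,∞) → (0,∞)`. -/
structure IsIncreasingSlowlyVarying (ℓ : ℝ → ℝ) : Prop where
  pos : ∀ s : ℝ, 0 < s → 0 < ℓ s
  measurable : Measurable fun s : Ioi (0 : ℝ) => ℓ s
  mono : MonotoneOn ℓ (Ioi 0)
  slow : ∀ c : ℝ, 0 < c → Tendsto (fun s : ℝ => ℓ (c * s) / ℓ s) atTop (𝓝 1)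

/-- The Stieltjes function `S_g(t) = ∫₀^∞ g(s) / (s + t)² ds` associated with `g`. -/
def stieltjesFn (g : ℝ → ℝ) (t : ℝ) : ℝ := ∫ s in Ioi (0 : ℝ), g s / (s + t) ^ 2

/-- `Ψ_ε(s) = s^ε / S_h(1 / s^ε)`, where `h(s) = ℓ(s^{1/ε})`. -/
def Psi (ℓ : ℝ → ℝ) (ε : ℝ) (s : ℝ) : ℝ :=
  s ^ ε / stieltjesFn (fun r => ℓ (r ^ (1 / ε))) (1 / s ^ ε)

/-- `Φ(t) = t S_κ(t)`. -/
def Phi (κ : ℝ → ℝ) (t : ℝ) : ℝ := t * stieltjesFn κ t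

end SectorialCalculus

end

noncomputable section

namespace SectorialCalculus

/-! ### Balakrishnan integrals in a Banach algebra -/

/-! Write `T = B⁻¹ = (1 + A)⁻¹`, `R = (λ + A)⁻¹` with `λ ∈ iℝ`, `w = (1 - λ)⁻¹` and `r = |1 - λ|`.
The resolvent identity reads `R T = w R - w T`: multiplied by `R` on the left, `T` acts like the
scalar `w`, with an error of order `1/r`. This approximate eigenvalue relation survives functional
calculus. `exists_norm_mul_balPow_sub_le` carries it through the Balakrishnan formula for fractional
powers, and `NonnegBound.exists_norm_cbfOp_sub_le` through Stieltjes representations.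

Slowly varying loss: put `F = Ψ(T)`. Then `R T^β F^(1+a)` is `w^β Ψ(w)^(1+a) R` plus errors of order
`r^(-δ)` times powers of `ℓ(r)`, which are harmless because `ℓ` grows more slowly than any power. On
the right half-plane `|Ψ(w)|` is comparable to `Ψ(|w|)`, hence to `1/ℓ(r)`, so the main term is at
most a constant times `r^(-β) ℓ^(-1-a) r^β ℓ = ℓ^(-a)`. See
`NonnegBound.exists_norm_mul_balPow_mul_balPow_le`.

Slowly varying gain: `Φ(B)` is unbounded, so everything is expressed through `G = Φ(B)⁻¹` and the
bounded operator `V = Φ(B) B⁻¹`, where `G V = V G = T`. Now `R G = Φ(1 - λ)⁻¹ R - E` with `E` of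
order `1/r`. Since `Φ` grows more slowly than any power, `T^β = Q G^(1+a)` with `Q` bounded. With
`c` the scalar power of `Φ(1 - λ)⁻¹`, the extension sought is `N = c⁻¹ (R T^β + (c R - R G^(1+a))
Q)`. See `IsPseudoResolvent.exists_factor_norm_le`.

Fractional powers of `F` and `G` require these operators to be non-negative. For rational complete
Bernstein functions, `(t + f)⁻¹` is an explicit positive combination of resolvents, obtained by
diagonalizing a rank-one perturbation of a diagonal matrix (`exists_rankOne_spectral_data`); the
resulting bound is uniform and passes to limits (`nonnegBound_of_mem_bernsteinCone`). The same
reciprocal formula shows that `f(t) ↦ 1 / f(1/t)` preserves the closed cone of complete Bernstein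
functions, which gives the membership of `Ψ_ε` once `Φ` is written as a superposition of the
functions `t / (t + u)`. -/

theorem integrableOn_rpow_mul_min {p q : ℝ} (hp : -1 < p) (hq : p - q < -1) :
    IntegrableOn (fun t : ℝ => t ^ p * (min 1 t⁻¹) ^ q) (Ioi 0) := by
  rw [← Ioc_union_Ioi_eq_Ioi (zero_le_one (α := ℝ))]
  refine IntegrableOn.union ?_ ?_
  · have h : IntegrableOn (fun t : ℝ => t ^ p) (Ioc 0 1) := by
      rw [← intervalIntegrable_iff_integrableOn_Ioc_of_le zero_le_one]
      exact intervalIntegral.intervalIntegrable_rpow' hp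
    refine h.congr_fun (fun t ht => ?_) measurableSet_Ioc
    have : min 1 t⁻¹ = 1 := min_eq_left (one_le_inv_iff₀.2 ⟨ht.1, ht.2⟩)
    simp [this]
  · refine (integrableOn_Ioi_rpow_of_lt hq zero_lt_one).congr_fun (fun t ht => ?_) measurableSet_Ioi
    have ht0 : (0 : ℝ) < t := zero_lt_one.trans ht
    have : min 1 t⁻¹ = t⁻¹ := min_eq_right (inv_le_one_of_one_le₀ (le_of_lt ht))
    simp only [this]
    rw [Real.rpow_sub ht0, Real.inv_rpow ht0.le, div_eq_mul_inv]

section Balakrishnan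

variable {𝔸 : Type*} [NormedRing 𝔸] [NormedAlgebra ℝ 𝔸]

/-- The resolvent `(t + T)⁻¹` in a Banach algebra. -/
def res (T : 𝔸) (t : ℝ) : 𝔸 := Ring.inverse (t • (1 : 𝔸) + T)

/-- The element `T (t + T)⁻¹`. -/
def resMul (T : 𝔸) (t : ℝ) : 𝔸 := T * res T t

/-- `T` is non-negative with constant `M`: `‖(t + T)⁻¹‖ ≤ M / t` for all `t > 0`. -/
def NonnegBound (T : 𝔸) (M : ℝ) : Prop :=
  ∀ t : ℝ, 0 < t → IsUnit (t • (1 : 𝔸) + T) ∧ ‖res T t‖ ≤ M / t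

/-- The Balakrishnan integral `∫₀^∞ t ^ (b - 1) (T (t + T)⁻¹) ^ n dt`. -/
def balInt (T : 𝔸) (b : ℝ) (n : ℕ) : 𝔸 := ∫ t in Ioi (0 : ℝ), t ^ (b - 1) • resMul T t ^ n

/-- The normalizing constant of the Balakrishnan formula. -/
def balConst (α : ℝ) : ℝ :=
  Real.Gamma ((⌊α⌋₊ : ℝ) + 1) / (Real.Gamma α * Real.Gamma ((⌊α⌋₊ : ℝ) + 1 - α))

/-- The fractional power of a non-negative element of a Banach algebra. -/
def balPow (T : 𝔸) (α : ℝ) : 𝔸 := balConst α • balInt T α (⌊α⌋₊ + 1)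

theorem balConst_pos {α : ℝ} (hα : 0 < α) : 0 < balConst α := by
  have h1 : 0 < (⌊α⌋₊ : ℝ) + 1 - α := by linarith [Nat.lt_floor_add_one α]
  unfold balConst
  have := Real.Gamma_pos_of_pos hα
  have := Real.Gamma_pos_of_pos h1
  have : 0 < Real.Gamma ((⌊α⌋₊ : ℝ) + 1) := Real.Gamma_pos_of_pos (by positivity)
  positivity

variable {T : 𝔸} {M : ℝ}

theorem NonnegBound.add_mul_res (h : NonnegBound T M) {t : ℝ} (ht : 0 < t) :
    (t • (1 : 𝔸) + T) * res T t = 1 := Ring.mul_inverse_cancel _ (h t ht).1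

theorem NonnegBound.res_mul_add (h : NonnegBound T M) {t : ℝ} (ht : 0 < t) :
    res T t * (t • (1 : 𝔸) + T) = 1 := Ring.inverse_mul_cancel _ (h t ht).1

theorem NonnegBound.nonneg (h : NonnegBound T M) : 0 ≤ M := by
  have := (norm_nonneg _).trans (h 1 one_pos).2
  simpa using this

theorem NonnegBound.resMul_eq (h : NonnegBound T M) {t : ℝ} (ht : 0 < t) :
    resMul T t = 1 - t • res T t := by
  have := h.add_mul_res ht
  rw [add_mul, smul_mul_assoc, one_mul] at this
  rw [resMul, ← this]; abel

theorem NonnegBound.res_mul_eq (h : NonnegBound T M) {t : ℝ} (ht : 0 < t) :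
    res T t * T = 1 - t • res T t := by
  have := h.res_mul_add ht
  rw [mul_add, mul_smul_comm, mul_one] at this
  rw [← this]; abel

theorem NonnegBound.commute_res (h : NonnegBound T M) {t : ℝ} (ht : 0 < t) :
    Commute T (res T t) := by
  rw [Commute, SemiconjBy, h.res_mul_eq ht, ← h.resMul_eq ht, resMul]

theorem NonnegBound.smul_res (h : NonnegBound T M) {t : ℝ} (ht : 0 < t) :
    t • res T t = 1 - resMul T t := by rw [h.resMul_eq ht]; abel

theorem NonnegBound.commute_of_commute (h : NonnegBound T M) {S : 𝔸} (hS : Commute S T) {t : ℝ}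
    (ht : 0 < t) : Commute S (res T t) := by
  have h1 : Commute S (t • (1 : 𝔸) + T) := ((Commute.one_right S).smul_right t).add_right hS
  have e : S * res T t = res T t * (t • (1 : 𝔸) + T) * (S * res T t) := by
    rw [h.res_mul_add ht, one_mul]
  calc S * res T t = res T t * (t • (1 : 𝔸) + T) * (S * res T t) := e
    _ = res T t * (S * (t • (1 : 𝔸) + T)) * res T t := by rw [h1.eq]; simp only [mul_assoc]
    _ = res T t * S := by rw [mul_assoc, mul_assoc, h.add_mul_res ht, mul_one]

theorem NonnegBound.commute_resMul (h : NonnegBound T M) {S : 𝔸} (hS : Commute S T) {t : ℝ}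
    (ht : 0 < t) : Commute S (resMul T t) :=
  hS.mul_right (h.commute_of_commute hS ht)

/-- Near `0` the form `1 - t (t + T)⁻¹` is bounded; at infinity `T (t + T)⁻¹` decays like `1/t`. The
minimum records both regimes at once and is the majorant used throughout. -/
theorem NonnegBound.norm_resMul_le (h : NonnegBound T M) {t : ℝ} (ht : 0 < t) :
    ‖resMul T t‖ ≤ (‖(1 : 𝔸)‖ + M + ‖T‖ * M) * min 1 t⁻¹ := by
  have hM := h.nonneg
  have h1 : ‖resMul T t‖ ≤ ‖(1 : 𝔸)‖ + M := by
    rw [h.resMul_eq ht]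
    refine (norm_sub_le _ _).trans (add_le_add le_rfl ?_)
    rw [norm_smul, Real.norm_of_nonneg ht.le]
    calc t * ‖res T t‖ ≤ t * (M / t) := by gcongr; exact (h t ht).2
      _ = M := by field_simp
  have h2 : ‖resMul T t‖ ≤ ‖T‖ * M * t⁻¹ := by
    refine (norm_mul_le _ _).trans ?_
    rw [mul_assoc, ← div_eq_mul_inv]
    gcongr; exact (h t ht).2
  have h3 : 0 ≤ ‖T‖ * M := by positivity
  have h4 : 0 ≤ ‖(1 : 𝔸)‖ + M := by positivity
  have h5 : 0 < t⁻¹ := inv_pos.2 ht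
  rcases le_total 1 t⁻¹ with hh | hh
  · rw [min_eq_left hh]; linarith
  · rw [min_eq_right hh]; nlinarith

theorem NonnegBound.norm_resMul_pow_le (h : NonnegBound T M) {t : ℝ} (ht : 0 < t) (n : ℕ) :
    ‖resMul T t ^ n‖ ≤ ‖(1 : 𝔸)‖ * (‖(1 : 𝔸)‖ + M + ‖T‖ * M) ^ n * (min 1 t⁻¹) ^ (n : ℝ) := by
  rw [Real.rpow_natCast, mul_assoc, ← mul_pow]
  induction n with
  | zero => simp
  | succ n ih =>
    rw [pow_succ, pow_succ, ← mul_assoc]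
    exact (norm_mul_le _ _).trans (mul_le_mul ih (h.norm_resMul_le ht) (norm_nonneg _)
      ((norm_nonneg _).trans ih))

variable [CompleteSpace 𝔸]

theorem NonnegBound.hasDerivAt_res (h : NonnegBound T M) {t : ℝ} (ht : 0 < t) :
    HasDerivAt (res T) (-(res T t * res T t)) t := by
  have h1 : HasDerivAt (fun t : ℝ => t • (1 : 𝔸) + T) 1 t := by
    simpa using ((hasDerivAt_id t).smul_const (1 : 𝔸)).add_const T
  have h2 := hasFDerivAt_ringInverse (𝕜 := ℝ) (h t ht).1.unit
  have h3 := HasFDerivAt.comp_hasDerivAt t h2 h1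
  refine h3.congr_deriv ?_
  have e : ((h t ht).1.unit⁻¹ : 𝔸ˣ) = res T t := (Ring.inverse_of_isUnit (h t ht).1).symm
  simp [e]

theorem NonnegBound.hasDerivAt_resMul (h : NonnegBound T M) {t : ℝ} (ht : 0 < t) :
    HasDerivAt (resMul T) (-(resMul T t * res T t)) t := by
  have := (h.hasDerivAt_res ht).const_mul T
  refine this.congr_deriv ?_
  rw [resMul, mul_neg, mul_assoc]

theorem NonnegBound.hasDerivAt_resMul_pow (h : NonnegBound T M) {t : ℝ} (ht : 0 < t) (n : ℕ) :
    HasDerivAt (fun t => resMul T t ^ n) (-((n : ℝ) • (resMul T t ^ n * res T t))) t := by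
  induction n with
  | zero => simpa using hasDerivAt_const t (1 : 𝔸)
  | succ n ih =>
    have := ih.mul (h.hasDerivAt_resMul ht)
    simp only [pow_succ]
    refine this.congr_deriv ?_
    have hc : res T t * resMul T t = resMul T t * res T t :=
      (h.commute_resMul (h.commute_res ht).symm ht).eq
    push_cast
    rw [add_smul, one_smul, neg_mul, smul_mul_assoc, mul_assoc, hc, mul_neg, neg_add,
      ← mul_assoc]

theorem NonnegBound.continuousOn_resMul (h : NonnegBound T M) : ContinuousOn (resMul T) (Ioi 0) :=
  fun _ ht => (h.hasDerivAt_resMul ht).continuousAt.continuousWithinAt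

theorem NonnegBound.continuousOn_res (h : NonnegBound T M) : ContinuousOn (res T) (Ioi 0) :=
  fun _ ht => (h.hasDerivAt_res ht).continuousAt.continuousWithinAt

theorem continuousOn_rpow_Ioi (b : ℝ) : ContinuousOn (fun t : ℝ => t ^ b) (Ioi 0) :=
  fun _ ht => (Real.continuousAt_rpow_const _ _ (Or.inl ht.ne')).continuousWithinAt

theorem integrableOn_of_norm_le_rpow_mul_min {E : Type*} [NormedAddCommGroup E]
    {f : ℝ → E} {p q C : ℝ} (hf : ContinuousOn f (Ioi 0)) (hp : -1 < p) (hq : p - q < -1)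
    (hb : ∀ t, 0 < t → ‖f t‖ ≤ C * (t ^ p * (min 1 t⁻¹) ^ q)) : IntegrableOn f (Ioi 0) := by
  refine ((integrableOn_rpow_mul_min hp hq).const_mul C).mono'
    (hf.aestronglyMeasurable measurableSet_Ioi) ?_
  filter_upwards [ae_restrict_mem measurableSet_Ioi] with t ht using hb t ht

theorem NonnegBound.integrableOn_pow (h : NonnegBound T M) {b : ℝ} {n : ℕ} (hb : 0 < b)
    (hn : b < n) : IntegrableOn (fun t : ℝ => t ^ (b - 1) • resMul T t ^ n) (Ioi 0) := by
  refine integrableOn_of_norm_le_rpow_mul_min (p := b - 1) (q := n)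
    (C := ‖(1 : 𝔸)‖ * (‖(1 : 𝔸)‖ + M + ‖T‖ * M) ^ n)
    ((continuousOn_rpow_Ioi _).smul (h.continuousOn_resMul.pow n)) (by linarith) (by linarith) ?_
  intro t ht
  rw [norm_smul, Real.norm_of_nonneg (Real.rpow_nonneg ht.le _), mul_left_comm]
  exact mul_le_mul_of_nonneg_left (h.norm_resMul_pow_le ht n) (Real.rpow_nonneg ht.le _)

theorem NonnegBound.integrableOn_pow_mul_res (h : NonnegBound T M) {b : ℝ} {n : ℕ} (hb : 0 < b)
    (hn : b < n) : IntegrableOn (fun t : ℝ => t ^ b • (resMul T t ^ n * res T t)) (Ioi 0) := by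
  have h1 := (h.integrableOn_pow hb hn).sub
    (h.integrableOn_pow (n := n + 1) hb (by push_cast; linarith))
  refine IntegrableOn.congr_fun h1 (fun t ht => ?_) measurableSet_Ioi
  have ht' : (0 : ℝ) < t := ht
  simp only [Pi.sub_apply]
  rw [pow_succ, ← smul_sub, ← mul_one_sub, ← h.smul_res ht', mul_smul_comm, smul_smul,
    ← Real.rpow_add_one ht'.ne', sub_add_cancel]

theorem tendsto_rpow_mul_min_atTop {b n : ℝ} (hn : b < n) :
    Tendsto (fun t : ℝ => t ^ b * (min 1 t⁻¹) ^ n) atTop (𝓝 0) := by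
  have h1 : Tendsto (fun t : ℝ => t ^ (-(n - b))) atTop (𝓝 0) :=
    tendsto_rpow_neg_atTop (by linarith)
  refine h1.congr' ?_
  filter_upwards [eventually_ge_atTop 1] with t ht
  have ht0 : (0 : ℝ) < t := by linarith
  rw [min_eq_right (inv_le_one_of_one_le₀ ht), Real.inv_rpow ht0.le, ← Real.rpow_neg ht0.le,
    ← Real.rpow_add ht0]
  congr 1; ring

/-- The integration by parts underlying the recursions for the Balakrishnan integrals. -/
theorem NonnegBound.smul_balInt_eq (h : NonnegBound T M) {b : ℝ} {n : ℕ} (hb : 0 < b)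
    (hn : b < n) :
    b • balInt T b n = (n : ℝ) • ∫ t in Ioi (0 : ℝ), t ^ b • (resMul T t ^ n * res T t) := by
  have hnorm : ∀ t : ℝ, 0 < t → ‖t ^ b • resMul T t ^ n‖ ≤
      ‖(1 : 𝔸)‖ * (‖(1 : 𝔸)‖ + M + ‖T‖ * M) ^ n * (t ^ b * (min 1 t⁻¹) ^ (n : ℝ)) := by
    intro t ht
    rw [norm_smul, Real.norm_of_nonneg (Real.rpow_nonneg ht.le _), mul_left_comm]
    exact mul_le_mul_of_nonneg_left (h.norm_resMul_pow_le ht n) (Real.rpow_nonneg ht.le _)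
  -- The boundary terms of `t ^ b • resMul T t ^ n` vanish at `0` because `b > 0` and at infinity
  -- because `b < n`.
  have key := integral_Ioi_of_hasDerivAt_of_tendsto (a := (0 : ℝ)) (m := (0 : 𝔸))
    (f := fun t : ℝ => t ^ b • resMul T t ^ n)
    (f' := fun t : ℝ => b • (t ^ (b - 1) • resMul T t ^ n) -
      (n : ℝ) • (t ^ b • (resMul T t ^ n * res T t))) ?_ ?_ ?_ ?_
  · have hs := integral_sub ((h.integrableOn_pow hb hn).smul b)
      ((h.integrableOn_pow_mul_res hb hn).smul (n : ℝ))
    simp only [Pi.smul_apply] at hs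
    rw [hs, integral_smul, integral_smul,
      Real.zero_rpow hb.ne', zero_smul, sub_zero, sub_eq_zero] at key
    exact key
  · rw [← continuousWithinAt_Ioi_iff_Ici, ContinuousWithinAt, Real.zero_rpow hb.ne', zero_smul]
    have h0 : Tendsto (fun t : ℝ => ‖(1 : 𝔸)‖ * (‖(1 : 𝔸)‖ + M + ‖T‖ * M) ^ n * t ^ b) (𝓝[>] 0)
        (𝓝 0) := by
      have h1 : ContinuousAt (fun t : ℝ => t ^ b) 0 :=
        Real.continuousAt_rpow_const _ _ (Or.inr hb.le)
      have h2 : Tendsto (fun t : ℝ => t ^ b) (𝓝[>] 0) (𝓝 0) := by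
        have := h1.tendsto.mono_left (nhdsWithin_le_nhds (s := Ioi 0))
        rwa [Real.zero_rpow hb.ne'] at this
      simpa using h2.const_mul (‖(1 : 𝔸)‖ * (‖(1 : 𝔸)‖ + M + ‖T‖ * M) ^ n)
    refine squeeze_zero_norm' ?_ h0
    filter_upwards [self_mem_nhdsWithin] with t ht
    have hM := h.nonneg
    refine (hnorm t ht).trans ?_
    have h1 : (min 1 t⁻¹) ^ (n : ℝ) ≤ 1 :=
      Real.rpow_le_one (le_min zero_le_one (inv_nonneg.2 (le_of_lt ht))) (min_le_left _ _)
        (Nat.cast_nonneg n)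
    have h2 := Real.rpow_nonneg (le_of_lt ht) b
    have : t ^ b * (min 1 t⁻¹) ^ (n : ℝ) ≤ t ^ b := mul_le_of_le_one_right h2 h1
    gcongr
  · intro t ht
    have ht' : (0 : ℝ) < t := ht
    refine ((Real.hasDerivAt_rpow_const (p := b) (Or.inl ht'.ne')).smul
      (h.hasDerivAt_resMul_pow ht' n)).congr_deriv ?_
    rw [smul_neg, smul_comm, mul_smul, smul_comm b]
    abel
  · exact ((h.integrableOn_pow hb hn).smul b).sub
      ((h.integrableOn_pow_mul_res hb hn).smul (n : ℝ))
  · have h0 := (tendsto_rpow_mul_min_atTop hn).const_mul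
      (‖(1 : 𝔸)‖ * (‖(1 : 𝔸)‖ + M + ‖T‖ * M) ^ n)
    rw [mul_zero] at h0
    refine squeeze_zero_norm' ?_ h0
    filter_upwards [eventually_gt_atTop 0] with t ht using hnorm t ht

/-- Since `t (t + T)⁻¹ = 1 - T (t + T)⁻¹`, the integral produced by parts is a difference of two
consecutive Balakrishnan integrals. Thus raising `n` only multiplies the integral by a scalar. -/
theorem NonnegBound.balInt_succ (h : NonnegBound T M) {b : ℝ} {n : ℕ} (hb : 0 < b)
    (hn : b < n) : (n : ℝ) • balInt T b (n + 1) = ((n : ℝ) - b) • balInt T b n := by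
  have e : ∫ t in Ioi (0 : ℝ), t ^ b • (resMul T t ^ n * res T t) =
      balInt T b n - balInt T b (n + 1) := by
    rw [balInt, balInt, ← integral_sub (h.integrableOn_pow hb hn)
      (h.integrableOn_pow (n := n + 1) hb (by push_cast; linarith))]
    refine setIntegral_congr_fun measurableSet_Ioi (fun t ht => ?_)
    have ht' : (0 : ℝ) < t := ht
    rw [pow_succ, ← smul_sub, ← mul_one_sub, ← h.smul_res ht', mul_smul_comm, smul_smul,
      ← Real.rpow_add_one ht'.ne', sub_add_cancel]
  have := h.smul_balInt_eq hb hn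
  rw [e, smul_sub] at this
  rw [sub_smul, this]; abel

/-- Here the extra factor `T` turns the stray resolvent into one more `resMul`; this is the source
of `T ^ (α + 1) = T * T ^ α`. -/
theorem NonnegBound.mul_balInt (h : NonnegBound T M) {b : ℝ} {n : ℕ} (hb : 0 < b)
    (hn : b < n) : b • (T * balInt T b n) = (n : ℝ) • balInt T (b + 1) (n + 1) := by
  have : b • (T * balInt T b n) =
      (n : ℝ) • (T * ∫ t in Ioi (0 : ℝ), t ^ b • (resMul T t ^ n * res T t)) := by
    rw [← mul_smul_comm, h.smul_balInt_eq hb hn, mul_smul_comm]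
  rw [this, ← integral_const_mul_of_integrable (h.integrableOn_pow_mul_res hb hn), balInt]
  congr 1
  refine setIntegral_congr_fun measurableSet_Ioi (fun t ht => ?_)
  have hc : T * resMul T t ^ n = resMul T t ^ n * T :=
    ((h.commute_resMul (Commute.refl T) ht).pow_right n).eq
  rw [mul_smul_comm, ← mul_assoc, hc, mul_assoc, pow_succ, add_sub_cancel_right, resMul]

theorem NonnegBound.balPow_add_one (h : NonnegBound T M) {α : ℝ} (hα : 0 < α) :
    balPow T (α + 1) = T * balPow T α := by
  have hn : α < (⌊α⌋₊ + 1 : ℕ) := by push_cast; exact Nat.lt_floor_add_one α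
  have h1 := h.mul_balInt hα hn
  have hf : ⌊α + 1⌋₊ = ⌊α⌋₊ + 1 := Nat.floor_add_one hα.le
  have hc : balConst (α + 1) * α = balConst α * ((⌊α⌋₊ + 1 : ℕ) : ℝ) := by
    unfold balConst
    rw [hf, Real.Gamma_add_one hα.ne']
    push_cast
    rw [Real.Gamma_add_one (s := (⌊α⌋₊ : ℝ) + 1) (by positivity)]
    have h2 : (⌊α⌋₊ : ℝ) + 1 + 1 - (α + 1) = (⌊α⌋₊ : ℝ) + 1 - α := by ring
    rw [h2]
    push_cast at hn
    have := (Real.Gamma_pos_of_pos hα).ne'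
    have := (Real.Gamma_pos_of_pos (show 0 < (⌊α⌋₊ : ℝ) + 1 - α by linarith)).ne'
    field_simp
  rw [balPow, balPow, hf, mul_smul_comm]
  have hn0 : ((⌊α⌋₊ + 1 : ℕ) : ℝ) ≠ 0 := by positivity
  have h3 : T * balInt T α (⌊α⌋₊ + 1) =
      (((⌊α⌋₊ + 1 : ℕ) : ℝ) / α) • balInt T (α + 1) (⌊α⌋₊ + 1 + 1) := by
    rw [div_eq_inv_mul, mul_smul, ← h1, smul_smul, inv_mul_cancel₀ hα.ne', one_smul]
  rw [h3, smul_smul]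
  congr 1
  field_simp
  linarith

/-- The function `T - t T (t + T)⁻¹` is an explicit primitive of the negative of the integrand,
falling from `T` at `0` to `0` at infinity. -/
theorem NonnegBound.balInt_one_two (h : NonnegBound T M) : balInt T 1 2 = T := by
  have hi : IntegrableOn (fun t : ℝ => resMul T t ^ 2) (Ioi 0) := by
    simpa using h.integrableOn_pow (b := 1) (n := 2) one_pos (by norm_num)
  have key := integral_Ioi_of_hasDerivAt_of_tendsto (a := (0 : ℝ)) (m := (0 : 𝔸))
    (f := fun t : ℝ => T - t • resMul T t)
    (f' := fun t : ℝ => -(resMul T t ^ 2)) ?_ ?_ hi.neg ?_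
  · rw [integral_neg] at key
    simp only [zero_smul, sub_zero, zero_sub, neg_inj] at key
    simpa [balInt] using key
  · rw [← continuousWithinAt_Ioi_iff_Ici]
    refine continuousWithinAt_const.sub ?_
    rw [ContinuousWithinAt, zero_smul]
    have h0 : Tendsto (fun t : ℝ => t * (‖(1 : 𝔸)‖ + M + ‖T‖ * M)) (𝓝[>] 0) (𝓝 0) := by
      have : Tendsto (fun t : ℝ => t) (𝓝[>] (0 : ℝ)) (𝓝 0) :=
        tendsto_id.mono_left nhdsWithin_le_nhds
      simpa using this.mul_const (‖(1 : 𝔸)‖ + M + ‖T‖ * M)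
    refine squeeze_zero_norm' ?_ h0
    filter_upwards [self_mem_nhdsWithin] with t ht
    have hM := h.nonneg
    rw [norm_smul, Real.norm_of_nonneg (le_of_lt ht)]
    have h1 := h.norm_resMul_le ht
    have h2 : (‖(1 : 𝔸)‖ + M + ‖T‖ * M) * min 1 t⁻¹ ≤ (‖(1 : 𝔸)‖ + M + ‖T‖ * M) :=
      mul_le_of_le_one_right (by positivity) (min_le_left _ _)
    exact mul_le_mul_of_nonneg_left (h1.trans h2) (le_of_lt ht)
  · intro t ht
    have ht' : (0 : ℝ) < t := ht
    refine (((hasDerivAt_id t).smul (h.hasDerivAt_resMul ht')).const_sub T).congr_deriv ?_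
    have : t • (resMul T t * res T t) = resMul T t - resMul T t ^ 2 := by
      rw [← mul_smul_comm, h.smul_res ht', mul_sub, mul_one, sq]
    simp only [id, one_smul, smul_neg, this]
    abel
  · have h1 : ∀ t : ℝ, 0 < t → T - t • resMul T t = T * resMul T t := by
      intro t ht
      have := h.smul_res ht
      calc T - t • resMul T t = T * (1 - t • res T t) := by
            rw [resMul, mul_sub, mul_one, mul_smul_comm]
        _ = _ := by rw [← h.resMul_eq ht]
    have h0 : Tendsto (fun t : ℝ => ‖T‖ * ((‖(1 : 𝔸)‖ + M + ‖T‖ * M) * t⁻¹)) atTop (𝓝 0) := by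
      simpa using (tendsto_inv_atTop_zero.const_mul (‖(1 : 𝔸)‖ + M + ‖T‖ * M)).const_mul ‖T‖
    refine squeeze_zero_norm' ?_ h0
    filter_upwards [eventually_gt_atTop 0] with t ht
    have hM := h.nonneg
    rw [h1 t ht]
    refine (norm_mul_le _ _).trans ?_
    gcongr
    refine (h.norm_resMul_le ht).trans ?_
    gcongr
    exact min_le_right _ _

theorem NonnegBound.balPow_one (h : NonnegBound T M) : balPow T 1 = T := by
  rw [balPow, balConst]
  norm_num [Real.Gamma_two, h.balInt_one_two]

end Balakrishnan

/-! ### Products of complementary fractional powers -/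

section BalakrishnanProduct

variable {𝔸 : Type*} [NormedRing 𝔸] [NormedAlgebra ℝ 𝔸] {T : 𝔸} {M : ℝ}

theorem NonnegBound.res_sub_res (h : NonnegBound T M) {s t : ℝ} (hs : 0 < s) (ht : 0 < t) :
    res T s - res T t = (t - s) • (res T s * res T t) := by
  have h1 : res T s * ((t • (1 : 𝔸) + T) - (s • (1 : 𝔸) + T)) * res T t =
      res T s - res T t := by
    rw [mul_sub, sub_mul, mul_assoc, h.add_mul_res ht, mul_one, h.res_mul_add hs, one_mul]
  rw [← h1, add_sub_add_right_eq_sub, ← sub_smul, mul_smul_comm, mul_one, smul_mul_assoc]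

/-- The resolvent identity linearizes a product at the scales `t` and `u t`, so that its weighted
integral in `t` can be evaluated by scaling. -/
theorem NonnegBound.smul_resMul_mul_resMul (h : NonnegBound T M) {t u : ℝ} (ht : 0 < t)
    (hu : 0 < u) : (u - 1) • (resMul T t * resMul T (u * t)) =
      u • resMul T (u * t) - resMul T t := by
  have h1 := h.res_sub_res ht (mul_pos hu ht)
  have h2 : (u - 1) • ((t * (u * t)) • (res T t * res T (u * t))) =
      (u * t) • (res T t - res T (u * t)) := by
    rw [h1, smul_smul, smul_smul]; congr 1; ring
  rw [h.resMul_eq ht, h.resMul_eq (mul_pos hu ht), sub_mul, one_mul, mul_sub, mul_one,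
    smul_mul_smul_comm, smul_sub, smul_sub (u - 1) (t • res T t), h2]
  module

theorem nonnegBound_one : NonnegBound (1 : ℝ) 1 := by
  intro t ht
  have h : (t • (1 : ℝ) + 1) ≠ 0 := by simp; positivity
  refine ⟨h.isUnit, ?_⟩
  rw [res, Ring.inverse_eq_inv', Real.norm_of_nonneg (by simp; positivity), one_div]
  simp only [smul_eq_mul, mul_one]
  exact inv_anti₀ ht (by linarith)

theorem resMul_one {t : ℝ} : resMul (1 : ℝ) t = (t + 1)⁻¹ := by
  simp [resMul, res, Ring.inverse_eq_inv']

theorem min_one_inv_mul_le {t u : ℝ} (ht : 0 < t) (hu : 0 < u) :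
    min 1 (u * t)⁻¹ ≤ (1 + u⁻¹) * min 1 t⁻¹ := by
  have h1 : 0 < u⁻¹ := inv_pos.2 hu
  have h2 : 0 < t⁻¹ := inv_pos.2 ht
  rcases le_total 1 t⁻¹ with h | h
  · rw [min_eq_left h]; exact (min_le_left _ _).trans (by linarith)
  · rw [min_eq_right h, mul_inv]
    exact (min_le_right _ _).trans (by nlinarith)

/-- The integrals of a single `resMul` converge only for exponents `γ < 1`, while the product
formula needs `γ = 1`. Identities are proved for `γ < 1` and passed to the limit. -/
theorem tendsto_integral_rpow_smul {f : ℝ → 𝔸} {K : ℝ} (hf : ContinuousOn f (Ioi 0))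
    (hb : ∀ t, 0 < t → ‖f t‖ ≤ K * (min 1 t⁻¹) ^ (2 : ℝ)) :
    Tendsto (fun γ : ℝ => ∫ t in Ioi (0 : ℝ), t ^ (γ - 1) • f t) (𝓝[<] 1)
      (𝓝 (∫ t in Ioi (0 : ℝ), t ^ ((1 : ℝ) - 1) • f t)) := by
  have hK : 0 ≤ K := by
    have := (norm_nonneg _).trans (hb 1 one_pos)
    simpa using this
  refine tendsto_integral_filter_of_dominated_convergence
    (fun t => K * (t ^ (-(1 / 2) : ℝ) * (min 1 t⁻¹) ^ (2 : ℝ)) +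
      K * (t ^ (0 : ℝ) * (min 1 t⁻¹) ^ (2 : ℝ))) ?_ ?_ ?_ ?_
  · exact .of_forall fun γ =>
      ((continuousOn_rpow_Ioi _).smul hf).aestronglyMeasurable measurableSet_Ioi
  · have : Ioi (1 / 2 : ℝ) ∈ 𝓝[<] (1 : ℝ) := mem_nhdsWithin_of_mem_nhds (Ioi_mem_nhds (by norm_num))
    filter_upwards [this, self_mem_nhdsWithin] with γ h1 h2
    filter_upwards [ae_restrict_mem measurableSet_Ioi] with t ht
    have ht' : (0 : ℝ) < t := ht
    have h1' : 1 / 2 < γ := h1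
    have h2' : γ < 1 := h2
    rw [norm_smul, Real.norm_of_nonneg (Real.rpow_nonneg ht'.le _), ← mul_add, ← add_mul,
      mul_left_comm]
    refine mul_le_mul ?_ (hb t ht') (norm_nonneg _) (by positivity)
    rcases le_total t 1 with h | h
    · exact (Real.rpow_le_rpow_of_exponent_ge ht' h (show -(1 / 2 : ℝ) ≤ γ - 1 by linarith)).trans
        (le_add_of_nonneg_right (Real.rpow_nonneg ht'.le _))
    · exact (Real.rpow_le_rpow_of_exponent_le h (show γ - 1 ≤ 0 by linarith)).trans
        (le_add_of_nonneg_left (Real.rpow_nonneg ht'.le _))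
  · exact ((integrableOn_rpow_mul_min (by norm_num) (by norm_num)).const_mul K).add
      ((integrableOn_rpow_mul_min (by norm_num) (by norm_num)).const_mul K)
  · filter_upwards [ae_restrict_mem measurableSet_Ioi] with t ht
    have ht' : (0 : ℝ) < t := ht
    have : ContinuousAt (fun γ : ℝ => t ^ (γ - 1) • f t) 1 := by
      refine ContinuousAt.smul ?_ continuousAt_const
      exact (Real.continuousAt_const_rpow ht'.ne').comp (continuousAt_id.sub continuousAt_const)
    exact this.tendsto.mono_left nhdsWithin_le_nhds

variable [CompleteSpace 𝔸]

theorem continuousOn_comp_mul {E : Type*} [TopologicalSpace E] {f : ℝ → E}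
    (hf : ContinuousOn f (Ioi 0)) {u : ℝ} (hu : 0 < u) :
    ContinuousOn (fun t => f (u * t)) (Ioi 0) :=
  hf.comp (continuousOn_const.mul continuousOn_id) (fun _ ht => mul_pos hu ht)

/-- The integral `∫₀^∞ t ^ (γ - 1) T (t + T)⁻¹ T (u t + T)⁻¹ dt`. -/
def balInt₂ (T : 𝔸) (γ u : ℝ) : 𝔸 :=
  ∫ t in Ioi (0 : ℝ), t ^ (γ - 1) • (resMul T t * resMul T (u * t))

theorem NonnegBound.smul_balInt₂ (h : NonnegBound T M) {γ u : ℝ} (hγ : 0 < γ) (hγ1 : γ < 1)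
    (hu : 0 < u) : (u - 1) • balInt₂ T γ u = (u ^ (1 - γ) - 1) • balInt T γ 1 := by
  have hi : IntegrableOn (fun t : ℝ => t ^ (γ - 1) • resMul T t) (Ioi 0) := by
    simpa using h.integrableOn_pow (n := 1) hγ (by simpa using hγ1)
  have e1 : ∀ t ∈ Ioi (0 : ℝ), t ^ (γ - 1) • ((u - 1) • (resMul T t * resMul T (u * t))) =
      (u * u ^ (1 - γ)) • ((u * t) ^ (γ - 1) • resMul T (u * t)) - t ^ (γ - 1) • resMul T t := by
    intro t ht
    rw [h.smul_resMul_mul_resMul ht hu, Real.mul_rpow hu.le (le_of_lt ht), smul_sub, smul_smul,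
      smul_smul]
    congr 2
    have : u ^ (1 - γ) * u ^ (γ - 1) = 1 := by
      rw [← Real.rpow_add hu]; simp
    calc t ^ (γ - 1) * u = u * (u ^ (1 - γ) * u ^ (γ - 1)) * t ^ (γ - 1) := by rw [this]; ring
      _ = _ := by ring
  have hi2 : IntegrableOn (fun t : ℝ => (u * t) ^ (γ - 1) • resMul T (u * t)) (Ioi 0) := by
    have := (integrableOn_Ioi_comp_mul_left_iff
      (fun t : ℝ => t ^ (γ - 1) • resMul T t) 0 hu).2 (by simpa using hi)
    exact this
  rw [balInt₂, ← integral_smul]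
  simp only [smul_comm (u - 1)]
  have hs := integral_sub (hi2.smul (u * u ^ (1 - γ))) hi
  simp only [Pi.smul_apply] at hs
  rw [setIntegral_congr_fun measurableSet_Ioi e1, hs, integral_smul,
    integral_comp_mul_left_Ioi (fun t : ℝ => t ^ (γ - 1) • resMul T t) 0 hu, mul_zero, smul_smul,
    sub_smul, one_smul, balInt]
  have : u * u ^ (1 - γ) * u⁻¹ = u ^ (1 - γ) := by field_simp
  simp [this]

/-- Both integrals are multiples of `balInt T γ 1` by scalars that do not depend on `T`. Comparison
with `T = 1` in `ℝ` eliminates these scalars without evaluating any Beta integral. -/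
theorem NonnegBound.smul_balInt₂_eq (h : NonnegBound T M) {γ u : ℝ} (hγ : 0 < γ) (hγ1 : γ < 1)
    (hu : 0 < u) (hu1 : u ≠ 1) :
    balInt (1 : ℝ) γ 2 • balInt₂ T γ u = balInt₂ (1 : ℝ) γ u • balInt T γ 2 := by
  have a1 := h.smul_balInt₂ hγ hγ1 hu
  have a2 := h.balInt_succ (n := 1) hγ (by simpa using hγ1)
  have b1 := nonnegBound_one.smul_balInt₂ hγ hγ1 hu
  have b2 := nonnegBound_one.balInt_succ (n := 1) hγ (by simpa using hγ1)
  simp only [Nat.cast_one, one_smul, Nat.reduceAdd, smul_eq_mul, one_mul] at a1 a2 b1 b2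
  have hu2 : u - 1 ≠ 0 := sub_ne_zero.2 hu1
  have : (u - 1) • (balInt (1 : ℝ) γ 2 • balInt₂ T γ u) =
      (u - 1) • (balInt₂ (1 : ℝ) γ u • balInt T γ 2) := by
    rw [smul_comm, a1, smul_smul, smul_smul, b1, a2, smul_smul, b2]
    congr 1; ring
  exact smul_right_injective 𝔸 hu2 this

theorem NonnegBound.tendsto_balInt (h : NonnegBound T M) :
    Tendsto (fun γ => balInt T γ 2) (𝓝[<] 1) (𝓝 T) := by
  have := tendsto_integral_rpow_smul (h.continuousOn_resMul.pow 2)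
    (fun t ht => by simpa using h.norm_resMul_pow_le ht 2)
  have e := h.balInt_one_two
  rw [balInt] at e
  simp only [Pi.pow_apply] at this
  rwa [e] at this

theorem NonnegBound.tendsto_balInt₂ (h : NonnegBound T M) {u : ℝ} (hu : 0 < u) :
    Tendsto (fun γ => balInt₂ T γ u) (𝓝[<] 1) (𝓝 (balInt₂ T 1 u)) := by
  have hM := h.nonneg
  refine tendsto_integral_rpow_smul (K := (‖(1 : 𝔸)‖ + M + ‖T‖ * M) *
      ((‖(1 : 𝔸)‖ + M + ‖T‖ * M) * (1 + u⁻¹)))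
    (h.continuousOn_resMul.mul (continuousOn_comp_mul h.continuousOn_resMul hu)) ?_
  intro t ht
  have h0 : 0 ≤ min 1 t⁻¹ := le_min zero_le_one (inv_nonneg.2 ht.le)
  refine (norm_mul_le _ _).trans ?_
  have h1 := h.norm_resMul_le ht
  have h2 : ‖resMul T (u * t)‖ ≤ (‖(1 : 𝔸)‖ + M + ‖T‖ * M) * ((1 + u⁻¹) * min 1 t⁻¹) :=
    (h.norm_resMul_le (mul_pos hu ht)).trans (by gcongr; exact min_one_inv_mul_le ht hu)
  refine (mul_le_mul h1 h2 (norm_nonneg _) (by positivity)).trans (le_of_eq ?_)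
  rw [Real.rpow_two]; ring

theorem NonnegBound.balInt₂_one (h : NonnegBound T M) {u : ℝ} (hu : 0 < u) (hu1 : u ≠ 1) :
    balInt₂ T 1 u = balInt₂ (1 : ℝ) 1 u • T := by
  have h1 := (nonnegBound_one.tendsto_balInt).smul (h.tendsto_balInt₂ hu)
  have h2 := (nonnegBound_one.tendsto_balInt₂ hu).smul h.tendsto_balInt
  rw [one_smul] at h1
  refine tendsto_nhds_unique_of_eventuallyEq h1 h2 ?_
  have : Ioi (0 : ℝ) ∈ 𝓝[<] (1 : ℝ) := mem_nhdsWithin_of_mem_nhds (Ioi_mem_nhds (by norm_num))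
  filter_upwards [this, self_mem_nhdsWithin] with γ h3 h4
  exact h.smul_balInt₂_eq h3 h4 hu hu1

/-- For every `ρ ∈ [0, 1]` the left side is at most `(t u)^(-ρ)`. Taking `ρ = σ` for `u ≤ 1` and `ρ
= τ` for `u ≥ 1` separates the variables, as needed for Fubini. -/
theorem min_one_inv_mul_le_mul {σ τ : ℝ} (h0 : 0 ≤ σ) (h1 : σ ≤ τ) (h2 : τ ≤ 1) {t u : ℝ}
    (ht : 0 < t) (hu : 0 < u) :
    min 1 (t * u)⁻¹ ≤ (t ^ (-σ) + t ^ (-τ)) * (u ^ (-σ) * (min 1 u⁻¹) ^ (τ - σ)) := by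
  have htu := mul_pos ht hu
  have key : ∀ ρ : ℝ, 0 ≤ ρ → ρ ≤ 1 → min 1 (t * u)⁻¹ ≤ t ^ (-ρ) * u ^ (-ρ) := by
    intro ρ a b
    rw [← Real.mul_rpow ht.le hu.le]
    rcases le_total (t * u) 1 with h | h
    · exact (min_le_left _ _).trans (Real.one_le_rpow_of_pos_of_le_one_of_nonpos htu h (by linarith))
    · refine (min_le_right _ _).trans ?_
      rw [← Real.rpow_neg_one]
      exact Real.rpow_le_rpow_of_exponent_le h (by linarith)
  have p1 := Real.rpow_pos_of_pos ht (-σ)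
  have p2 := Real.rpow_pos_of_pos ht (-τ)
  rcases le_total u 1 with h | h
  · rw [min_eq_left (one_le_inv_iff₀.2 ⟨hu, h⟩), Real.one_rpow, mul_one]
    refine (key σ h0 (h1.trans h2)).trans ?_
    have := Real.rpow_pos_of_pos hu (-σ)
    gcongr; linarith
  · rw [min_eq_right (inv_le_one_of_one_le₀ h), Real.inv_rpow hu.le, ← Real.rpow_neg hu.le,
      ← Real.rpow_add hu]
    refine (key τ (h0.trans h1) h2).trans ?_
    have := Real.rpow_pos_of_pos hu (-τ)
    rw [show -σ + -(τ - σ) = -τ by ring]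
    gcongr; linarith

theorem NonnegBound.integrable_resMul_mul (h : NonnegBound T M) {θ : ℝ} (hθ : 0 < θ)
    (hθ1 : θ < 1) :
    Integrable (Function.uncurry fun t u : ℝ => u ^ (-θ) • (resMul T t * resMul T (t * u)))
      ((volume.restrict (Ioi 0)).prod (volume.restrict (Ioi 0))) := by
  set K := ‖(1 : 𝔸)‖ + M + ‖T‖ * M with hK
  have hM := h.nonneg
  -- The choice satisfies `0 < σ < 1 - θ < τ < 1`: the middle inequalities give integrability in `u`
  -- at `0` and at infinity, the outer ones integrability in `t`.
  set σ := (1 - θ) / 2 with hσ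
  set τ := 1 - θ / 2 with hτ
  have hστ : σ ≤ τ := by rw [hσ, hτ]; linarith
  have hi1 : IntegrableOn (fun t : ℝ => K * K * (t ^ (-σ) * (min 1 t⁻¹) ^ (1 : ℝ) +
      t ^ (-τ) * (min 1 t⁻¹) ^ (1 : ℝ))) (Ioi 0) := by
    refine Integrable.const_mul (Integrable.add ?_ ?_) _
    · exact integrableOn_rpow_mul_min (by rw [hσ]; linarith) (by rw [hσ]; linarith)
    · exact integrableOn_rpow_mul_min (by rw [hτ]; linarith) (by rw [hτ]; linarith)
  have hi2 : IntegrableOn (fun u : ℝ => u ^ (-θ - σ) * (min 1 u⁻¹) ^ (τ - σ)) (Ioi 0) :=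
    integrableOn_rpow_mul_min (by rw [hσ]; linarith) (by rw [hτ]; linarith)
  have hcont : ContinuousOn
      (Function.uncurry fun t u : ℝ => u ^ (-θ) • (resMul T t * resMul T (t * u)))
      (Ioi (0 : ℝ) ×ˢ Ioi (0 : ℝ)) := by
    refine ContinuousOn.smul ?_ (ContinuousOn.mul ?_ ?_)
    · exact (continuousOn_rpow_Ioi (-θ)).comp continuousOn_snd (fun x hx => hx.2)
    · exact h.continuousOn_resMul.comp continuousOn_fst (fun x hx => hx.1)
    · exact h.continuousOn_resMul.comp (continuousOn_fst.mul continuousOn_snd)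
        (fun x hx => mul_pos (mem_Ioi.1 hx.1) (mem_Ioi.1 hx.2))
  refine (Integrable.mul_prod hi1 hi2).mono' ?_ ?_
  · rw [Measure.prod_restrict]
    exact hcont.aestronglyMeasurable (measurableSet_Ioi.prod measurableSet_Ioi)
  · rw [Measure.prod_restrict]
    filter_upwards [ae_restrict_mem (measurableSet_Ioi.prod measurableSet_Ioi)] with x hx
    obtain ⟨t, u⟩ := x
    have ht : 0 < t := hx.1
    have hu : 0 < u := hx.2
    have hm : 0 ≤ min 1 t⁻¹ := le_min zero_le_one (inv_nonneg.2 ht.le)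
    simp only [Function.uncurry_apply_pair, Real.rpow_one]
    rw [norm_smul, Real.norm_of_nonneg (Real.rpow_nonneg hu.le _), Real.rpow_sub hu,
      div_eq_mul_inv, ← Real.rpow_neg hu.le]
    have h1 := h.norm_resMul_le ht
    have h2 := (h.norm_resMul_le (mul_pos ht hu)).trans (mul_le_mul_of_nonneg_left
      (min_one_inv_mul_le_mul (σ := σ) (τ := τ) (by rw [hσ]; linarith) hστ
        (by rw [hτ]; linarith) ht hu) (show 0 ≤ K by positivity))
    have h3 := (norm_mul_le (resMul T t) (resMul T (t * u))).trans
      (mul_le_mul h1 h2 (norm_nonneg _) (by positivity))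
    refine (mul_le_mul_of_nonneg_left h3 (Real.rpow_nonneg hu.le (-θ))).trans (le_of_eq ?_)
    ring

/-- Substituting `s = t u` in the second factor makes the powers of `t` cancel. After Fubini the
inner integral is `balInt₂ T 1 u`, a scalar multiple of `T`. -/
theorem NonnegBound.balInt_mul_balInt (h : NonnegBound T M) {θ : ℝ} (hθ : 0 < θ) (hθ1 : θ < 1) :
    balInt T θ 1 * balInt T (1 - θ) 1 =
      (∫ u in Ioi (0 : ℝ), u ^ (-θ) * balInt₂ (1 : ℝ) 1 u) • T := by
  have hi1 : IntegrableOn (fun t : ℝ => t ^ (θ - 1) • resMul T t) (Ioi 0) := by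
    simpa using h.integrableOn_pow (n := 1) hθ (by simpa using hθ1)
  have hi2 : IntegrableOn (fun t : ℝ => t ^ (-θ) • resMul T t) (Ioi 0) := by
    simpa using h.integrableOn_pow (n := 1) (b := 1 - θ) (by linarith) (by simp [hθ])
  have e1 : balInt T θ 1 * balInt T (1 - θ) 1 = ∫ t in Ioi (0 : ℝ), ∫ u in Ioi (0 : ℝ),
      u ^ (-θ) • (resMul T t * resMul T (t * u)) := by
    simp only [balInt, pow_one, sub_sub_cancel_left]
    rw [← integral_mul_const_of_integrable hi1]
    refine setIntegral_congr_fun measurableSet_Ioi (fun t ht => ?_)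
    have ht' : (0 : ℝ) < t := ht
    have := integral_comp_mul_left_Ioi (fun s : ℝ => s ^ (-θ) • resMul T s) 0 ht'
    rw [mul_zero] at this
    have e2 : ∫ s in Ioi (0 : ℝ), s ^ (-θ) • resMul T s =
        t • ∫ u in Ioi (0 : ℝ), (t * u) ^ (-θ) • resMul T (t * u) := by
      rw [this, smul_smul, mul_inv_cancel₀ ht'.ne', one_smul]
    have hi3 : IntegrableOn (fun u : ℝ => (t * u) ^ (-θ) • resMul T (t * u)) (Ioi 0) :=
      (integrableOn_Ioi_comp_mul_left_iff (fun t : ℝ => t ^ (-θ) • resMul T t) 0 ht').2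
        (by simpa using hi2)
    have hs := integral_const_mul_of_integrable (c := t ^ (θ - 1) • resMul T t) (hi3.smul t)
    simp only [Pi.smul_apply] at hs
    rw [e2, ← integral_smul, ← hs]
    refine setIntegral_congr_fun measurableSet_Ioi (fun u hu => ?_)
    rw [Real.mul_rpow ht'.le (le_of_lt hu), smul_smul, smul_mul_smul_comm]
    congr 1
    have : t ^ (θ - 1) * t * t ^ (-θ) = 1 := by
      rw [← Real.rpow_add_one ht'.ne', ← Real.rpow_add ht']; simp
    calc t ^ (θ - 1) * (t * (t ^ (-θ) * u ^ (-θ))) = (t ^ (θ - 1) * t * t ^ (-θ)) * u ^ (-θ) := by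
          ring
      _ = _ := by rw [this, one_mul]
  rw [e1, integral_integral_swap (h.integrable_resMul_mul hθ hθ1), ← integral_smul_const]
  -- The evaluation of `balInt₂` divides by `u - 1`, so the null set `u = 1` is discarded.
  have hne : ∀ᵐ u : ℝ ∂volume.restrict (Ioi 0), u ≠ 1 := by
    refine ae_restrict_of_ae ?_
    simp [ae_iff]
  refine integral_congr_ae ?_
  filter_upwards [ae_restrict_mem measurableSet_Ioi, hne] with u hu hu1
  rw [integral_smul, mul_smul, ← h.balInt₂_one hu hu1, balInt₂]
  congr 1
  refine setIntegral_congr_fun measurableSet_Ioi (fun t ht => ?_)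
  simp [mul_comm u]

theorem balInt_one_pos {θ : ℝ} (hθ : 0 < θ) (hθ1 : θ < 1) : 0 < balInt (1 : ℝ) θ 1 := by
  have hi := nonnegBound_one.integrableOn_pow (n := 1) hθ (by simpa using hθ1)
  have hpos : ∀ t ∈ Ioi (0 : ℝ), 0 < t ^ (θ - 1) • resMul (1 : ℝ) t ^ 1 := by
    intro t ht
    have ht' : (0 : ℝ) < t := ht
    have := Real.rpow_pos_of_pos ht' (θ - 1)
    rw [resMul_one, pow_one, smul_eq_mul]; positivity
  rw [balInt, setIntegral_pos_iff_support_of_nonneg_ae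
    (by filter_upwards [ae_restrict_mem measurableSet_Ioi] with t ht using (hpos t ht).le) hi]
  have : (Function.support fun t : ℝ => t ^ (θ - 1) • resMul (1 : ℝ) t ^ 1) ∩ Ioi 0 = Ioi 0 := by
    refine inter_eq_right.2 fun t ht => (hpos t ht).ne'
  rw [this]; simp

variable (𝔸) in
-- The constant is read off from the scalar case `T = 1`. Only its positivity and its independence
-- of `T` matter later.
theorem exists_balPow_mul_balPow_of_lt_one {θ : ℝ} (hθ : 0 < θ) (hθ1 : θ < 1) :
    ∃ C : ℝ, 0 < C ∧ ∀ (T : 𝔸) (M : ℝ), NonnegBound T M →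
      balPow T θ * balPow T (1 - θ) = C • T := by
  refine ⟨balConst θ * balConst (1 - θ) * (balInt (1 : ℝ) θ 1 * balInt (1 : ℝ) (1 - θ) 1), ?_, ?_⟩
  · have h1 := balInt_one_pos hθ hθ1
    have h2 := balInt_one_pos (θ := 1 - θ) (by linarith) (by linarith)
    have h3 := balConst_pos hθ
    have h4 := balConst_pos (α := 1 - θ) (by linarith)
    positivity
  · intro T M h
    have f1 : ⌊θ⌋₊ = 0 := Nat.floor_eq_zero.2 hθ1
    have f2 : ⌊1 - θ⌋₊ = 0 := Nat.floor_eq_zero.2 (by linarith)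
    rw [nonnegBound_one.balInt_mul_balInt hθ hθ1, smul_eq_mul, mul_one, balPow, balPow, f1, f2,
      zero_add, smul_mul_smul_comm, h.balInt_mul_balInt hθ hθ1, smul_smul]

theorem NonnegBound.balPow_add_natCast (h : NonnegBound T M) {α : ℝ} (hα : 0 < α) (m : ℕ) :
    balPow T (α + m) = T ^ m * balPow T α := by
  induction m with
  | zero => simp
  | succ m ih =>
    rw [Nat.cast_succ, ← add_assoc, h.balPow_add_one (by positivity), ih, pow_succ', mul_assoc]

variable (𝔸) in
theorem exists_balPow_mul_balPow {α : ℝ} (hα : 0 < α) :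
    ∃ C : ℝ, 0 < C ∧ ∀ (T : 𝔸) (M : ℝ), NonnegBound T M →
      balPow T α * balPow T (⌊α⌋₊ + 1 - α) = C • T ^ (⌊α⌋₊ + 1) := by
  set m := ⌊α⌋₊ with hm
  have h1 : (m : ℝ) ≤ α := Nat.floor_le hα.le
  have h2 : α < m + 1 := Nat.lt_floor_add_one α
  -- For integral `α` the complementary exponent is `1`, not a number in `(0, 1)`, and the product
  -- formula is not available; the powers are then computed directly.
  rcases h1.eq_or_lt with h | h
  · refine ⟨1, one_pos, fun T M hT => ?_⟩
    rw [← h, add_sub_cancel_left, hT.balPow_one, one_smul]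
    obtain ⟨k, hk⟩ : ∃ k, m = k + 1 := Nat.exists_eq_succ_of_ne_zero (by
      rintro h0; rw [h0] at h; simp at h; linarith)
    rw [hk, Nat.cast_succ, add_comm, hT.balPow_add_natCast one_pos, hT.balPow_one, ← pow_succ,
      ← pow_succ]
  · obtain ⟨C, hC, H⟩ := exists_balPow_mul_balPow_of_lt_one 𝔸 (θ := α - m) (by linarith)
      (by linarith)
    refine ⟨C, hC, fun T M hT => ?_⟩
    have e1 : balPow T α = T ^ m * balPow T (α - m) := by
      rw [← hT.balPow_add_natCast (by linarith), sub_add_cancel]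
    have := H T M hT
    rw [show 1 - (α - m) = (m : ℝ) + 1 - α by ring] at this
    rw [e1, mul_assoc, this, mul_smul_comm, pow_succ]

end BalakrishnanProduct

theorem integral_rpow_mul_min_scale {α r : ℝ} (n : ℕ) (hr : 0 < r) :
    ∫ t in Ioi (0 : ℝ), t ^ (α - 1) * (min 1 (r * t⁻¹)) ^ (n : ℝ) =
      r ^ α * ∫ t in Ioi (0 : ℝ), t ^ (α - 1) * (min 1 t⁻¹) ^ (n : ℝ) := by
  have h := integral_comp_mul_left_Ioi
    (fun t : ℝ => t ^ (α - 1) * (min 1 (r * t⁻¹)) ^ (n : ℝ)) 0 hr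
  rw [mul_zero] at h
  have h2 : ∫ t in Ioi (0 : ℝ), (r * t) ^ (α - 1) * (min 1 (r * (r * t)⁻¹)) ^ (n : ℝ) =
      r ^ (α - 1) * ∫ t in Ioi (0 : ℝ), t ^ (α - 1) * (min 1 t⁻¹) ^ (n : ℝ) := by
    rw [← integral_const_mul]
    refine setIntegral_congr_fun measurableSet_Ioi fun t ht => ?_
    have ht' : (0 : ℝ) < t := ht
    have : r * (r * t)⁻¹ = t⁻¹ := by field_simp
    simp only [this]
    rw [Real.mul_rpow hr.le ht'.le, mul_assoc]
  rw [h2, smul_eq_mul] at h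
  have : r ^ α = r * r ^ (α - 1) := by rw [mul_comm, ← Real.rpow_add_one hr.ne', sub_add_cancel]
  rw [this, mul_assoc, h, ← mul_assoc, mul_inv_cancel₀ hr.ne', one_mul]

theorem integrableOn_rpow_mul_min_scale {α r : ℝ} {n : ℕ} (hα : 0 < α) (hn : α < n) (hr : 0 < r) :
    IntegrableOn (fun t : ℝ => t ^ (α - 1) * (min 1 (r * t⁻¹)) ^ (n : ℝ)) (Ioi 0) := by
  have h0 := integrableOn_rpow_mul_min (p := α - 1) (q := n) (by linarith) (by linarith)
  have h1 := (integrableOn_Ioi_comp_mul_left_iff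
    (fun t : ℝ => t ^ (α - 1) * (min 1 t⁻¹) ^ (n : ℝ)) 0 (inv_pos.2 hr)).2 (by simpa using h0)
  refine IntegrableOn.congr_fun (h1.const_mul (r ^ (α - 1))) (fun t ht => ?_) measurableSet_Ioi
  have ht' : (0 : ℝ) < t := ht
  rw [Real.mul_rpow (inv_pos.2 hr).le ht'.le, ← mul_assoc, ← mul_assoc,
    ← Real.mul_rpow hr.le (inv_pos.2 hr).le, mul_inv_cancel₀ hr.ne', Real.one_rpow, one_mul,
    mul_inv, inv_inv]

/-! ### Powers of complex numbers in the closed right half-plane -/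

/-- On the closed right half-plane there is no cancellation in `t + c`. All scalar estimates below
rest on this comparison. -/
theorem add_norm_le_two_mul {c : ℂ} (hc : 0 ≤ c.re) {t : ℝ} (ht : 0 ≤ t) :
    t + ‖c‖ ≤ 2 * ‖(t : ℂ) + c‖ := by
  have h1 : t ≤ ‖(t : ℂ) + c‖ := by
    refine le_trans ?_ (Complex.re_le_norm _)
    simp [hc]
  have h2 : ‖c‖ ≤ ‖(t : ℂ) + c‖ := by
    rw [Complex.norm_def, Complex.norm_def]
    refine Real.sqrt_le_sqrt ?_
    simp only [Complex.normSq_apply, Complex.add_re, Complex.ofReal_re, Complex.add_im,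
      Complex.ofReal_im, zero_add]
    nlinarith
  linarith

theorem ofReal_add_ne_zero {c : ℂ} (hc : 0 ≤ c.re) {t : ℝ} (ht : 0 < t) : (t : ℂ) + c ≠ 0 := by
  intro h
  have := add_norm_le_two_mul hc ht.le
  rw [h, norm_zero] at this
  linarith [norm_nonneg c]

theorem res_complex (c : ℂ) (t : ℝ) : res c t = ((t : ℂ) + c)⁻¹ := by
  simp [res, Ring.inverse_eq_inv']

theorem resMul_complex (c : ℂ) (t : ℝ) : resMul c t = c / ((t : ℂ) + c) := by
  rw [resMul, res_complex, div_eq_mul_inv]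

theorem nonnegBound_complex {c : ℂ} (hc : 0 ≤ c.re) : NonnegBound c 1 := by
  intro t ht
  have h : t • (1 : ℂ) + c ≠ 0 := by simpa using ofReal_add_ne_zero hc ht
  refine ⟨h.isUnit, ?_⟩
  rw [res_complex, norm_inv, one_div]
  refine inv_anti₀ ht ?_
  refine le_trans ?_ (Complex.re_le_norm _)
  simp [hc]

theorem norm_resMul_complex_le {c : ℂ} (hc : 0 ≤ c.re) {t : ℝ} (ht : 0 < t) :
    ‖resMul c t‖ ≤ 2 * min 1 (‖c‖ * t⁻¹) := by
  have h := add_norm_le_two_mul hc ht.le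
  have h0 : 0 < ‖(t : ℂ) + c‖ := norm_pos_iff.2 (ofReal_add_ne_zero hc ht)
  rw [resMul_complex, norm_div, div_le_iff₀ h0]
  have hn := norm_nonneg c
  rcases le_total 1 (‖c‖ * t⁻¹) with h1 | h1
  · rw [min_eq_left h1]; linarith
  · rw [min_eq_right h1]
    calc ‖c‖ = ‖c‖ * t⁻¹ * t := by field_simp
      _ ≤ ‖c‖ * t⁻¹ * (2 * ‖(t : ℂ) + c‖) := by gcongr; linarith
      _ = _ := by ring

/-- The majorant `min 1 (‖c‖ / t)` of `resMul c t` is homogeneous, so rescaling `t` by `‖c‖`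
extracts exactly `‖c‖ ^ α`. There is no need to identify `balPow c α` with a branch of the complex
power. -/
theorem exists_norm_balPow_complex_le {α : ℝ} (hα : 0 < α) :
    ∃ C : ℝ, 0 < C ∧ ∀ c : ℂ, 0 ≤ c.re → c ≠ 0 → ‖balPow c α‖ ≤ C * ‖c‖ ^ α := by
  set n := ⌊α⌋₊ + 1 with hn
  have hαn : α < (n : ℕ) := by rw [hn]; push_cast; exact Nat.lt_floor_add_one α
  set I := ∫ t in Ioi (0 : ℝ), t ^ (α - 1) * (min 1 t⁻¹) ^ (n : ℝ) with hI
  have hI0 : 0 ≤ I := by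
    refine setIntegral_nonneg measurableSet_Ioi fun t ht => ?_
    have : (0 : ℝ) ≤ t⁻¹ := inv_nonneg.2 (le_of_lt ht)
    exact mul_nonneg (Real.rpow_nonneg (le_of_lt ht) _) (Real.rpow_nonneg (by positivity) _)
  have hb := balConst_pos hα
  refine ⟨balConst α * (2 ^ n * I) + 1, by positivity, fun c hc h0 => ?_⟩
  have hc0 : 0 < ‖c‖ := norm_pos_iff.2 h0
  have h1 : ‖balInt c α n‖ ≤ 2 ^ n * (‖c‖ ^ α * I) := by
    rw [← integral_rpow_mul_min_scale n hc0, ← integral_const_mul]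
    refine norm_integral_le_of_norm_le
      ((integrableOn_rpow_mul_min_scale hα hαn hc0).const_mul _) ?_
    filter_upwards [ae_restrict_mem measurableSet_Ioi] with t ht
    have ht' : (0 : ℝ) < t := ht
    rw [norm_smul, Real.norm_of_nonneg (Real.rpow_nonneg ht'.le _), norm_pow, mul_left_comm,
      Real.rpow_natCast, ← mul_pow]
    have := Real.rpow_nonneg ht'.le (α - 1)
    gcongr
    exact norm_resMul_complex_le hc ht'
  rw [balPow, norm_smul, Real.norm_of_nonneg hb.le]
  have h3 := mul_le_mul_of_nonneg_left h1 hb.le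
  have h4 := Real.rpow_nonneg hc0.le α
  calc _ ≤ balConst α * (2 ^ n * (‖c‖ ^ α * I)) := h3
    _ = balConst α * (2 ^ n * I) * ‖c‖ ^ α := by ring
    _ ≤ _ := by gcongr; linarith

/-- The lower bound is the upper bound for the complementary power, read through the product
formula. -/
theorem exists_le_norm_balPow_complex {α : ℝ} (hα : 0 < α) :
    ∃ C : ℝ, 0 < C ∧ ∀ c : ℂ, 0 ≤ c.re → c ≠ 0 → ‖c‖ ^ α ≤ C * ‖balPow c α‖ := by
  have hα' : 0 < (⌊α⌋₊ : ℝ) + 1 - α := by linarith [Nat.lt_floor_add_one α]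
  obtain ⟨C, hC, H⟩ := exists_balPow_mul_balPow ℂ hα
  obtain ⟨D, hD, H'⟩ := exists_norm_balPow_complex_le hα'
  refine ⟨D / C, by positivity, fun c hc h0 => ?_⟩
  have hc0 : 0 < ‖c‖ := norm_pos_iff.2 h0
  have h1 := congrArg norm (H c 1 (nonnegBound_complex hc))
  rw [norm_mul, norm_smul, norm_pow, Real.norm_of_nonneg hC.le] at h1
  have h2 := H' c hc h0
  have h3 : ‖c‖ ^ (⌊α⌋₊ + 1) = ‖c‖ ^ α * ‖c‖ ^ ((⌊α⌋₊ : ℝ) + 1 - α) := by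
    rw [← Real.rpow_add hc0, add_sub_cancel, ← Nat.cast_succ, Real.rpow_natCast]
  have h4 : C * (‖c‖ ^ α * ‖c‖ ^ ((⌊α⌋₊ : ℝ) + 1 - α)) ≤
      (D * ‖balPow c α‖) * ‖c‖ ^ ((⌊α⌋₊ : ℝ) + 1 - α) := by
    rw [← h3, ← h1, mul_comm D, mul_assoc]
    exact mul_le_mul_of_nonneg_left h2 (norm_nonneg _)
  have h5 := Real.rpow_pos_of_pos hc0 ((⌊α⌋₊ : ℝ) + 1 - α)
  rw [← mul_assoc] at h4
  have h6 := le_of_mul_le_mul_right h4 h5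
  rw [div_mul_eq_mul_div, le_div_iff₀ hC]
  linarith

/-! ### Commuting an approximate eigenvalue relation past fractional powers -/

section Perturbation

variable {𝔸 : Type*} [NormedRing 𝔸] [NormedAlgebra ℂ 𝔸] {T : 𝔸} {M : ℝ}

/-- The hypothesis says that `T` acts behind `R` as the scalar `c` up to `E`. Multiplying `R (t + T)
= (t + c) R - E` by the resolvent on the right transfers this to `T (t + T)⁻¹`. -/
theorem NonnegBound.mul_resMul_of_mul_eq (h : NonnegBound T M) {R E : 𝔸} {c : ℂ} (hc : 0 ≤ c.re)
    (hR : R * T = c • R - E) {t : ℝ} (ht : 0 < t) :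
    R * resMul T t = resMul c t • R - ((t : ℂ) + c)⁻¹ • (E * (1 - resMul T t)) := by
  have hne := ofReal_add_ne_zero hc ht
  have h1 : R * (t • (1 : 𝔸) + T) = ((t : ℂ) + c) • R - E := by
    rw [mul_add, hR, mul_smul_comm, mul_one, add_smul, Complex.coe_smul]; abel
  have h2 : R = ((t : ℂ) + c) • (R * res T t) - E * res T t := by
    calc R = R * (t • (1 : 𝔸) + T) * res T t := by rw [mul_assoc, h.add_mul_res ht, mul_one]
      _ = _ := by rw [h1, sub_mul, smul_mul_assoc]
  have h3 : R * res T t = ((t : ℂ) + c)⁻¹ • (R + E * res T t) := by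
    rw [eq_inv_smul_iff₀ hne]
    nth_rewrite 2 [h2]; abel
  have h4 : t • (R * res T t) = R - R * resMul T t := by
    rw [← mul_smul_comm, h.smul_res ht, mul_sub, mul_one]
  have h5 : R * resMul T t = R - (t : ℂ) • (R * res T t) := by
    rw [Complex.coe_smul, h4]; abel
  have h6 : (t : ℂ) • res T t = 1 - resMul T t := by rw [Complex.coe_smul, h.smul_res ht]
  have h7 : resMul c t = 1 - t * ((t : ℂ) + c)⁻¹ := by
    rw [resMul_complex]; field_simp; ring
  rw [h5, h3, h7, ← h6, mul_smul_comm, smul_comm, smul_smul, sub_smul, one_smul, smul_add,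
    smul_smul, mul_comm (((t : ℂ) + c)⁻¹), sub_add_eq_sub_sub]

/-- A telescoping sum: each term moves `R` past one more factor, replacing it by the scalar. -/
theorem NonnegBound.mul_resMul_pow_of_mul_eq (h : NonnegBound T M) {R E : 𝔸} {c : ℂ}
    (hc : 0 ≤ c.re) (hR : R * T = c • R - E) {t : ℝ} (ht : 0 < t) (n : ℕ) :
    R * resMul T t ^ n - resMul c t ^ n • R = - ∑ k ∈ Finset.range n,
      (resMul c t ^ (n - 1 - k) * ((t : ℂ) + c)⁻¹) •
        (E * ((1 - resMul T t) * resMul T t ^ k)) := by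
  induction n with
  | zero => simp
  | succ n ih =>
    rw [Finset.sum_range_succ']
    have e0 : ∀ k ∈ Finset.range n, (resMul c t ^ (n + 1 - 1 - (k + 1)) * ((t : ℂ) + c)⁻¹) •
        (E * ((1 - resMul T t) * resMul T t ^ (k + 1))) =
        ((resMul c t ^ (n - 1 - k) * ((t : ℂ) + c)⁻¹) •
        (E * ((1 - resMul T t) * resMul T t ^ k))) * resMul T t := by
      intro k _
      rw [smul_mul_assoc, mul_assoc E, mul_assoc (1 - resMul T t), ← pow_succ]
      congr 3
      omega
    rw [Finset.sum_congr rfl e0, ← Finset.sum_mul, neg_add, ← neg_mul, ← ih, sub_mul, mul_assoc,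
      ← pow_succ, smul_mul_assoc, h.mul_resMul_of_mul_eq hc hR ht, smul_sub, smul_smul, smul_smul,
      ← pow_succ]
    simp only [Nat.add_sub_cancel, Nat.sub_zero, pow_zero, mul_one]
    abel

/-- Interpolation between `1/t` and `1/‖c‖`: the price `‖c‖ ^ (δ - 1)` buys the milder singularity
`t ^ (-δ)` at the origin, which is integrable against `t ^ (α - 1)` as soon as `δ < α`. -/
theorem inv_norm_add_le {c : ℂ} (hc : 0 ≤ c.re) (hc0 : c ≠ 0) {δ : ℝ} (hδ : 0 < δ) (hδ1 : δ ≤ 1)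
    {t : ℝ} (ht : 0 < t) :
    ‖((t : ℂ) + c)⁻¹‖ ≤ 2 * (1 + ‖c‖ ^ (δ - 1)) * (t ^ (-δ) * (min 1 t⁻¹) ^ (1 - δ)) := by
  have hn : 0 < ‖c‖ := norm_pos_iff.2 hc0
  have h := add_norm_le_two_mul hc ht.le
  have h1 : ‖((t : ℂ) + c)⁻¹‖ ≤ 2 * (t + ‖c‖)⁻¹ := by
    rw [norm_inv, ← div_eq_mul_inv, le_div_iff₀ (by positivity), inv_mul_le_iff₀
      (norm_pos_iff.2 (ofReal_add_ne_zero hc ht))]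
    linarith
  refine h1.trans ?_
  rw [mul_assoc]
  refine mul_le_mul_of_nonneg_left ?_ zero_le_two
  have hp := Real.rpow_pos_of_pos hn (δ - 1)
  have ht2 := Real.rpow_pos_of_pos ht (-δ)
  rcases le_total t 1 with h2 | h2
  · rw [min_eq_left (one_le_inv_iff₀.2 ⟨ht, h2⟩), Real.one_rpow, mul_one]
    have h3 : (t + ‖c‖)⁻¹ ≤ ‖c‖ ^ (δ - 1) * t ^ (-δ) := by
      have a1 : ‖c‖ ^ (1 - δ) ≤ (t + ‖c‖) ^ (1 - δ) :=
        Real.rpow_le_rpow hn.le (by linarith) (by linarith)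
      have a2 : t ^ δ ≤ (t + ‖c‖) ^ δ := Real.rpow_le_rpow ht.le (by linarith) hδ.le
      have a3 : t + ‖c‖ = (t + ‖c‖) ^ (1 - δ) * (t + ‖c‖) ^ δ := by
        rw [← Real.rpow_add (by positivity)]; simp
      have a4 : ‖c‖ ^ (δ - 1) * t ^ (-δ) = (‖c‖ ^ (1 - δ) * t ^ δ)⁻¹ := by
        rw [mul_inv, ← Real.rpow_neg hn.le, ← Real.rpow_neg ht.le, neg_sub]
      have a5 := Real.rpow_pos_of_pos hn (1 - δ)
      have a6 := Real.rpow_pos_of_pos ht δ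
      rw [a4]
      refine inv_anti₀ (by positivity) ?_
      rw [a3]
      gcongr
    nlinarith
  · rw [min_eq_right (inv_le_one_of_one_le₀ h2), Real.inv_rpow ht.le, ← Real.rpow_neg ht.le,
      ← Real.rpow_add ht]
    have : -δ + -(1 - δ) = -1 := by ring
    rw [this, Real.rpow_neg_one]
    have h3 : (t + ‖c‖)⁻¹ ≤ t⁻¹ := inv_anti₀ ht (by linarith)
    have h4 : 0 < t⁻¹ := inv_pos.2 ht
    nlinarith

theorem NonnegBound.norm_mul_resMul_pow_sub_le (h : NonnegBound T M) {R E : 𝔸} {c : ℂ} {K δ : ℝ}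
    (hc : 0 ≤ c.re) (hc0 : c ≠ 0) (hδ : 0 < δ) (hδ1 : δ ≤ 1) (hcK : 2 * (1 + ‖c‖) ≤ K)
    (hTK : ‖(1 : 𝔸)‖ + M + ‖T‖ * M ≤ K) (h1K : ‖(1 : 𝔸)‖ ≤ K)
    (hR : R * T = c • R - E) (n : ℕ) {t : ℝ} (ht : 0 < t) :
    ‖R * resMul T t ^ (n + 1) - resMul c t ^ (n + 1) • R‖ ≤
      (n + 1) * (K ^ n * (2 * K * K) * 2) * (‖E‖ * (1 + ‖c‖ ^ (δ - 1))) *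
        (t ^ (-δ) * (min 1 t⁻¹) ^ ((n : ℝ) + 1 - δ)) := by
  set m := min 1 t⁻¹ with hm
  have hm0 : 0 < m := lt_min one_pos (inv_pos.2 ht)
  have hm1 : m ≤ 1 := min_le_left _ _
  have hnc := norm_nonneg c
  have hK : 0 < K := by linarith
  have hT : ‖resMul T t‖ ≤ K * m := (h.norm_resMul_le ht).trans (by gcongr)
  have hcm : ‖resMul c t‖ ≤ K * m := by
    refine (norm_resMul_complex_le hc ht).trans ?_
    have h1 : min 1 (‖c‖ * t⁻¹) ≤ (1 + ‖c‖) * m := by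
      have h2 : 0 < t⁻¹ := inv_pos.2 ht
      rw [hm]
      rcases le_total 1 t⁻¹ with h3 | h3
      · rw [min_eq_left h3]; exact (min_le_left _ _).trans (by linarith)
      · rw [min_eq_right h3]; exact (min_le_right _ _).trans (by nlinarith)
    calc 2 * min 1 (‖c‖ * t⁻¹) ≤ 2 * ((1 + ‖c‖) * m) := by gcongr
      _ = 2 * (1 + ‖c‖) * m := by ring
      _ ≤ K * m := by gcongr
  have hP : ∀ k : ℕ, ‖(1 - resMul T t) * resMul T t ^ k‖ ≤ 2 * K * K * (K * m) ^ k := by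
    intro k
    have h1 : ‖1 - resMul T t‖ ≤ 2 * K := by
      refine (norm_sub_le _ _).trans ?_
      have : K * m ≤ K := mul_le_of_le_one_right hK.le hm1
      linarith
    have h2 : ‖resMul T t ^ k‖ ≤ K * (K * m) ^ k := by
      induction k with
      | zero => simpa using h1K
      | succ k ih =>
        rw [pow_succ, pow_succ, ← mul_assoc]
        exact (norm_mul_le _ _).trans (mul_le_mul ih hT (norm_nonneg _) (by positivity))
    refine (norm_mul_le _ _).trans ((mul_le_mul h1 h2 (norm_nonneg _) (by positivity)).trans
      (le_of_eq (by ring)))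
  rw [h.mul_resMul_pow_of_mul_eq hc hR ht, norm_neg]
  set B := ‖((t : ℂ) + c)⁻¹‖ with hB
  have hterm : ∀ k ∈ Finset.range (n + 1),
      ‖(resMul c t ^ (n + 1 - 1 - k) * ((t : ℂ) + c)⁻¹) •
        (E * ((1 - resMul T t) * resMul T t ^ k))‖ ≤ (K * m) ^ n * (2 * K * K) * ‖E‖ * B := by
    intro k hk
    have hk' : k ≤ n := Nat.lt_succ_iff.1 (Finset.mem_range.1 hk)
    rw [norm_smul, norm_mul, norm_pow, Nat.add_sub_cancel]
    have h1 : ‖resMul c t‖ ^ (n - k) ≤ (K * m) ^ (n - k) := by gcongr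
    have h2 := (norm_mul_le E ((1 - resMul T t) * resMul T t ^ k)).trans
      (mul_le_mul_of_nonneg_left (hP k) (norm_nonneg E))
    calc ‖resMul c t‖ ^ (n - k) * B * ‖E * ((1 - resMul T t) * resMul T t ^ k)‖
        ≤ (K * m) ^ (n - k) * B * (‖E‖ * (2 * K * K * (K * m) ^ k)) := by gcongr
      _ = ((K * m) ^ (n - k) * (K * m) ^ k) * (2 * K * K) * ‖E‖ * B := by ring
      _ = _ := by rw [← pow_add, Nat.sub_add_cancel hk']
  refine (norm_sum_le_of_le _ hterm).trans ?_
  rw [Finset.sum_const, Finset.card_range, nsmul_eq_mul]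
  have hBle := inv_norm_add_le hc hc0 hδ hδ1 ht
  have e : m ^ ((n : ℝ) + 1 - δ) = m ^ n * m ^ (1 - δ) := by
    rw [← Real.rpow_natCast, ← Real.rpow_add hm0]; congr 1; ring
  push_cast
  calc ((n : ℝ) + 1) * ((K * m) ^ n * (2 * K * K) * ‖E‖ * B)
      ≤ ((n : ℝ) + 1) * ((K * m) ^ n * (2 * K * K) * ‖E‖ *
          (2 * (1 + ‖c‖ ^ (δ - 1)) * (t ^ (-δ) * m ^ (1 - δ)))) := by gcongr
    _ = _ := by rw [e, mul_pow]; ring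

variable [CompleteSpace 𝔸]

variable (𝔸) in
-- The approximate eigenvalue relation passes to fractional powers by integrating the telescoped
-- identity. The constant depends on `T`, `R`, `E`, `c` only through `M` and `K`. This gives
-- uniformity in the spectral parameter; for `E = c T` the error is of order `‖c‖ ^ δ` when `‖c‖ ≤
-- 1`.
theorem exists_norm_mul_balPow_sub_le {α δ : ℝ} (hα : 0 < α) (hδ : 0 < δ) (hδ1 : δ ≤ 1)
    (hδα : δ < α) (M K : ℝ) : ∃ C : ℝ, 0 < C ∧ ∀ (T R E : 𝔸) (c : ℂ), NonnegBound T M →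
      ‖T‖ ≤ K → 0 ≤ c.re → c ≠ 0 → ‖c‖ ≤ K → R * T = c • R - E →
      ‖R * balPow T α - balPow c α • R‖ ≤ C * (‖E‖ * (1 + ‖c‖ ^ (δ - 1))) := by
  set n := ⌊α⌋₊ with hn
  have hαn : α < ((n + 1 : ℕ) : ℝ) := by rw [hn]; push_cast; exact Nat.lt_floor_add_one α
  set L := 2 * (1 + |K|) + ‖(1 : 𝔸)‖ + |M| + |K| * |M| with hL
  have hL0 : 0 ≤ L := by positivity
  -- Convergence at `0` is `δ < α`; at infinity the exponents combine to `α - n - 2 < -1`.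
  have hi := integrableOn_rpow_mul_min (p := α - 1 - δ) (q := (n : ℝ) + 1 - δ)
    (by linarith) (by push_cast at hαn; linarith)
  set I := ∫ t in Ioi (0 : ℝ), t ^ (α - 1 - δ) * (min 1 t⁻¹) ^ ((n : ℝ) + 1 - δ) with hI
  have hI0 : 0 ≤ I := by
    refine setIntegral_nonneg measurableSet_Ioi fun t ht => ?_
    have : (0 : ℝ) ≤ t⁻¹ := inv_nonneg.2 (le_of_lt ht)
    exact mul_nonneg (Real.rpow_nonneg (le_of_lt ht) _) (Real.rpow_nonneg (by positivity) _)
  set D := ((n : ℝ) + 1) * (L ^ n * (2 * L * L) * 2) with hD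
  have hD0 : 0 ≤ D := by positivity
  have hb := balConst_pos hα
  refine ⟨balConst α * (D * I) + 1, by positivity, ?_⟩
  intro T R E c hT hTK hc hc0 hcK hR
  have hM := hT.nonneg
  have hcL : 2 * (1 + ‖c‖) ≤ L := by
    have : 0 ≤ ‖(1 : 𝔸)‖ + |M| + |K| * |M| := by positivity
    have := hcK.trans (le_abs_self K)
    rw [hL]; linarith
  have hTL : ‖(1 : 𝔸)‖ + M + ‖T‖ * M ≤ L := by
    have h1 : ‖T‖ * M ≤ |K| * |M| :=
      mul_le_mul (hTK.trans (le_abs_self K)) (le_abs_self M) hM (abs_nonneg K)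
    have := le_abs_self M
    have := abs_nonneg K
    rw [hL]; linarith
  have h1L : ‖(1 : 𝔸)‖ ≤ L := by
    have : 0 ≤ 2 * (1 + |K|) + |M| + |K| * |M| := by positivity
    rw [hL]; linarith
  set S := ‖E‖ * (1 + ‖c‖ ^ (δ - 1)) with hS
  have hS0 : 0 ≤ S := by positivity
  have i1 := hT.integrableOn_pow hα hαn
  have i2 := (nonnegBound_complex hc).integrableOn_pow hα hαn
  have e1 : R * balPow T α - balPow c α • R = balConst α •
      ∫ t in Ioi (0 : ℝ), t ^ (α - 1) •
        (R * resMul T t ^ (n + 1) - resMul c t ^ (n + 1) • R) := by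
    have h1 : R * balInt T α (n + 1) =
        ∫ t in Ioi (0 : ℝ), t ^ (α - 1) • (R * resMul T t ^ (n + 1)) := by
      rw [balInt, ← integral_const_mul_of_integrable i1]
      simp only [mul_smul_comm]
    have h2 : balInt c α (n + 1) • R =
        ∫ t in Ioi (0 : ℝ), t ^ (α - 1) • (resMul c t ^ (n + 1) • R) := by
      rw [balInt, ← integral_smul_const]
      simp only [smul_assoc]
    have j1 : IntegrableOn (fun t : ℝ => t ^ (α - 1) • (R * resMul T t ^ (n + 1))) (Ioi 0) := by
      have := i1.const_mul R
      simp only [mul_smul_comm] at this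
      exact this
    have j2 : IntegrableOn (fun t : ℝ => t ^ (α - 1) • (resMul c t ^ (n + 1) • R)) (Ioi 0) := by
      have := Integrable.smul_const i2 R
      simp only [smul_assoc] at this
      exact this
    rw [balPow, balPow, mul_smul_comm, smul_assoc, ← smul_sub, h1, h2, ← integral_sub j1 j2]
    simp only [smul_sub]
  have e2 : ‖∫ t in Ioi (0 : ℝ), t ^ (α - 1) •
      (R * resMul T t ^ (n + 1) - resMul c t ^ (n + 1) • R)‖ ≤ D * S * I := by
    rw [hI, ← integral_const_mul]
    refine norm_integral_le_of_norm_le (hi.const_mul _) ?_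
    filter_upwards [ae_restrict_mem measurableSet_Ioi] with t ht
    have ht' : (0 : ℝ) < t := ht
    have hp := Real.rpow_nonneg ht'.le (α - 1)
    rw [norm_smul, Real.norm_of_nonneg hp]
    refine (mul_le_mul_of_nonneg_left (hT.norm_mul_resMul_pow_sub_le hc hc0 hδ hδ1 hcL hTL h1L hR n
      ht') hp).trans (le_of_eq ?_)
    rw [sub_eq_add_neg (α - 1), Real.rpow_add ht']
    ring
  rw [e1, norm_smul, Real.norm_of_nonneg hb.le]
  calc _ ≤ balConst α * (D * S * I) := mul_le_mul_of_nonneg_left e2 hb.le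
    _ = balConst α * (D * I) * S := by ring
    _ ≤ _ := by gcongr; linarith

end Perturbation

section Commute

variable {𝔸 : Type*} [NormedRing 𝔸] [NormedAlgebra ℝ 𝔸] [CompleteSpace 𝔸] {T : 𝔸} {M : ℝ}

theorem NonnegBound.commute_balInt (h : NonnegBound T M) {S : 𝔸} (hS : Commute S T) {b : ℝ}
    {n : ℕ} (hb : 0 < b) (hn : b < n) : Commute S (balInt T b n) := by
  have hi := h.integrableOn_pow hb hn
  rw [Commute, SemiconjBy, balInt, ← integral_const_mul_of_integrable hi,
    ← integral_mul_const_of_integrable hi]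
  refine setIntegral_congr_fun measurableSet_Ioi fun t ht => ?_
  rw [mul_smul_comm, smul_mul_assoc, ((h.commute_resMul hS ht).pow_right n).eq]

theorem NonnegBound.commute_balPow (h : NonnegBound T M) {S : 𝔸} (hS : Commute S T) {α : ℝ}
    (hα : 0 < α) : Commute S (balPow T α) :=
  (h.commute_balInt hS hα (by push_cast; exact Nat.lt_floor_add_one α)).smul_right _

end Commute

theorem fracPow_eq_balPow {X : Type*} [NormedAddCommGroup X] [NormedSpace ℂ X] (T : X →L[ℂ] X)
    (α : ℝ) : fracPow T α = balPow T α := by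
  simp only [fracPow, balPow, balInt, resMul, res, balConst, Complex.coe_smul]

/-! ### Reciprocals of rational complete Bernstein functions -/

/-- Spectral data of the rank-one perturbation `diag(s) - v vᵀ / τ`. -/
theorem exists_rankOne_spectral_data {ι : Type*} [Fintype ι] [DecidableEq ι] (s v : ι → ℝ) {τ : ℝ}
    (hs : ∀ i, 0 < s i) (hτ : ∑ i, v i ^ 2 / s i < τ) :
    ∃ (U : ι → ι → ℝ) (l w : ι → ℝ), (∀ j, 0 < l j) ∧
      (∀ i j, (s i - l j) * U i j = v i * w j / τ) ∧
      (∀ j, ∑ i, v i * U i j = w j) ∧ ∀ i, ∑ j, w j * U i j = v i := by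
  have hτ0 : 0 < τ := lt_of_le_of_lt
    (Finset.sum_nonneg fun i _ => div_nonneg (sq_nonneg _) (hs i).le) hτ
  set H : Matrix ι ι ℝ := Matrix.diagonal s - τ⁻¹ • Matrix.vecMulVec v v with hH
  have hh : H.IsHermitian := by
    ext i j
    simp only [hH, Matrix.conjTranspose_apply, Matrix.sub_apply, Matrix.smul_apply,
      Matrix.vecMulVec_apply, star_trivial, smul_eq_mul, Matrix.diagonal_apply]
    rcases eq_or_ne i j with rfl | h
    · rfl
    · simp only [if_neg h, if_neg h.symm]; ring
  set e := hh.eigenvectorBasis with he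
  set l := hh.eigenvalues with hl
  set w : ι → ℝ := fun j => ∑ i, v i * e j i with hw
  have hmul : ∀ i j, s i * e j i - τ⁻¹ * (v i * w j) = l j * e j i := by
    intro i j
    have hx : ∀ x : ι → ℝ, H.mulVec x i = s i * x i - τ⁻¹ * (v i * ∑ k, v k * x k) := by
      intro x
      rw [hH, Matrix.sub_mulVec]
      simp only [Pi.sub_apply, Matrix.mulVec_diagonal, Matrix.smul_mulVec, Pi.smul_apply,
        smul_eq_mul]
      rw [Matrix.mulVec]
      simp only [dotProduct, Matrix.vecMulVec_apply, mul_assoc, ← Finset.mul_sum]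
    have h := congrFun (hh.mulVec_eigenvectorBasis j) i
    rw [hx] at h
    exact h
  have hone : ∀ j, ∑ i, e j i ^ 2 = 1 := by
    intro j
    have := e.orthonormal.1 j
    rw [EuclideanSpace.norm_eq, Real.sqrt_eq_one] at this
    simpa using this
  refine ⟨fun i j => e j i, l, w, fun j => ?_, fun i j => ?_, fun j => rfl, fun i => ?_⟩
  · have h1 : l j = ∑ i, s i * e j i ^ 2 - τ⁻¹ * w j ^ 2 := by
      calc l j = ∑ i, l j * e j i * e j i := by
            simp only [mul_assoc, ← sq]; rw [← Finset.mul_sum, hone, mul_one]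
        _ = ∑ i, (s i * e j i ^ 2 - τ⁻¹ * w j * (v i * e j i)) := by
            refine Finset.sum_congr rfl fun i _ => ?_
            rw [← hmul i j]; ring
        _ = _ := by rw [Finset.sum_sub_distrib, ← Finset.mul_sum]; simp only [hw]; ring
    set Q := ∑ i, s i * e j i ^ 2 with hQ
    have hQ0 : 0 < Q := by
      have h0 : 0 ≤ Q := Finset.sum_nonneg fun i _ => mul_nonneg (hs i).le (sq_nonneg _)
      refine lt_of_le_of_ne h0 fun hz => ?_
      have h2 := (Finset.sum_eq_zero_iff_of_nonneg
        (fun i _ => mul_nonneg (hs i).le (sq_nonneg (e j i)))).1 hz.symm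
      have h3 := hone j
      rw [Finset.sum_eq_zero] at h3
      · exact zero_ne_one h3
      · intro i hi
        have := h2 i hi
        rcases mul_eq_zero.1 this with h4 | h4
        · exact absurd h4 (hs i).ne'
        · exact h4
    -- The eigenvalue is the Rayleigh quotient `Q - w² / τ`. Cauchy-Schwarz and the hypothesis on
    -- `τ` give `w² < τ Q`, hence positivity.
    have h2 : w j ^ 2 ≤ (∑ i, v i ^ 2 / s i) * Q := by
      refine Finset.sum_sq_le_sum_mul_sum_of_sq_le_mul _ (fun i _ => by have := hs i; positivity)
        (fun i _ => by have := hs i; positivity) (fun i _ => ?_)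
      have := (hs i).ne'
      refine le_of_eq ?_
      field_simp
    rw [h1, sub_pos, inv_mul_lt_iff₀ hτ0]
    exact h2.trans_lt (mul_lt_mul_of_pos_right hτ hQ0)
  · have := hmul i j
    simp only [sub_mul, div_eq_inv_mul]
    linarith
  · have hx := congrArg (fun x : EuclideanSpace ℝ ι => x i)
      (e.sum_repr (WithLp.toLp 2 v))
    have hr : ∀ j, e.repr (WithLp.toLp 2 v) j = w j := by
      intro j
      rw [e.repr_apply_apply]
      simp [PiLp.inner_apply, hw]
    simp only [hr] at hx
    simpa using hx

/-! ### Reciprocals as positive combinations of resolvents -/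

section PseudoResolvent

variable {𝔸 : Type*} [Ring 𝔸] [Algebra ℝ 𝔸]

/-- The resolvent identity for a family `R s = (s + A)⁻¹`, `s > 0`. -/
def IsPseudoResolvent (R : ℝ → 𝔸) : Prop :=
  ∀ s u : ℝ, 0 < s → 0 < u → R s - R u = (u - s) • (R s * R u)

theorem IsPseudoResolvent.commute {R : ℝ → 𝔸} (hR : IsPseudoResolvent R) {s u : ℝ} (hs : 0 < s)
    (hu : 0 < u) : Commute (R s) (R u) := by
  rcases eq_or_ne s u with rfl | h
  · exact Commute.refl _
  · have h1 := hR s u hs hu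
    have h2 := hR u s hu hs
    have h3 : (u - s) • (R s * R u) = (u - s) • (R u * R s) := by
      rw [← h1, ← neg_sub, h2, ← neg_smul, neg_sub]
    have hne : u - s ≠ 0 := sub_ne_zero.2 h.symm
    calc R s * R u = (u - s)⁻¹ • ((u - s) • (R s * R u)) := by rw [inv_smul_smul₀ hne]
      _ = _ := by rw [h3, inv_smul_smul₀ hne]

theorem isPseudoResolvent_inv_add {x : ℝ} (hx : 0 ≤ x) :
    IsPseudoResolvent fun s : ℝ => (s + x)⁻¹ := by
  intro s u hs hu
  have h1 : s + x ≠ 0 := by positivity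
  have h2 : u + x ≠ 0 := by positivity
  simp only [smul_eq_mul]
  field_simp
  ring

/-- If `τ - ∑ mᵢ sᵢ R(sᵢ)` is a rational complete Bernstein function of the generator, its
reciprocal is the rational Stieltjes function `1/τ + ∑ wⱼ R(lⱼ)`. -/
def IsReciprocalData {ι : Type*} [Fintype ι] (τ : ℝ) (s m l w : ι → ℝ) : Prop :=
  ∃ (v z : ι → ℝ) (U : ι → ι → ℝ), (∀ i, v i ^ 2 = m i * s i) ∧ (∀ j, w j = (z j / τ) ^ 2) ∧
      (∀ i j, (s i - l j) * U i j = v i * z j / τ) ∧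
      (∀ j, ∑ i, v i * U i j = z j) ∧ ∀ i, ∑ j, z j * U i j = v i

/-- The resolvent identity turns `(s i - l j) R (s i) R (l j)` into a difference, and the
eigenvector equation supplies precisely the factor `s i - l j`. No division by it occurs, so
coincidences between nodes and eigenvalues are harmless. Summation uses the two expansions of `v`
and `z` in `U`. -/
theorem IsReciprocalData.mul_eq_one {ι : Type*} [Fintype ι] {τ : ℝ} {s m l w : ι → ℝ}
    (h : IsReciprocalData τ s m l w) (hτ : 0 < τ) (hs : ∀ i, 0 < s i) (hl : ∀ j, 0 < l j)
    {R : ℝ → 𝔸} (hR : IsPseudoResolvent R) :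
    (τ • (1 : 𝔸) - ∑ i, (m i * s i) • R (s i)) * (τ⁻¹ • (1 : 𝔸) + ∑ j, w j • R (l j)) = 1 := by
  obtain ⟨v, z, U, hv, hw, hU, hz, hv2⟩ := h
  set P := ∑ i, (m i * s i) • R (s i) with hP
  set Q := ∑ j, (z j ^ 2) • R (l j) with hQ
  have hwQ : ∑ j, w j • R (l j) = (τ⁻¹ ^ 2) • Q := by
    rw [hQ, Finset.smul_sum]
    refine Finset.sum_congr rfl fun j _ => ?_
    rw [hw, smul_smul]; congr 1; rw [div_eq_inv_mul, mul_pow]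
  have key : P * Q = τ • (Q - P) := by
    have h1 : P * Q = ∑ i, ∑ j, (v i ^ 2 * z j ^ 2) • (R (s i) * R (l j)) := by
      rw [hP, hQ, Finset.sum_mul_sum]
      refine Finset.sum_congr rfl fun i _ => Finset.sum_congr rfl fun j _ => ?_
      rw [smul_mul_smul_comm, hv]
    have h2 : ∀ i j, (v i ^ 2 * z j ^ 2) • (R (s i) * R (l j)) =
        τ • ((v i * z j * U i j) • (R (l j) - R (s i))) := by
      intro i j
      have e1 : (s i - l j) • (R (s i) * R (l j)) = R (l j) - R (s i) := by
        rw [hR (l j) (s i) (hl j) (hs i), (hR.commute (hl j) (hs i)).eq]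
      rw [← e1, smul_smul, smul_smul]
      congr 1
      have := hU i j
      rw [eq_div_iff hτ.ne'] at this
      calc v i ^ 2 * z j ^ 2 = (v i * z j) * (v i * z j) := by ring
        _ = (v i * z j) * ((s i - l j) * U i j * τ) := by rw [this]
        _ = _ := by ring
    have h3 : Q = ∑ i, ∑ j, (v i * z j * U i j) • R (l j) := by
      rw [Finset.sum_comm, hQ]
      refine Finset.sum_congr rfl fun j _ => ?_
      rw [← Finset.sum_smul]
      congr 1
      calc z j ^ 2 = z j * ∑ i, v i * U i j := by rw [hz, sq]
        _ = _ := by rw [Finset.mul_sum]; exact Finset.sum_congr rfl fun i _ => by ring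
    have h4 : P = ∑ i, ∑ j, (v i * z j * U i j) • R (s i) := by
      rw [hP]
      refine Finset.sum_congr rfl fun i _ => ?_
      rw [← Finset.sum_smul, ← hv]
      congr 1
      calc v i ^ 2 = v i * ∑ j, z j * U i j := by rw [hv2, sq]
        _ = _ := by rw [Finset.mul_sum]; exact Finset.sum_congr rfl fun i _ => by ring
    rw [h1, h3, h4, ← Finset.sum_sub_distrib, Finset.smul_sum]
    refine Finset.sum_congr rfl fun i _ => ?_
    rw [← Finset.sum_sub_distrib, Finset.smul_sum]
    refine Finset.sum_congr rfl fun j _ => ?_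
    rw [h2, smul_sub (v i * z j * U i j)]
  rw [hwQ, sub_mul, mul_add, mul_add, smul_mul_smul_comm, mul_one, mul_inv_cancel₀ hτ.ne',
    one_smul, smul_mul_assoc, one_mul, mul_smul_comm, mul_smul_comm, key, mul_one, smul_smul,
    smul_smul]
  have e1 : τ * τ⁻¹ ^ 2 = τ⁻¹ := by field_simp
  have e2 : τ⁻¹ ^ 2 * τ = τ⁻¹ := by field_simp
  rw [e1, e2, smul_sub]
  abel

theorem exists_isReciprocalData {ι : Type*} [Fintype ι] (s m : ι → ℝ) {τ₀ : ℝ}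
    (hτ₀ : 0 < τ₀) (hs : ∀ i, 0 < s i) (hm : ∀ i, 0 ≤ m i) :
    ∃ l w : ι → ℝ, (∀ j, 0 < l j) ∧ (∀ j, 0 ≤ w j) ∧
      IsReciprocalData (τ₀ + ∑ i, m i) s m l w ∧
      (τ₀ + ∑ i, m i)⁻¹ + ∑ j, w j / l j = τ₀⁻¹ := by
  classical
  have hsum : 0 ≤ ∑ i, m i := Finset.sum_nonneg fun i _ => hm i
  set τ := τ₀ + ∑ i, m i with hτ
  have hτ0 : 0 < τ := by positivity
  have hv : ∀ i, √(m i * s i) ^ 2 = m i * s i := fun i =>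
    Real.sq_sqrt (mul_nonneg (hm i) (hs i).le)
  -- With `v i = √(m i * s i)` the sum of `v i ^ 2 / s i` is `∑ m i`, which is smaller than `τ`
  -- exactly because `τ₀ > 0`.
  obtain ⟨U, l, z, hl, hU, hz, hv2⟩ := exists_rankOne_spectral_data s (fun i => √(m i * s i))
    (τ := τ) hs (by
      have : ∀ i, √(m i * s i) ^ 2 / s i = m i := fun i => by
        rw [hv, mul_div_assoc, div_self (hs i).ne', mul_one]
      simp only [this]; linarith)
  have hd : IsReciprocalData τ s m l fun j => (z j / τ) ^ 2 :=
    ⟨_, z, U, hv, fun j => rfl, hU, hz, hv2⟩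
  refine ⟨l, fun j => (z j / τ) ^ 2, hl, fun j => sq_nonneg _, hd, ?_⟩
  -- Evaluating the identity at the scalar point `0`, where the function equals `τ₀`, gives the
  -- total weight; this later becomes the norm bound for the inverse.
  have h1 := hd.mul_eq_one hτ0 hs hl (isPseudoResolvent_inv_add le_rfl)
  have h2 : τ • (1 : ℝ) - ∑ i, (m i * s i) • (s i + 0)⁻¹ = τ₀ := by
    have : ∀ i, (m i * s i) • (s i + 0)⁻¹ = m i := fun i => by
      rw [add_zero, smul_eq_mul, mul_assoc, mul_inv_cancel₀ (hs i).ne', mul_one]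
    simp only [this, smul_eq_mul, mul_one, hτ]; ring
  rw [h2] at h1
  simp only [smul_eq_mul, mul_one, add_zero, ← div_eq_mul_inv] at h1
  exact eq_inv_of_mul_eq_one_right h1

end PseudoResolvent

section

open scoped NNReal

/-! ### Integrals in closed convex cones -/

theorem integral_mem_of_isClosed {E : Type*} [NormedAddCommGroup E] [NormedSpace ℝ E]
    [CompleteSpace E] (K : Submodule ℝ≥0 E) (hK : IsClosed (K : Set E)) {Ω : Type*}
    [MeasurableSpace Ω] {μ : Measure Ω} {f : Ω → E} (hf : Integrable f μ)
    (hmem : ∀ᵐ x ∂μ, f x ∈ K) : ∫ x, f x ∂μ ∈ K := by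
  by_contra hnot
  have hconv : Convex ℝ (K : Set E) := by
    intro x hx y hy a b ha hb _
    exact K.add_mem (K.smul_mem (⟨a, ha⟩ : ℝ≥0) hx) (K.smul_mem (⟨b, hb⟩ : ℝ≥0) hy)
  obtain ⟨l, u, h1, h2⟩ := geometric_hahn_banach_closed_point hconv hK hnot
  have hu : 0 < u := by simpa using h1 0 K.zero_mem
  -- A functional bounded above on a cone is non-positive there, so it separates the integral from
  -- `K` at the level `0`.
  have hneg : ∀ x ∈ K, l x ≤ 0 := by
    intro x hx
    by_contra hpos
    push Not at hpos
    have h3 : l ((u / l x) • x) < u :=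
      h1 _ (K.smul_mem (⟨u / l x, (div_pos hu hpos).le⟩ : ℝ≥0) hx)
    rw [map_smul, smul_eq_mul, div_mul_cancel₀ _ hpos.ne'] at h3
    exact lt_irrefl _ h3
  have h4 : l (∫ x, f x ∂μ) ≤ 0 := by
    rw [← ContinuousLinearMap.integral_comp_comm l hf]
    refine integral_nonpos_of_ae ?_
    filter_upwards [hmem] with x hx using hneg _ hx
  linarith

theorem isUnit_and_norm_inverse_le_of_tendsto {𝔸 : Type*} [NormedRing 𝔸]
    [CompleteSpace 𝔸] {x : ℕ → 𝔸} {y : 𝔸} {B : ℝ}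
    (hx : Tendsto x atTop (𝓝 y)) (h : ∀ n, IsUnit (x n) ∧ ‖Ring.inverse (x n)‖ ≤ B) :
    IsUnit y ∧ ‖Ring.inverse y‖ ≤ B := by
  have hy : IsUnit y := by
    have h0 : Tendsto (fun n => B * ‖x n - y‖) atTop (𝓝 0) := by
      simpa using (tendsto_iff_norm_sub_tendsto_zero.1 hx).const_mul B
    obtain ⟨n, hn⟩ := (h0.eventually (gt_mem_nhds one_pos)).exists
    -- A Neumann series: the inverses are bounded by `B`, so for large `n` the limit is a small
    -- relative perturbation of `x n`.
    have h1 : y = x n * (1 - Ring.inverse (x n) * (x n - y)) := by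
      rw [mul_sub, mul_one, ← mul_assoc, Ring.mul_inverse_cancel _ (h n).1, one_mul]; abel
    rw [h1]
    refine (h n).1.mul (isUnit_one_sub_of_norm_lt_one ?_)
    exact ((norm_mul_le _ _).trans (mul_le_mul_of_nonneg_right (h n).2 (norm_nonneg _))).trans_lt hn
  refine ⟨hy, ?_⟩
  have h1 : Tendsto (fun n => ‖Ring.inverse (x n)‖) atTop (𝓝 ‖Ring.inverse y‖) := by
    have := (NormedRing.inverse_continuousAt hy.unit).tendsto
    rw [IsUnit.unit_spec] at this
    exact (this.comp hx).norm
  exact le_of_tendsto' h1 fun n => (h n).2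

/-! ### Non-negativity on the cone generated by the resolvents -/

section Cone

variable {𝔸 : Type*} [NormedRing 𝔸] [NormedAlgebra ℝ 𝔸]

/-- The closed convex cone generated by the operators `A (s + A)⁻¹ = 1 - s (s + A)⁻¹`. -/
def bernsteinCone (R : ℝ → 𝔸) : Submodule ℝ≥0 𝔸 :=
  (Submodule.span ℝ≥0 ((fun s : ℝ => 1 - s • R s) '' Ioi 0)).topologicalClosure

theorem isClosed_bernsteinCone (R : ℝ → 𝔸) : IsClosed (bernsteinCone R : Set 𝔸) :=
  Submodule.isClosed_topologicalClosure _

theorem mem_bernsteinCone (R : ℝ → 𝔸) {s : ℝ} (hs : 0 < s) : 1 - s • R s ∈ bernsteinCone R :=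
  Submodule.le_topologicalClosure _ (Submodule.subset_span ⟨s, hs, rfl⟩)

theorem NonnegBound.isPseudoResolvent {T : 𝔸} {M : ℝ} (h : NonnegBound T M) :
    IsPseudoResolvent (res T) := fun _ _ hs hu => h.res_sub_res hs hu

variable [CompleteSpace 𝔸]

/-- Elements of the closed cone of complete Bernstein functions of a non-negative operator are
non-negative. -/
theorem nonnegBound_of_mem_bernsteinCone {R : ℝ → 𝔸} (hR : IsPseudoResolvent R) {M : ℝ}
    (hM : ∀ s, 0 < s → ‖R s‖ ≤ M / s) {F : 𝔸} (hF : F ∈ bernsteinCone R) :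
    NonnegBound F (max ‖(1 : 𝔸)‖ M) := by
  intro t ht
  obtain ⟨x, hx, hlim⟩ := mem_closure_iff_seq_limit.1 hF
  refine isUnit_and_norm_inverse_le_of_tendsto (x := fun n => t • (1 : 𝔸) + x n)
    (hlim.const_add _) fun n => ?_
  obtain ⟨k, c, g, hsum⟩ := Submodule.mem_span_set'.1 (hx n)
  choose s hs hsg using fun i => (g i).2
  have hs' : ∀ i, 0 < s i := hs
  obtain ⟨l, w, hl, hw, hd, hval⟩ := exists_isReciprocalData s (fun i => (c i : ℝ)) ht hs'
    (fun i => (c i).2)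
  have hτ : 0 < t + ∑ i, (c i : ℝ) := by positivity
  have e1 : t • (1 : 𝔸) + x n =
      (t + ∑ i, (c i : ℝ)) • (1 : 𝔸) - ∑ i, ((c i : ℝ) * s i) • R (s i) := by
    rw [← hsum, add_smul, Finset.sum_smul, add_sub_assoc, ← Finset.sum_sub_distrib]
    congr 1
    refine Finset.sum_congr rfl fun i _ => ?_
    rw [← hsg i, NNReal.smul_def, smul_sub, smul_smul]
  have h1 := hd.mul_eq_one hτ hs' hl hR
  rw [← e1] at h1
  set H := (t + ∑ i, (c i : ℝ))⁻¹ • (1 : 𝔸) + ∑ j, w j • R (l j) with hH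
  have hc : Commute (t • (1 : 𝔸) + x n) H := by
    rw [e1, hH]
    refine Commute.sub_left ((Commute.one_left _).smul_left _) (Commute.add_right ?_ ?_)
    · exact (Commute.one_right _).smul_right _
    · refine Commute.sum_right _ _ _ fun j _ => Commute.sum_left _ _ _ fun i _ => ?_
      exact ((hR.commute (hs' i) (hl j)).smul_left _).smul_right _
  have h2 : H * (t • (1 : 𝔸) + x n) = 1 := by rw [← hc.eq, h1]
  have hunit : IsUnit (t • (1 : 𝔸) + x n) := ⟨⟨_, H, h1, h2⟩, rfl⟩
  have hinv : Ring.inverse (t • (1 : 𝔸) + x n) = H := by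
    have h3 := Ring.inverse_mul_cancel_left _ H hunit
    rwa [h1, mul_one] at h3
  refine ⟨hunit, ?_⟩
  -- The inverse is a positive combination with `‖R (l j)‖ ≤ M / l j`, and `hval` evaluates the sum
  -- of the scalar majorants to `1 / t`, whatever the number of nodes.
  rw [hinv, hH, div_eq_mul_inv, ← hval, mul_add, Finset.mul_sum]
  refine (norm_add_le _ _).trans (add_le_add ?_ ((norm_sum_le _ _).trans
    (Finset.sum_le_sum fun j _ => ?_)))
  · rw [norm_smul, Real.norm_of_nonneg (inv_pos.2 hτ).le, mul_comm]
    exact mul_le_mul_of_nonneg_right (le_max_left _ _) (inv_pos.2 hτ).le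
  · rw [norm_smul, Real.norm_of_nonneg (hw j)]
    calc w j * ‖R (l j)‖ ≤ w j * (M / l j) := mul_le_mul_of_nonneg_left (hM _ (hl j)) (hw j)
      _ = M * (w j / l j) := by ring
      _ ≤ _ := mul_le_mul_of_nonneg_right (le_max_right _ _) (div_nonneg (hw j) (hl j).le)

end Cone

end


section

open scoped NNReal unitInterval

/-! ### The closed cone of complete Bernstein functions -/

/-- The rational complete Bernstein functions `c + ∑ mᵢ t / (t + sᵢ)` on `(0,∞)`. -/
def rationalCBF : Submodule ℝ≥0 (Ioi (0 : ℝ) → ℝ) :=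
  Submodule.span ℝ≥0 (insert 1
    ((fun (s : ℝ) (t : Ioi (0 : ℝ)) => (t : ℝ) / (t + s)) '' Ioi 0))

/-- The closure, for pointwise convergence on `(0,∞)`, of the rational complete Bernstein
functions `c + ∑ mᵢ t / (t + sᵢ)`. -/
def cbfCone : Submodule ℝ≥0 (Ioi (0 : ℝ) → ℝ) :=
  rationalCBF.topologicalClosure

theorem isClosed_cbfCone : IsClosed (cbfCone : Set (Ioi (0 : ℝ) → ℝ)) :=
  Submodule.isClosed_topologicalClosure _

theorem const_mem_cbfCone {c : ℝ} (hc : 0 ≤ c) : (fun _ => c) ∈ cbfCone := by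
  have h : (1 : Ioi (0 : ℝ) → ℝ) ∈ cbfCone :=
    Submodule.le_topologicalClosure _ (Submodule.subset_span (mem_insert _ _))
  have := cbfCone.smul_mem (⟨c, hc⟩ : ℝ≥0) h
  convert this using 1
  funext t
  exact (mul_one c).symm

theorem smul_mem_cbfCone {c : ℝ} (hc : 0 ≤ c) {φ : Ioi (0 : ℝ) → ℝ} (h : φ ∈ cbfCone) :
    (fun t => c * φ t) ∈ cbfCone := by
  exact cbfCone.smul_mem (⟨c, hc⟩ : ℝ≥0) h

theorem div_add_mem_cbfCone {s : ℝ} (hs : 0 < s) :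
    (fun t : Ioi (0 : ℝ) => (t : ℝ) / (t + s)) ∈ cbfCone :=
  Submodule.le_topologicalClosure _ (Submodule.subset_span (mem_insert_of_mem _ ⟨s, hs, rfl⟩))

theorem id_mem_cbfCone : (fun t : Ioi (0 : ℝ) => (t : ℝ)) ∈ cbfCone := by
  refine isClosed_cbfCone.mem_of_tendsto (f := fun (n : ℕ) (t : Ioi (0 : ℝ)) =>
    ((n : ℝ) + 1) * ((t : ℝ) / (t + (n + 1)))) (b := atTop) ?_ (.of_forall fun n =>
      smul_mem_cbfCone (by positivity) (div_add_mem_cbfCone (by positivity)))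
  rw [tendsto_pi_nhds]
  rintro ⟨t, ht⟩
  have ht' : (0 : ℝ) < t := ht
  have h1 : Tendsto (fun n : ℕ => t - t ^ 2 / (t + ((n : ℝ) + 1))) atTop (𝓝 (t - 0)) := by
    refine tendsto_const_nhds.sub (Tendsto.div_atTop tendsto_const_nhds ?_)
    refine tendsto_atTop_add_const_left _ _ (tendsto_atTop_add_const_right _ _ ?_)
    exact tendsto_natCast_atTop_atTop
  rw [sub_zero] at h1
  refine h1.congr fun n => ?_
  have : t + ((n : ℝ) + 1) ≠ 0 := by positivity
  simp only
  field_simp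
  ring

/-- The pointwise topology is not normed, but a neighbourhood only tests finitely many coordinates.
Projection onto these reduces the claim to `integral_mem_of_isClosed` in a finite-dimensional space.
-/
theorem integral_mem_cbfCone {Ω : Type*} [MeasurableSpace Ω] {μ : Measure Ω}
    {φ : Ω → Ioi (0 : ℝ) → ℝ} (hφ : ∀ᵐ x ∂μ, φ x ∈ cbfCone)
    (hi : ∀ t, Integrable (fun x => φ x t) μ) : (fun t => ∫ x, φ x t ∂μ) ∈ cbfCone := by
  by_contra hnot
  obtain ⟨J, u, hu, hsub⟩ := isOpen_pi_iff.1 isClosed_cbfCone.isOpen_compl _ hnot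
  let r : (Ioi (0 : ℝ) → ℝ) →ₗ[ℝ≥0] (J → ℝ) :=
    { toFun := fun ψ j => ψ j
      map_add' := fun _ _ => rfl
      map_smul' := fun _ _ => rfl }
  have hi' : Integrable (fun x => r (φ x)) μ := Integrable.of_eval fun j => hi j
  have h1 : ∫ x, r (φ x) ∂μ ∈ (cbfCone.map r).topologicalClosure :=
    integral_mem_of_isClosed _ (Submodule.isClosed_topologicalClosure _) hi' (by
      filter_upwards [hφ] with x hx
      exact Submodule.le_topologicalClosure _ (Submodule.mem_map_of_mem hx))
  have hopen : IsOpen (Set.univ.pi fun j : J => u j) :=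
    isOpen_set_pi finite_univ fun j _ => (hu j j.2).1
  have hmem : ∫ x, r (φ x) ∂μ ∈ Set.univ.pi fun j : J => u j := by
    intro j _
    rw [eval_integral (f := fun x => r (φ x)) (fun j : J => hi j) j]
    exact (hu j j.2).2
  obtain ⟨y, hy1, hy2⟩ := mem_closure_iff.1 h1 _ hopen hmem
  obtain ⟨ψ, hψ, rfl⟩ := hy2
  exact hsub (fun j hj => hy1 ⟨j, hj⟩ (mem_univ _)) hψ

/-- If `φ` is a positive complete Bernstein function, so is `t ↦ 1 / φ(1/t)`. -/
theorem inv_comp_inv_mem_cbfCone {φ : Ioi (0 : ℝ) → ℝ} (hφ : φ ∈ cbfCone) (hpos : ∀ t, 0 < φ t) :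
    (fun t : Ioi (0 : ℝ) => (φ ⟨(t : ℝ)⁻¹, mem_Ioi.2 (inv_pos.2 (mem_Ioi.1 t.2))⟩)⁻¹) ∈ cbfCone := by
  let ι : Ioi (0 : ℝ) → Ioi (0 : ℝ) := fun t => ⟨(t : ℝ)⁻¹, mem_Ioi.2 (inv_pos.2 (mem_Ioi.1 t.2))⟩
  -- The shift by `δ` keeps the constant term positive, so the explicit reciprocal exists. Replacing
  -- the argument by `1 / t` turns `w / (l + 1/t)` into `(w / l) · t / (t + 1/l)`, again a
  -- generator.
  have step1 : ∀ ψ ∈ rationalCBF, ∀ δ : ℝ, 0 < δ →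
      (fun t => (δ + ψ (ι t))⁻¹) ∈ cbfCone := by
    intro ψ hψ δ hδ
    obtain ⟨a, ψ', hψ', rfl⟩ := Submodule.mem_span_insert.1 hψ
    obtain ⟨k, c, g, rfl⟩ := Submodule.mem_span_set'.1 hψ'
    choose s hs hsg using fun i => (g i).2
    have hs' : ∀ i, 0 < s i := hs
    obtain ⟨l, w, hl, hw, hd, -⟩ := exists_isReciprocalData s (fun i => (c i : ℝ))
      (τ₀ := δ + a) (by positivity) hs' (fun i => (c i).2)
    have hτ : 0 < δ + a + ∑ i, (c i : ℝ) := by positivity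
    have e : (fun t => (δ + (a • (1 : Ioi (0 : ℝ) → ℝ) +
        ∑ i, c i • (g i : Ioi (0 : ℝ) → ℝ)) (ι t))⁻¹) =
        (fun _ => (δ + a + ∑ i, (c i : ℝ))⁻¹) +
          ∑ j, fun t : Ioi (0 : ℝ) => w j / l j * ((t : ℝ) / (t + (l j)⁻¹)) := by
      funext t
      have ht : (0 : ℝ) < (t : ℝ)⁻¹ := inv_pos.2 (mem_Ioi.1 t.2)
      have ht0 : (0 : ℝ) < (t : ℝ) := mem_Ioi.1 t.2
      have h1 := hd.mul_eq_one hτ hs' hl (isPseudoResolvent_inv_add ht.le)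
      have h2 : δ + (a • (1 : Ioi (0 : ℝ) → ℝ) + ∑ i, c i • (g i : Ioi (0 : ℝ) → ℝ)) (ι t) =
          (δ + a + ∑ i, (c i : ℝ)) • (1 : ℝ) -
            ∑ i, ((c i : ℝ) * s i) • (s i + (t : ℝ)⁻¹)⁻¹ := by
        simp only [Pi.add_apply, Pi.smul_apply, Finset.sum_apply, Pi.one_apply, NNReal.smul_def,
          smul_eq_mul, mul_one]
        rw [add_sub_assoc, ← Finset.sum_sub_distrib, add_assoc]
        congr 2
        refine Finset.sum_congr rfl fun i _ => ?_
        rw [← hsg i]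
        have h3 : (t : ℝ)⁻¹ + s i ≠ 0 := by have := hs' i; positivity
        change (c i : ℝ) * ((t : ℝ)⁻¹ / ((t : ℝ)⁻¹ + s i)) = _
        rw [add_comm (s i)]
        generalize (t : ℝ)⁻¹ = x at h3 ⊢
        field_simp
        ring
      simp only [h2]
      rw [inv_eq_of_mul_eq_one_right h1]
      simp only [Pi.add_apply, Finset.sum_apply, smul_eq_mul, mul_one]
      congr 1
      refine Finset.sum_congr rfl fun j _ => ?_
      have := hl j
      field_simp
    rw [e]
    refine cbfCone.add_mem (const_mem_cbfCone (inv_pos.2 hτ).le) (cbfCone.sum_mem fun j _ => ?_)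
    exact smul_mem_cbfCone (div_nonneg (hw j) (hl j).le) (div_add_mem_cbfCone (inv_pos.2 (hl j)))
  have step2 : ∀ δ : ℝ, 0 < δ → (fun t => (δ + φ (ι t))⁻¹) ∈ cbfCone := by
    intro δ hδ
    have hφ' := mem_closure_iff_nhdsWithin_neBot.1 (show φ ∈ closure _ from hφ)
    refine isClosed_cbfCone.mem_of_tendsto (b := 𝓝[(rationalCBF : Set _)] φ)
      (f := fun (ψ : Ioi (0 : ℝ) → ℝ) t => (δ + ψ (ι t))⁻¹) ?_ ?_
    · rw [tendsto_pi_nhds]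
      intro t
      have h0 : δ + φ (ι t) ≠ 0 := (add_pos hδ (hpos _)).ne'
      have : ContinuousAt (fun ψ : Ioi (0 : ℝ) → ℝ => (δ + ψ (ι t))⁻¹) φ :=
        (continuousAt_const.add (continuous_apply (ι t)).continuousAt).inv₀ h0
      exact this.tendsto.mono_left nhdsWithin_le_nhds
    · filter_upwards [self_mem_nhdsWithin] with ψ hψ using step1 ψ hψ δ hδ
  refine isClosed_cbfCone.mem_of_tendsto (b := 𝓝[>] (0 : ℝ))
      (f := fun (δ : ℝ) t => (δ + φ (ι t))⁻¹) ?_ ?_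
  · rw [tendsto_pi_nhds]
    intro t
    have : ContinuousAt (fun δ : ℝ => (δ + φ (ι t))⁻¹) 0 :=
      (continuousAt_id.add continuousAt_const).inv₀ (by simpa using (hpos _).ne')
    have h2 := this.tendsto.mono_left (nhdsWithin_le_nhds (s := Ioi 0))
    rw [zero_add] at h2
    exact h2
  · filter_upwards [self_mem_nhdsWithin] with δ hδ using step2 δ hδ

/-- By scaling, `t ^ ε` is a constant times the superposition of `t / (t + s)` with density `s ^ (ε
- 1)`. -/
theorem rpow_mem_cbfCone {ε : ℝ} (hε : 0 < ε) (hε1 : ε ≤ 1) :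
    (fun t : Ioi (0 : ℝ) => (t : ℝ) ^ ε) ∈ cbfCone := by
  rcases hε1.eq_or_lt with rfl | hε1
  · simpa using id_mem_cbfCone
  have hC := balInt_one_pos hε hε1
  have hi := nonnegBound_one.integrableOn_pow (n := 1) hε (by simpa using hε1)
  simp only [resMul_one, pow_one, smul_eq_mul] at hi
  have hscale : ∀ t s : ℝ, 0 < t → 0 < s →
      t / (t + s) * s ^ (ε - 1) = t ^ (ε - 1) * ((t⁻¹ * s) ^ (ε - 1) * (t⁻¹ * s + 1)⁻¹) := by
    intro t s ht hs
    rw [← mul_assoc, ← Real.mul_rpow ht.le (by positivity), mul_inv_cancel_left₀ ht.ne', mul_comm]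
    congr 1
    field_simp
    rw [add_comm]
  have hint : ∀ t : ℝ, 0 < t → IntegrableOn (fun s => t / (t + s) * s ^ (ε - 1)) (Ioi 0) := by
    intro t ht
    have h1 := (integrableOn_Ioi_comp_mul_left_iff
      (fun s : ℝ => s ^ (ε - 1) * (s + 1)⁻¹) 0 (inv_pos.2 ht)).2 (by simpa using hi)
    exact IntegrableOn.congr_fun (h1.const_mul (t ^ (ε - 1)))
      (fun s hs => (hscale t s ht hs).symm) measurableSet_Ioi
  have hval : ∀ t : ℝ, 0 < t → ∫ s in Ioi (0 : ℝ), t / (t + s) * s ^ (ε - 1) =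
      t ^ ε * balInt (1 : ℝ) ε 1 := by
    intro t ht
    rw [setIntegral_congr_fun measurableSet_Ioi (fun s hs => hscale t s ht hs), integral_const_mul,
      integral_comp_mul_left_Ioi (fun s : ℝ => s ^ (ε - 1) * (s + 1)⁻¹) 0 (inv_pos.2 ht), mul_zero,
      inv_inv, smul_eq_mul, ← mul_assoc, ← Real.rpow_add_one ht.ne', sub_add_cancel, balInt]
    simp only [resMul_one, pow_one, smul_eq_mul]
  have hmem := integral_mem_cbfCone (μ := volume.restrict (Ioi (0 : ℝ)))
    (φ := fun s (t : Ioi (0 : ℝ)) => s ^ (ε - 1) * ((t : ℝ) / (t + s)))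
    (by
      filter_upwards [ae_restrict_mem measurableSet_Ioi] with s hs
      exact smul_mem_cbfCone (Real.rpow_nonneg (le_of_lt hs) _) (div_add_mem_cbfCone hs))
    (fun t => by
      have := hint t t.2
      simp only [mul_comm (_ / _)] at this
      exact this)
  have := smul_mem_cbfCone (inv_pos.2 hC).le hmem
  convert this using 1
  funext t
  simp only [mul_comm (_ ^ (ε - 1)) (_ / _)]
  rw [hval t t.2, mul_comm, mul_assoc, mul_inv_cancel₀ hC.ne', mul_one]

/-! ### Elements of the cone are complete Bernstein functions -/

/-- The kernel `t / ((1 - x) t + x)`, normalized by the value `1` at `t = 1`. -/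
def cbfKernel (t : ℝ) (x : I) : ℝ := t / ((1 - (x : ℝ)) * t + x)

theorem cbfKernel_denom_pos {t : ℝ} (ht : 0 < t) (x : I) : 0 < (1 - (x : ℝ)) * t + x := by
  have h0 := x.2.1
  have h1 := x.2.2
  rcases h0.eq_or_lt with h | h
  · rw [← h]; simpa using ht
  · have : 0 ≤ (1 - (x : ℝ)) * t := mul_nonneg (by linarith) ht.le
    linarith

theorem continuous_cbfKernel {t : ℝ} (ht : 0 < t) : Continuous (cbfKernel t) := by
  refine continuous_const.div (by fun_prop) fun x => (cbfKernel_denom_pos ht x).ne'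

theorem integrable_cbfKernel {t : ℝ} (ht : 0 < t) (ν : Measure I) [IsFiniteMeasure ν] :
    Integrable (cbfKernel t) ν :=
  (continuous_cbfKernel ht).integrable_of_hasCompactSupport
    (HasCompactSupport.of_compactSpace _)

/-- The parameter interval is compact because it contains the endpoints, where the kernel is the
constant `1` and the identity. Thus mass cannot escape in a limit; it can only become a constant or
a linear term. -/
theorem isCompact_range_integral_cbfKernel :
    IsCompact (range fun (P : ProbabilityMeasure I) (t : Ioi (0 : ℝ)) => ∫ x, cbfKernel t x ∂P) := by
  refine isCompact_range (continuous_pi fun t => ?_)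
  exact ProbabilityMeasure.continuous_integral_boundedContinuousFunction
    (BoundedContinuousFunction.mkOfCompact ⟨cbfKernel t, continuous_cbfKernel t.2⟩)

theorem exists_measure_of_mem_span {ψ : Ioi (0 : ℝ) → ℝ} (hψ : ψ ∈ rationalCBF) :
    ∃ ν : Measure I, IsFiniteMeasure ν ∧ ∀ t : Ioi (0 : ℝ), ψ t = ∫ x, cbfKernel t x ∂ν := by
  induction hψ using Submodule.span_induction with
  | mem φ hφ =>
    rcases hφ with rfl | ⟨s, hs, rfl⟩
    · refine ⟨Measure.dirac 0, inferInstance, fun t => ?_⟩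
      have : (t : ℝ) ≠ 0 := (mem_Ioi.1 t.2).ne'
      rw [integral_dirac, cbfKernel]; simp [this]
    · have hs' : (0 : ℝ) < s := hs
      -- The node `s` corresponds to `x = s / (1 + s)`, and the normalization of the kernel at `t =
      -- 1` accounts for the mass `1 / (1 + s)`.
      have hx : s / (1 + s) ∈ I := ⟨by positivity, (div_le_one (by positivity)).2 (by linarith)⟩
      refine ⟨ENNReal.ofReal (1 / (1 + s)) • Measure.dirac ⟨s / (1 + s), hx⟩,
        Measure.smul_finite _ ENNReal.ofReal_ne_top, fun t => ?_⟩
      have ht : (0 : ℝ) < t := t.2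
      rw [integral_smul_measure, integral_dirac, cbfKernel, ENNReal.toReal_ofReal (by positivity),
        smul_eq_mul]
      have h1 : (1 - s / (1 + s)) * (t : ℝ) + s / (1 + s) = (t + s) / (1 + s) := by
        field_simp; ring
      simp only [h1]
      field_simp
  | zero => exact ⟨0, inferInstance, fun t => by simp⟩
  | add φ ψ _ _ hφ hψ =>
    obtain ⟨ν, h1, h2⟩ := hφ
    obtain ⟨ν', h1', h2'⟩ := hψ
    refine ⟨ν + ν', inferInstance, fun t => ?_⟩
    rw [integral_add_measure (integrable_cbfKernel t.2 ν) (integrable_cbfKernel t.2 ν'), ← h2,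
      ← h2', Pi.add_apply]
  | smul a φ _ hφ =>
    obtain ⟨ν, h1, h2⟩ := hφ
    refine ⟨a • ν, inferInstance, fun t => ?_⟩
    rw [integral_smul_nnreal_measure, ← h2, Pi.smul_apply]

/-- The kernel equals `1` at `t = 1`, so the value of a function there is the mass of its measure.
Normalized rational functions lie in a compact set, which therefore also contains the normalized
limit. -/
theorem exists_probabilityMeasure_of_mem_cbfCone {φ : Ioi (0 : ℝ) → ℝ} (hφ : φ ∈ cbfCone)
    (h1 : 0 < φ ⟨1, mem_Ioi.2 one_pos⟩) : ∃ P : ProbabilityMeasure I, ∀ t : Ioi (0 : ℝ),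
      φ t = φ ⟨1, mem_Ioi.2 one_pos⟩ * ∫ x, cbfKernel t x ∂P := by
  set o : Ioi (0 : ℝ) := ⟨1, mem_Ioi.2 one_pos⟩ with ho
  have hclosed := isCompact_range_integral_cbfKernel.isClosed
  have hφ' := mem_closure_iff_nhdsWithin_neBot.1 (show φ ∈ closure _ from hφ)
  have hmem : (fun t => (φ o)⁻¹ * φ t) ∈
      range fun (P : ProbabilityMeasure I) (t : Ioi (0 : ℝ)) => ∫ x, cbfKernel t x ∂P := by
    refine hclosed.mem_of_tendsto (b := 𝓝[(rationalCBF : Set _)] φ)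
      (f := fun (ψ : Ioi (0 : ℝ) → ℝ) t => (ψ o)⁻¹ * ψ t) ?_ ?_
    · rw [tendsto_pi_nhds]
      intro t
      have : ContinuousAt (fun ψ : Ioi (0 : ℝ) → ℝ => (ψ o)⁻¹ * ψ t) φ :=
        ((continuous_apply o).continuousAt.inv₀ h1.ne').mul (continuous_apply t).continuousAt
      exact this.tendsto.mono_left nhdsWithin_le_nhds
    · have hev : ∀ᶠ ψ in 𝓝[(rationalCBF : Set _)] φ, 0 < ψ o :=
        ((continuous_apply o).continuousAt.eventually (lt_mem_nhds h1)).filter_mono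
          nhdsWithin_le_nhds
      filter_upwards [self_mem_nhdsWithin, hev] with ψ hψ hψ1
      obtain ⟨ν, hν, hrep⟩ := exists_measure_of_mem_span hψ
      have hmass : ψ o = ν.real univ := by
        rw [hrep o]
        have : ∀ x : I, cbfKernel o x = 1 := fun x => by simp [cbfKernel, ho]
        simp [this]
      have hν0 : NeZero ν := ⟨by
        rintro rfl
        rw [hmass] at hψ1
        simp at hψ1⟩
      refine ⟨⟨(ν univ)⁻¹ • ν, inferInstance⟩, ?_⟩
      funext t
      simp only [ProbabilityMeasure.coe_mk]
      rw [integral_smul_measure, hrep t, hmass, ENNReal.toReal_inv, smul_eq_mul]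
      rfl
  obtain ⟨P, hP⟩ := hmem
  refine ⟨P, fun t => ?_⟩
  have := congrFun hP t
  simp only at this
  rw [this, mul_inv_cancel_left₀ h1.ne']

/-- The change of variable `s = x / (1 - x)` maps the open interval to the half-line with density `c
(1 + s)`; the atoms at `0` and `1` provide the constant and the linear term. -/
theorem isCBF_of_eq_integral_cbfKernel {f : ℝ → ℝ} {c : ℝ} (hc : 0 ≤ c) (P : Measure I)
    [IsFiniteMeasure P] (h : ∀ t : ℝ, 0 < t → f t = c * ∫ x, cbfKernel t x ∂P) : IsCBF f := by
  set S : Set I := Ioo 0 1 with hS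
  have hSm : MeasurableSet S := measurableSet_Ioo
  set q : I → ℝ := fun x => x / (1 - x) with hq
  have hqm : Measurable q := by fun_prop
  have hqpos : ∀ x ∈ S, 0 < q x := fun x hx => by
    have h0 : (0 : ℝ) < x := hx.1
    have h1 : (x : ℝ) < 1 := hx.2
    exact div_pos h0 (by linarith)
  set d : I → ℝ≥0 := fun x => Real.toNNReal (c * (1 + q x)) with hd
  have hdm : Measurable d := by fun_prop
  set ρ : Measure I := (P.restrict S).withDensity fun x => (d x : ENNReal) with hρ
  have hρS : ∀ᵐ x ∂ρ, x ∈ S :=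
    (withDensity_absolutelyContinuous _ _).ae_le (ae_restrict_mem hSm)
  have hρq : ρ.restrict (q ⁻¹' Ioi 0) = ρ :=
    Measure.restrict_eq_self_of_ae_mem (hρS.mono fun x hx => hqpos x hx)
  have hdval : ∀ x ∈ S, (d x : ℝ) = c * (1 + q x) := fun x hx =>
    Real.coe_toNNReal _ (mul_nonneg hc (by have := hqpos x hx; linarith))
  refine ⟨c * P.real {0}, c * P.real {1}, ρ.map q, by positivity, by positivity, ?_, ?_⟩
  · rw [setLIntegral_map measurableSet_Ioi (by fun_prop) hqm, hρq, hρ,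
      lintegral_withDensity_eq_lintegral_mul _ (by fun_prop) (by fun_prop)]
    refine lt_of_le_of_lt (setLIntegral_mono (g := fun _ => ENNReal.ofReal c) measurable_const
      fun x hx => ?_) ?_
    · have h1 := hqpos x hx
      rw [Pi.mul_apply, ENNReal.ofNNReal_toNNReal, ← ENNReal.ofReal_mul
        (mul_nonneg hc (by linarith))]
      refine ENNReal.ofReal_le_ofReal (le_of_eq ?_)
      field_simp
    · rw [lintegral_const]
      exact ENNReal.mul_lt_top ENNReal.ofReal_lt_top (measure_lt_top _ _)
  · intro t ht
    have hi := integrable_cbfKernel ht P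
    have hmeas : AEStronglyMeasurable (fun s : ℝ => t / (t + s)) (Measure.map q ρ) :=
      (by fun_prop : Measurable fun s : ℝ => t / (t + s)).aestronglyMeasurable
    have e1 : ∫ s in Ioi (0 : ℝ), t / (t + s) ∂(ρ.map q) = c * ∫ x in S, cbfKernel t x ∂P := by
      rw [setIntegral_map measurableSet_Ioi hmeas hqm.aemeasurable, hρq, hρ,
        integral_withDensity_eq_integral_smul hdm, ← integral_const_mul]
      refine setIntegral_congr_fun hSm fun x hx => ?_
      have h0 : (0 : ℝ) < x := hx.1
      have h1 : (0 : ℝ) < 1 - x := by have : (x : ℝ) < 1 := hx.2; linarith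
      have h2 := cbfKernel_denom_pos ht x
      rw [NNReal.smul_def, hdval x hx, smul_eq_mul, cbfKernel, hq]
      have h3 : t + (x : ℝ) / (1 - x) = ((1 - x) * t + x) / (1 - x) := by field_simp
      have h4 : 1 + (x : ℝ) / (1 - x) = 1 / (1 - x) := by field_simp; ring
      simp only [h3, h4]
      field_simp
    have hu : (univ : Set I) = {0} ∪ ({1} ∪ S) := by
      ext x
      simp only [mem_univ, mem_union, mem_singleton_iff, true_iff, hS, mem_Ioo]
      rcases eq_or_ne x 0 with h0 | h0
      · exact Or.inl h0
      · rcases eq_or_ne x 1 with h1 | h1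
        · exact Or.inr (Or.inl h1)
        · exact Or.inr (Or.inr ⟨unitInterval.pos_iff_ne_zero.2 h0, unitInterval.lt_one_iff_ne_one.2 h1⟩)
    have e2 : ∫ x, cbfKernel t x ∂P = P.real {0} + P.real {1} * t + ∫ x in S, cbfKernel t x ∂P := by
      rw [← setIntegral_univ, hu, setIntegral_union ?_ ((measurableSet_singleton _).union hSm)
        hi.integrableOn hi.integrableOn, setIntegral_union ?_ hSm hi.integrableOn hi.integrableOn,
        integral_singleton, integral_singleton]
      · have : t ≠ 0 := ht.ne'
        simp [cbfKernel, this]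
        ring
      · simp [hS]
      · simp [hS]
    rw [h t ht, e1, e2]
    ring

theorem isCBF_of_mem_cbfCone {f : ℝ → ℝ} (hf : (fun t : Ioi (0 : ℝ) => f t) ∈ cbfCone)
    (h1 : 0 < f 1) : IsCBF f := by
  obtain ⟨P, hP⟩ := exists_probabilityMeasure_of_mem_cbfCone hf h1
  exact isCBF_of_eq_integral_cbfKernel h1.le (P : Measure I) fun t ht => hP ⟨t, ht⟩

end


section

open scoped NNReal

/-! ### Increasing slowly varying functions -/

section SlowlyVarying

variable {κ : ℝ → ℝ}

theorem IsIncreasingSlowlyVarying.le_of_le (hκ : IsIncreasingSlowlyVarying κ) {s t : ℝ}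
    (hs : 0 < s) (hst : s ≤ t) : κ s ≤ κ t :=
  hκ.mono hs (hs.trans_le hst) hst

/-- A Potter-type bound. -/
theorem IsIncreasingSlowlyVarying.exists_potter (hκ : IsIncreasingSlowlyVarying κ) {δ : ℝ}
    (hδ : 0 < δ) : ∃ C : ℝ, 0 < C ∧ ∀ u s : ℝ, 1 ≤ u → 1 ≤ s → κ (u * s) ≤ C * u ^ δ * κ s := by
  have h2 : (1 : ℝ) < 2 ^ δ := Real.one_lt_rpow one_lt_two hδ
  obtain ⟨s₀, hs₀⟩ := eventually_atTop.1 ((hκ.slow 2 two_pos).eventually (gt_mem_nhds h2))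
  set s₁ := max s₀ 1 with hs₁
  have hs₁1 : 1 ≤ s₁ := le_max_right _ _
  have hstep : ∀ s, s₁ ≤ s → κ (2 * s) ≤ 2 ^ δ * κ s := fun s hs => by
    have h := hs₀ s ((le_max_left _ _).trans hs)
    rw [div_lt_iff₀ (hκ.pos s (by linarith))] at h
    exact h.le
  have hpow : ∀ (k : ℕ) (s : ℝ), s₁ ≤ s → κ (2 ^ k * s) ≤ (2 ^ k) ^ δ * κ s := by
    intro k
    induction k with
    | zero => intro s _; simp
    | succ k ih =>
      intro s hs
      have h1 : s₁ ≤ 2 ^ k * s := by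
        have : (1 : ℝ) ≤ 2 ^ k := one_le_pow₀ one_le_two
        nlinarith
      have e : (2 : ℝ) ^ (k + 1) * s = 2 * (2 ^ k * s) := by ring
      rw [e, pow_succ', Real.mul_rpow (by norm_num) (by positivity), mul_assoc]
      exact (hstep _ h1).trans (mul_le_mul_of_nonneg_left (ih s hs) (by positivity))
  have hbig : ∀ u s : ℝ, 1 ≤ u → s₁ ≤ s → κ (u * s) ≤ (2 * u) ^ δ * κ s := by
    intro u s hu hs
    obtain ⟨n, hn1, hn2⟩ := exists_nat_pow_near hu one_lt_two
    have hs0 : 0 < s := by linarith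
    have hu0 : 0 < u := by linarith
    have hle : (2 : ℝ) ^ (n + 1) ≤ 2 * u := by rw [pow_succ']; linarith
    calc κ (u * s) ≤ κ (2 ^ (n + 1) * s) :=
          hκ.le_of_le (by positivity) (mul_le_mul_of_nonneg_right hn2.le hs0.le)
      _ ≤ (2 ^ (n + 1)) ^ δ * κ s := hpow _ _ hs
      _ ≤ _ := mul_le_mul_of_nonneg_right (Real.rpow_le_rpow (by positivity) hle hδ.le)
          (hκ.pos s hs0).le
  -- Doubling is controlled only beyond `s₁`. For `1 ≤ s ≤ s₁` monotonicity replaces `s` by `s₁`, at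
  -- the cost of the factor `κ s₁ / κ 1`.
  have hκ1 := hκ.pos 1 one_pos
  have hκs := hκ.pos s₁ (by linarith)
  have hq : 1 ≤ κ s₁ / κ 1 := (one_le_div hκ1).2 (hκ.le_of_le one_pos hs₁1)
  refine ⟨2 ^ δ * (κ s₁ / κ 1), by positivity, fun u s hu hs => ?_⟩
  have hu0 : 0 < u := by linarith
  have hs0 : 0 < s := by linarith
  have hκs0 := hκ.pos s hs0
  have e : (2 * u) ^ δ = 2 ^ δ * u ^ δ := Real.mul_rpow (by norm_num) hu0.le
  have hp : 0 < 2 ^ δ * u ^ δ := by positivity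
  rcases le_total s₁ s with h | h
  · refine (hbig u s hu h).trans ?_
    rw [e]
    calc 2 ^ δ * u ^ δ * κ s ≤ 2 ^ δ * u ^ δ * κ s * (κ s₁ / κ 1) :=
          le_mul_of_one_le_right (by positivity) hq
      _ = _ := by ring
  · calc κ (u * s) ≤ κ (u * s₁) :=
          hκ.le_of_le (by positivity) (mul_le_mul_of_nonneg_left h hu0.le)
      _ ≤ 2 ^ δ * u ^ δ * κ s₁ := e ▸ hbig u s₁ hu le_rfl
      _ = 2 ^ δ * u ^ δ * ((κ s₁ / κ 1) * κ 1) := by rw [div_mul_cancel₀ _ hκ1.ne']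
      _ ≤ 2 ^ δ * u ^ δ * ((κ s₁ / κ 1) * κ s) := by
          gcongr; exact hκ.le_of_le one_pos hs
      _ = _ := by ring

theorem IsIncreasingSlowlyVarying.exists_le_rpow (hκ : IsIncreasingSlowlyVarying κ) {δ : ℝ}
    (hδ : 0 < δ) : ∃ C : ℝ, 0 < C ∧ ∀ s : ℝ, 1 ≤ s → κ s ≤ C * s ^ δ := by
  obtain ⟨C, hC, h⟩ := hκ.exists_potter hδ
  have := hκ.pos 1 one_pos
  refine ⟨C * κ 1, by positivity, fun s hs => ?_⟩
  have := h s 1 hs le_rfl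
  rw [mul_one] at this
  linarith

/-- For `v ≤ 1` monotonicity suffices; for `v ≥ 1` the Potter bound with exponent `1/2` leaves `v ^
(-3/2)`. The majorant is `κ t` times a fixed integrable function. -/
theorem IsIncreasingSlowlyVarying.exists_div_sq_le (hκ : IsIncreasingSlowlyVarying κ) :
    ∃ C : ℝ, 0 < C ∧ ∀ t v : ℝ, 1 ≤ t → 0 < v → κ (t * v) / (v + 1) ^ 2 ≤
      C * κ t * (v ^ (0 : ℝ) * (min 1 v⁻¹) ^ (3 / 2 : ℝ)) := by
  obtain ⟨C, hC, h⟩ := hκ.exists_potter (δ := 1 / 2) (by norm_num)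
  refine ⟨C + 1, by positivity, fun t v ht hv => ?_⟩
  have ht0 : 0 < t := by linarith
  have hκt := hκ.pos t ht0
  rw [Real.rpow_zero, one_mul]
  rcases le_total v 1 with h1 | h1
  · rw [min_eq_left (one_le_inv_iff₀.2 ⟨hv, h1⟩), Real.one_rpow, mul_one]
    have h2 : κ (t * v) ≤ κ t := hκ.le_of_le (by positivity) (by nlinarith)
    rw [div_le_iff₀ (by positivity)]
    nlinarith [mul_pos hC hκt, sq_nonneg v, mul_pos hκt hv, mul_pos (mul_pos hC hκt) hv]
  · rw [min_eq_right (inv_le_one_of_one_le₀ h1)]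
    have h2 := h v t h1 ht
    rw [mul_comm v t] at h2
    have h3 : v⁻¹ ^ (3 / 2 : ℝ) = v ^ (1 / 2 : ℝ) / v ^ 2 := by
      rw [Real.inv_rpow hv.le, ← Real.rpow_neg hv.le, ← Real.rpow_natCast, ← Real.rpow_sub hv]
      norm_num
    have hp : 0 < v ^ (1 / 2 : ℝ) := by positivity
    rw [h3, ← mul_div_assoc]
    refine div_le_div₀ (by positivity) ?_ (by positivity) (by gcongr; linarith)
    have : 0 < κ t * v ^ (1 / 2 : ℝ) := by positivity
    nlinarith

theorem Phi_eq_integral (κ : ℝ → ℝ) {t : ℝ} (ht : 0 < t) :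
    Phi κ t = ∫ v in Ioi (0 : ℝ), κ (t * v) / (v + 1) ^ 2 := by
  have h := integral_comp_mul_left_Ioi (fun s : ℝ => κ s / (s + t) ^ 2) 0 ht
  rw [mul_zero, smul_eq_mul] at h
  rw [Phi, stieltjesFn]
  have h2 : ∫ s in Ioi (0 : ℝ), κ s / (s + t) ^ 2 =
      t * ∫ v in Ioi (0 : ℝ), κ (t * v) / (t * v + t) ^ 2 := by
    rw [h, mul_inv_cancel_left₀ ht.ne']
  rw [h2, ← mul_assoc, ← integral_const_mul]
  refine setIntegral_congr_fun measurableSet_Ioi fun v hv => ?_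
  have hv' : (0 : ℝ) < v := hv
  have e : t * v + t = t * (v + 1) := by ring
  simp only [e]
  field_simp

theorem IsIncreasingSlowlyVarying.aemeasurable_comp_mul (hκ : IsIncreasingSlowlyVarying κ) {t : ℝ}
    (ht : 0 < t) : AEMeasurable (fun v => κ (t * v)) (volume.restrict (Ioi 0)) := by
  refine aemeasurable_restrict_of_measurable_subtype measurableSet_Ioi ?_
  exact hκ.measurable.comp (f := fun v : Ioi (0 : ℝ) =>
    (⟨t * v, mul_pos ht v.2⟩ : Ioi (0 : ℝ))) (by fun_prop)

theorem IsIncreasingSlowlyVarying.integrableOn_comp_mul (hκ : IsIncreasingSlowlyVarying κ) {t : ℝ}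
    (ht : 0 < t) : IntegrableOn (fun v => κ (t * v) / (v + 1) ^ 2) (Ioi 0) := by
  obtain ⟨C, hC, h⟩ := hκ.exists_div_sq_le
  refine ((integrableOn_rpow_mul_min (p := 0) (q := 3 / 2) (by norm_num)
    (by norm_num)).const_mul (C * κ (max t 1))).mono' ?_ ?_
  · exact ((hκ.aemeasurable_comp_mul ht).div
      (by fun_prop : Measurable fun v : ℝ => (v + 1) ^ 2).aemeasurable).aestronglyMeasurable
  · filter_upwards [ae_restrict_mem measurableSet_Ioi] with v hv
    have hv' : (0 : ℝ) < v := hv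
    have h1 := hκ.pos (t * v) (by positivity)
    rw [Real.norm_of_nonneg (by positivity)]
    refine le_trans ?_ (h (max t 1) v (le_max_right _ _) hv')
    gcongr
    exact hκ.le_of_le (by positivity) (mul_le_mul_of_nonneg_right (le_max_left _ _) hv'.le)

/-- `Φ(t)` is an average of `κ (t v)`; keeping only `v > 1`, where `κ (t v) ≥ κ t`, gives the bound.
Together with `exists_Phi_le` it makes `Φ` and `κ` comparable on `[1, ∞)`. -/
theorem IsIncreasingSlowlyVarying.exists_le_Phi (hκ : IsIncreasingSlowlyVarying κ) :
    ∃ c : ℝ, 0 < c ∧ ∀ t : ℝ, 0 < t → c * κ t ≤ Phi κ t := by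
  have hi : IntegrableOn (fun v : ℝ => 1 / (v + 1) ^ 2) (Ioi 1) := by
    refine (integrableOn_Ioi_rpow_of_lt (a := -2) (by norm_num) one_pos).mono' ?_ ?_
    · exact (by fun_prop : Measurable fun v : ℝ => 1 / (v + 1) ^ 2).aestronglyMeasurable
    · filter_upwards [ae_restrict_mem measurableSet_Ioi] with v hv
      have hv' : (0 : ℝ) < v := lt_trans one_pos hv
      rw [Real.norm_of_nonneg (by positivity), Real.rpow_neg hv'.le, one_div]
      refine inv_anti₀ (by positivity) ?_
      rw [Real.rpow_two]
      nlinarith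
  refine ⟨∫ v in Ioi (1 : ℝ), 1 / (v + 1) ^ 2, ?_, fun t ht => ?_⟩
  · rw [setIntegral_pos_iff_support_of_nonneg_ae (.of_forall fun v => by positivity) hi]
    have : (Function.support fun v : ℝ => 1 / (v + 1) ^ 2) ∩ Ioi 1 = Ioi 1 := by
      refine inter_eq_right.2 fun v hv => ?_
      have hv' : (0 : ℝ) < v := lt_trans one_pos hv
      simp only [Function.mem_support]
      positivity
    rw [this]; simp
  · have h0 := hκ.integrableOn_comp_mul ht
    rw [Phi_eq_integral κ ht, ← integral_mul_const]
    calc ∫ v in Ioi (1 : ℝ), 1 / (v + 1) ^ 2 * κ t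
        ≤ ∫ v in Ioi (1 : ℝ), κ (t * v) / (v + 1) ^ 2 := by
          refine setIntegral_mono_on (hi.mul_const _) (h0.mono_set (Ioi_subset_Ioi zero_le_one))
            measurableSet_Ioi fun v hv => ?_
          have hv' : (1 : ℝ) < v := hv
          rw [div_mul_eq_mul_div, one_mul]
          gcongr
          exact hκ.le_of_le ht (by nlinarith)
      _ ≤ _ := by
          refine setIntegral_mono_set h0 ?_ (Ioi_subset_Ioi zero_le_one).eventuallyLE
          filter_upwards [ae_restrict_mem measurableSet_Ioi] with v hv
          have hv' : (0 : ℝ) < v := hv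
          have := hκ.pos (t * v) (by positivity)
          simp only [Pi.zero_apply]
          positivity

theorem IsIncreasingSlowlyVarying.exists_Phi_le (hκ : IsIncreasingSlowlyVarying κ) :
    ∃ C : ℝ, 0 < C ∧ ∀ t : ℝ, 1 ≤ t → Phi κ t ≤ C * κ t := by
  obtain ⟨C, hC, h⟩ := hκ.exists_div_sq_le
  have hi := integrableOn_rpow_mul_min (p := 0) (q := 3 / 2) (by norm_num) (by norm_num)
  set J := ∫ v in Ioi (0 : ℝ), v ^ (0 : ℝ) * (min 1 v⁻¹) ^ (3 / 2 : ℝ) with hJ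
  have hJ0 : 0 ≤ J := by
    refine setIntegral_nonneg measurableSet_Ioi fun t ht => ?_
    have : (0 : ℝ) ≤ t⁻¹ := inv_nonneg.2 (le_of_lt ht)
    exact mul_nonneg (Real.rpow_nonneg (le_of_lt ht) _) (Real.rpow_nonneg (by positivity) _)
  refine ⟨C * J + 1, by positivity, fun t ht => ?_⟩
  have ht0 : 0 < t := by linarith
  have hκt := hκ.pos t ht0
  rw [Phi_eq_integral κ ht0]
  calc _ ≤ ∫ v in Ioi (0 : ℝ), C * κ t * (v ^ (0 : ℝ) * (min 1 v⁻¹) ^ (3 / 2 : ℝ)) :=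
        setIntegral_mono_on (hκ.integrableOn_comp_mul ht0) (hi.const_mul _) measurableSet_Ioi
          fun v hv => h t v ht hv
    _ = C * κ t * J := integral_const_mul _ _
    _ ≤ _ := by nlinarith

theorem IsIncreasingSlowlyVarying.Phi_pos (hκ : IsIncreasingSlowlyVarying κ) {t : ℝ} (ht : 0 < t) :
    0 < Phi κ t := by
  obtain ⟨c, hc, h⟩ := hκ.exists_le_Phi
  exact (mul_pos hc (hκ.pos t ht)).trans_le (h t ht)

theorem integral_Ioi_div_add_sq {t u : ℝ} (ht : 0 < t) (hu : 0 ≤ u) :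
    ∫ s in Ioi u, t / (s + t) ^ 2 = t / (t + u) := by
  have hd : ∀ s ∈ Ici u, HasDerivAt (fun s => -(t / (s + t))) (t / (s + t) ^ 2) s := by
    intro s hs
    have hs' : 0 < s + t := by have : u ≤ s := hs; linarith
    have h1 := ((hasDerivAt_id s).add_const t).inv hs'.ne'
    refine ((h1.const_mul t).neg).congr_deriv ?_ |>.congr_of_eventuallyEq (.of_forall fun s => ?_)
    · simp only [id]; ring
    · simp [div_eq_mul_inv]
  have hlim : Tendsto (fun s => -(t / (s + t))) atTop (𝓝 0) := by
    have : Tendsto (fun s => t / (s + t)) atTop (𝓝 0) :=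
      Tendsto.div_atTop tendsto_const_nhds (tendsto_atTop_add_const_right _ _ tendsto_id)
    simpa using this.neg
  rw [integral_Ioi_of_hasDerivAt_of_nonneg' hd (fun s _ => by positivity) hlim, add_comm u t]
  ring

/-- The superlevel sets of `κ` contribute elements of the cone to `Φ`. -/
theorem IsIncreasingSlowlyVarying.integral_superlevel_mem_cbfCone
    (hκ : IsIncreasingSlowlyVarying κ) {ψ : Ioi (0 : ℝ) → Ioi (0 : ℝ)}
    (hψ : ∀ u : ℝ, 0 < u → (fun t => (ψ t : ℝ) / (ψ t + u)) ∈ cbfCone) (y : ℝ) :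
    (fun t => ∫ s in Ioi (0 : ℝ), {s | y < κ s}.indicator
      (fun s => (ψ t : ℝ) / (s + ψ t) ^ 2) s) ∈ cbfCone := by
  set U : Set ℝ := {s | 0 < s ∧ y < κ s} with hU
  rcases U.eq_empty_or_nonempty with hE | hE
  · have : ∀ t : Ioi (0 : ℝ), ∫ s in Ioi (0 : ℝ), {s | y < κ s}.indicator
        (fun s => (ψ t : ℝ) / (s + ψ t) ^ 2) s = 0 := by
      intro t
      refine (setIntegral_congr_fun measurableSet_Ioi (g := fun _ => (0 : ℝ)) fun s hs => ?_).trans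
        (by simp)
      refine indicator_of_notMem (fun h => ?_) _
      have : s ∈ U := ⟨hs, h⟩
      rw [hE] at this
      exact this
    simp only [this]
    exact const_mem_cbfCone le_rfl
  -- By monotonicity the superlevel set is a half-line starting at `u`; whether it contains `u` does
  -- not affect the integral.
  · set u := sInf U with hu
    have hb : BddBelow U := ⟨0, fun s hs => hs.1.le⟩
    have hu0 : 0 ≤ u := le_csInf hE fun s hs => hs.1.le
    have hval : ∀ t : Ioi (0 : ℝ), ∫ s in Ioi (0 : ℝ), {s | y < κ s}.indicator
        (fun s => (ψ t : ℝ) / (s + ψ t) ^ 2) s = (ψ t : ℝ) / (ψ t + u) := by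
      intro t
      rw [← integral_Ioi_div_add_sq (ψ t).2 hu0, ← integral_indicator measurableSet_Ioi,
        ← integral_indicator measurableSet_Ioi]
      refine integral_congr_ae ?_
      have hne : ∀ᵐ s : ℝ, s ≠ u := by simp [ae_iff]
      filter_upwards [hne] with s hs
      by_cases h1 : u < s
      · have hs0 : 0 < s := hu0.trans_lt h1
        obtain ⟨v, hv, hvs⟩ := exists_lt_of_csInf_lt hE h1
        have h2 : y < κ s := hv.2.trans_le (hκ.le_of_le hv.1 hvs.le)
        rw [indicator_of_mem (show s ∈ Ioi (0 : ℝ) from hs0),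
          indicator_of_mem (show s ∈ Ioi u from h1), indicator_of_mem (show s ∈ {s | y < κ s} from h2)]
      · rw [indicator_of_notMem (show s ∉ Ioi u from h1)]
        by_cases h2 : 0 < s
        · rw [indicator_of_mem (show s ∈ Ioi (0 : ℝ) from h2), indicator_of_notMem]
          intro h3
          have : u ≤ s := csInf_le hb ⟨h2, h3⟩
          exact h1 (lt_of_le_of_ne this hs.symm)
        · rw [indicator_of_notMem (show s ∉ Ioi (0 : ℝ) from h2)]
    simp only [hval]
    rcases hu0.eq_or_lt with h | h
    · rw [← h]
      convert const_mem_cbfCone zero_le_one using 1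
      funext t
      have : (ψ t : ℝ) ≠ 0 := (mem_Ioi.1 (ψ t).2).ne'
      simp [this]
    · exact hψ u h

/-- Layer-cake decomposition: write `κ s` as the integral over `y > 0` of the indicator of `y < κ s`
and exchange the integrals. Each superlevel set contributes some `ψ / (ψ + u)`. -/
theorem IsIncreasingSlowlyVarying.Phi_comp_mem_cbfCone
    (hκ : IsIncreasingSlowlyVarying κ) {ψ : Ioi (0 : ℝ) → Ioi (0 : ℝ)}
    (hψ : ∀ u : ℝ, 0 < u → (fun t => (ψ t : ℝ) / (ψ t + u)) ∈ cbfCone) :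
    (fun t => Phi κ (ψ t)) ∈ cbfCone := by
  -- Extension by `0` is monotone on the whole line, hence Borel, which makes the region under the
  -- graph measurable.
  set k : ℝ → ℝ := fun s => if 0 < s then κ s else 0 with hk
  have hkmono : Monotone k := by
    intro a b hab
    simp only [hk]
    split_ifs with h1 h2 h2
    · exact hκ.le_of_le h1 hab
    · exact absurd (h1.trans_le hab) h2
    · exact (hκ.pos b h2).le
    · exact le_rfl
  have hkm : Measurable k := hkmono.measurable
  set D : Set (ℝ × ℝ) := {p | p.2 < k p.1} with hD
  have hDm : MeasurableSet D := measurableSet_lt measurable_snd (hkm.comp measurable_fst)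
  have hint : ∀ t : Ioi (0 : ℝ), Integrable
      (Function.uncurry fun s y : ℝ => D.indicator (fun p => (ψ t : ℝ) / (p.1 + ψ t) ^ 2) (s, y))
      ((volume.restrict (Ioi 0)).prod (volume.restrict (Ioi 0))) ∧
      ∫ s in Ioi (0 : ℝ), ∫ y in Ioi (0 : ℝ),
        D.indicator (fun p => (ψ t : ℝ) / (p.1 + ψ t) ^ 2) (s, y) = Phi κ (ψ t) := by
    intro t
    have ht : (0 : ℝ) < ψ t := (ψ t).2
    have hm : Measurable
      (Function.uncurry fun s y : ℝ =>
        D.indicator (fun p => (ψ t : ℝ) / (p.1 + ψ t) ^ 2) (s, y)) :=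
      (by fun_prop : Measurable fun p : ℝ × ℝ => (ψ t : ℝ) / (p.1 + ψ t) ^ 2).indicator hDm
    have hslice : ∀ s : ℝ, 0 < s → ∀ y : ℝ, y ∈ Ioi (0 : ℝ) →
        D.indicator (fun p => (ψ t : ℝ) / (p.1 + ψ t) ^ 2) (s, y) =
        (Iio (κ s)).indicator (fun _ => (ψ t : ℝ) / (s + ψ t) ^ 2) y := by
      intro s hs y _
      simp only [indicator, hD, mem_ofPred_eq, hk, if_pos hs, mem_Iio]
    have hslice_int : ∀ s : ℝ, 0 < s → IntegrableOn
        (fun y => D.indicator (fun p => (ψ t : ℝ) / (p.1 + ψ t) ^ 2) (s, y)) (Ioi 0) := by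
      intro s hs
      refine IntegrableOn.congr_fun ?_ (fun y hy => (hslice s hs y hy).symm) measurableSet_Ioi
      rw [IntegrableOn, integrable_indicator_iff measurableSet_Iio, IntegrableOn,
        Measure.restrict_restrict measurableSet_Iio]
      refine integrable_const_iff.2 (Or.inr ?_)
      constructor
      rw [Measure.restrict_apply_univ, Iio_inter_Ioi]
      exact measure_Ioo_lt_top
    have hslice_val : ∀ s : ℝ, 0 < s → ∫ y in Ioi (0 : ℝ),
        D.indicator (fun p => (ψ t : ℝ) / (p.1 + ψ t) ^ 2) (s, y) =
        (ψ t : ℝ) * (κ s / (s + ψ t) ^ 2) := by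
      intro s hs
      rw [setIntegral_congr_fun measurableSet_Ioi (hslice s hs),
        integral_indicator measurableSet_Iio, Measure.restrict_restrict measurableSet_Iio,
        Iio_inter_Ioi, setIntegral_const, Real.volume_real_Ioo_of_le (hκ.pos s hs).le, sub_zero,
        smul_eq_mul]
      ring
    have hk2 : IntegrableOn (fun s => (ψ t : ℝ) * (κ s / (s + ψ t) ^ 2)) (Ioi 0) := by
      have h1 := (integrableOn_Ioi_comp_mul_left_iff
        (fun v : ℝ => κ (ψ t * v) / (v + 1) ^ 2) 0 (inv_pos.2 ht)).2
        (by simpa using hκ.integrableOn_comp_mul ht)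
      refine IntegrableOn.congr_fun (Integrable.const_mul h1 (ψ t : ℝ)⁻¹) (fun s hs => ?_)
        measurableSet_Ioi
      have hs' : (0 : ℝ) < s := hs
      have e : (ψ t : ℝ)⁻¹ * s + 1 = (s + ψ t) / ψ t := by field_simp
      simp only [mul_inv_cancel_left₀ ht.ne', e]
      field_simp
    refine ⟨?_, ?_⟩
    · rw [integrable_prod_iff hm.aestronglyMeasurable]
      refine ⟨?_, ?_⟩
      · filter_upwards [ae_restrict_mem measurableSet_Ioi] with s hs using hslice_int s hs
      · refine IntegrableOn.congr_fun hk2 (fun s hs => ?_) measurableSet_Ioi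
        rw [← hslice_val s hs]
        refine integral_congr_ae (.of_forall fun y => ?_)
        simp only [Function.uncurry_apply_pair]
        rw [Real.norm_of_nonneg]
        exact indicator_nonneg (fun p _ => by positivity) _
    · rw [setIntegral_congr_fun measurableSet_Ioi (fun s hs => hslice_val s hs),
        integral_const_mul, Phi, stieltjesFn]
  have hmem := integral_mem_cbfCone (μ := volume.restrict (Ioi (0 : ℝ)))
    (φ := fun y t => ∫ s in Ioi (0 : ℝ),
      D.indicator (fun p => (ψ t : ℝ) / (p.1 + ψ t) ^ 2) (s, y)) (.of_forall fun y => by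
        convert hκ.integral_superlevel_mem_cbfCone hψ y using 1
        funext t
        refine setIntegral_congr_fun measurableSet_Ioi fun s hs => ?_
        have hs' : 0 < s := hs
        simp only [indicator, hD, mem_ofPred_eq, hk, if_pos hs'])
    (fun t => (hint t).1.integral_prod_right)
  convert hmem using 1
  funext t
  rw [← (hint t).2, integral_integral_swap (hint t).1]

theorem IsIncreasingSlowlyVarying.isCBF_Phi (hκ : IsIncreasingSlowlyVarying κ) : IsCBF (Phi κ) :=
  isCBF_of_mem_cbfCone (hκ.Phi_comp_mem_cbfCone (ψ := id) fun _ hu => div_add_mem_cbfCone hu)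
    (hκ.Phi_pos one_pos)

theorem IsIncreasingSlowlyVarying.comp_rpow {ℓ : ℝ → ℝ} (hℓ : IsIncreasingSlowlyVarying ℓ) {p : ℝ}
    (hp : 0 < p) : IsIncreasingSlowlyVarying fun r => ℓ (r ^ p) where
  pos s hs := hℓ.pos _ (Real.rpow_pos_of_pos hs p)
  measurable := hℓ.measurable.comp (f := fun s : Ioi (0 : ℝ) =>
    (⟨(s : ℝ) ^ p, Real.rpow_pos_of_pos s.2 p⟩ : Ioi (0 : ℝ))) (by fun_prop)
  mono s hs t ht hst := hℓ.mono (Real.rpow_pos_of_pos hs p) (Real.rpow_pos_of_pos ht p)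
    (Real.rpow_le_rpow (le_of_lt hs) hst hp.le)
  slow c hc := by
    have h := (hℓ.slow (c ^ p) (Real.rpow_pos_of_pos hc p)).comp (tendsto_rpow_atTop hp)
    refine h.congr' ?_
    filter_upwards [eventually_gt_atTop 0] with s hs
    simp only [Function.comp_apply]
    rw [Real.mul_rpow hc.le hs.le]

theorem Psi_eq_inv_Phi (ℓ : ℝ → ℝ) (ε : ℝ) {s : ℝ} (hs : 0 < s) :
    Psi ℓ ε s = (Phi (fun r => ℓ (r ^ (1 / ε))) (s⁻¹ ^ ε))⁻¹ := by
  have := Real.rpow_pos_of_pos hs ε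
  rw [Psi, Phi, Real.inv_rpow hs.le, one_div (s ^ ε), mul_inv, inv_inv, div_eq_mul_inv]

/-- `Ψ_ε` is obtained from `t ↦ Φ_h(t ^ ε)` by the involution `f(t) ↦ 1 / f(1/t)`. The composition
stays in the cone because the involution also maps `1 + u t ^ ε` to `t ^ ε / (t ^ ε + u)`. -/
theorem IsIncreasingSlowlyVarying.isCBF_Psi {ℓ : ℝ → ℝ} (hℓ : IsIncreasingSlowlyVarying ℓ) {ε : ℝ}
    (hε : 0 < ε) (hε1 : ε ≤ 1) : IsCBF (Psi ℓ ε) := by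
  have hh := hℓ.comp_rpow (one_div_pos.2 hε)
  set ψ : Ioi (0 : ℝ) → Ioi (0 : ℝ) := fun t => ⟨(t : ℝ) ^ ε, Real.rpow_pos_of_pos t.2 ε⟩ with hψ
  have h1 : ∀ u : ℝ, 0 < u → (fun t => (ψ t : ℝ) / (ψ t + u)) ∈ cbfCone := by
    intro u hu
    have hpow : ∀ t : Ioi (0 : ℝ), 0 < (t : ℝ) ^ ε := fun t => Real.rpow_pos_of_pos t.2 ε
    have := inv_comp_inv_mem_cbfCone
      (cbfCone.add_mem (const_mem_cbfCone zero_le_one)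
        (smul_mem_cbfCone hu.le (rpow_mem_cbfCone hε hε1)))
      (fun t => by
        have := hpow t
        simp only [Pi.add_apply]; positivity)
    convert this using 1
    funext t
    have h2 := hpow t
    simp only [Pi.add_apply, hψ]
    rw [Real.inv_rpow (le_of_lt t.2)]
    field_simp
  have h2 := inv_comp_inv_mem_cbfCone (hh.Phi_comp_mem_cbfCone h1)
    (fun t => hh.Phi_pos (ψ t).2)
  refine isCBF_of_mem_cbfCone ?_ ?_
  · convert h2 using 1
    funext t
    exact Psi_eq_inv_Phi ℓ ε t.2
  · rw [Psi_eq_inv_Phi ℓ ε one_pos]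
    exact inv_pos.2 (hh.Phi_pos (by positivity))

/-- `Ψ_ε(1/r)` is the reciprocal of `Φ_h(r ^ ε)`, which is comparable to `h(r ^ ε) = ℓ r`. -/
theorem IsIncreasingSlowlyVarying.exists_Psi_bounds {ℓ : ℝ → ℝ} (hℓ : IsIncreasingSlowlyVarying ℓ)
    {ε : ℝ} (hε : 0 < ε) : ∃ c C : ℝ, 0 < c ∧ 0 < C ∧ ∀ r : ℝ, 1 ≤ r →
      c ≤ ℓ r * Psi ℓ ε r⁻¹ ∧ ℓ r * Psi ℓ ε r⁻¹ ≤ C := by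
  have hh := hℓ.comp_rpow (one_div_pos.2 hε)
  obtain ⟨c, hc, h1⟩ := hh.exists_le_Phi
  obtain ⟨C, hC, h2⟩ := hh.exists_Phi_le
  refine ⟨C⁻¹, c⁻¹, inv_pos.2 hC, inv_pos.2 hc, fun r hr => ?_⟩
  have hr0 : 0 < r := by linarith
  have hrε : 0 < r ^ ε := Real.rpow_pos_of_pos hr0 ε
  have hℓr := hℓ.pos r hr0
  have e : (r ^ ε) ^ (1 / ε) = r := by
    rw [← Real.rpow_mul hr0.le, mul_one_div_cancel hε.ne', Real.rpow_one]
  have h3 := h1 (r ^ ε) hrε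
  have h4 := h2 (r ^ ε) (Real.one_le_rpow hr hε.le)
  have hp := hh.Phi_pos hrε
  simp only [e] at h3 h4
  rw [Psi_eq_inv_Phi ℓ ε (inv_pos.2 hr0), inv_inv, ← div_eq_mul_inv]
  refine ⟨?_, ?_⟩
  · rw [le_div_iff₀ hp, inv_mul_le_iff₀ hC]; exact h4
  · rw [div_le_iff₀ hp, ← div_eq_inv_mul, le_div_iff₀ hc]; linarith

end SlowlyVarying

end


/-! ### Bounded inverses and resolvents -/

section Operators

variable {X : Type*} [NormedAddCommGroup X] [NormedSpace ℂ X] {A : X →ₗ.[ℂ] X}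

theorem IsBoundedInverse.unique {T : X →ₗ.[ℂ] X} {S S' : X →L[ℂ] X} (h : IsBoundedInverse T S)
    (h' : IsBoundedInverse T S') : S = S' := by
  ext y
  obtain ⟨hy, hT⟩ := h'.2 y
  have := h.1 ⟨S' y, hy⟩
  rwa [hT] at this

theorem IsBoundedInverse.binv_eq {T : X →ₗ.[ℂ] X} {S : X →L[ℂ] X} (h : IsBoundedInverse T S) :
    binv T = S := by
  have hex : ∃ S : X →L[ℂ] X, IsBoundedInverse T S := ⟨S, h⟩
  rw [binv, dif_pos hex]
  exact hex.choose_spec.unique h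

theorem isBoundedInverse_binv {T : X →ₗ.[ℂ] X} (h : ∃ S : X →L[ℂ] X, IsBoundedInverse T S) :
    IsBoundedInverse T (binv T) := by
  rw [h.choose_spec.binv_eq]; exact h.choose_spec

theorem shift_shift (A : X →ₗ.[ℂ] X) (u v : ℂ) : shift (shift A u) v = shift A (u + v) := by
  refine LinearPMap.ext rfl fun x h _ => ?_
  change v • x + (u • x + A ⟨x, h⟩) = (u + v) • x + A ⟨x, h⟩
  rw [add_smul]; abel

theorem shift_zero (A : X →ₗ.[ℂ] X) : shift A 0 = A := by
  refine LinearPMap.ext rfl fun x h _ => ?_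
  change (0 : ℂ) • x + A ⟨x, h⟩ = A ⟨x, h⟩
  rw [zero_smul, zero_add]

theorem zero_mem_resolventSet_iff :
    0 ∈ resolventSet A ↔ ∃ S : X →L[ℂ] X, IsBoundedInverse A S := by
  rw [resolventSet, mem_ofPred_eq, neg_zero, shift_zero]

theorem IsBoundedInverse.mem_domain {u : ℂ} {S : X →L[ℂ] X} (h : IsBoundedInverse (shift A u) S)
    (y : X) : S y ∈ A.domain := (h.2 y).choose

theorem IsBoundedInverse.apply_inverse {u : ℂ} {S : X →L[ℂ] X}
    (h : IsBoundedInverse (shift A u) S) (y : X) :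
    A ⟨S y, h.mem_domain y⟩ = y - u • S y := by
  have h2 : u • S y + A ⟨S y, h.mem_domain y⟩ = y := (h.2 y).choose_spec
  rw [eq_sub_iff_add_eq, add_comm]; exact h2

/-- The resolvent identity. -/
theorem IsBoundedInverse.sub_eq {u v : ℂ} {S S' : X →L[ℂ] X} (h : IsBoundedInverse (shift A u) S)
    (h' : IsBoundedInverse (shift A v) S') : S - S' = (v - u) • (S * S') := by
  ext y
  have h1 : S (u • S' y + A ⟨S' y, h'.mem_domain y⟩) = S' y := h.1 ⟨S' y, h'.mem_domain y⟩
  rw [h'.apply_inverse] at h1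
  have h2 : u • S' y + (y - v • S' y) = y - (v - u) • S' y := by rw [sub_smul]; abel
  rw [h2, map_sub, map_smul] at h1
  change S y - S' y = (v - u) • S (S' y)
  nth_rewrite 1 [← h1]
  abel

theorem exists_isBoundedInverse_shift (hρ : ∀ z : ℂ, z.re ≤ 0 → z ∈ resolventSet A) {z : ℂ}
    (hz : 0 ≤ z.re) : IsBoundedInverse (shift A z) (binv (shift A z)) := by
  have := hρ (-z) (by simpa using hz)
  rw [resolventSet, mem_ofPred_eq, neg_neg] at this
  exact isBoundedInverse_binv this

theorem IsSectorial.exists_norm_binv_le {ω : ℝ} (hω' : ω < Real.pi)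
    (hA : IsSectorial A ω) : ∃ M : ℝ, 0 ≤ M ∧ ∀ s : ℝ, 0 < s → ‖binv (shift A s)‖ ≤ M / s := by
  obtain ⟨M, hM⟩ := hA.2 ((ω + Real.pi) / 2) (by linarith) (by linarith)
  have h : ∀ s : ℝ, 0 < s → s * ‖binv (shift A s)‖ ≤ M := fun s hs => by
    have h1 := hM (-(s : ℂ)) ?_
    · rwa [neg_neg, norm_neg, Complex.norm_real, Real.norm_of_nonneg hs.le] at h1
    · rw [closedSector, mem_ofPred_eq, not_or]
      refine ⟨by simpa using hs.ne', ?_⟩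
      have : (-(s : ℂ)) = ((-s : ℝ) : ℂ) := by push_cast; rfl
      rw [this, Complex.arg_ofReal_of_neg (by linarith), abs_of_pos Real.pi_pos, not_le]
      linarith
  refine ⟨M, (mul_nonneg one_pos.le (norm_nonneg _)).trans (h 1 one_pos), fun s hs => ?_⟩
  rw [le_div_iff₀ hs, mul_comm]
  exact h s hs

/-- Bounded operators with full domain are closed. -/
theorem isClosed_ofBounded (F : X →L[ℂ] X) : (ofBounded F).IsClosed := by
  have : ((ofBounded F).graph : Set (X × X)) = {p | F p.1 = p.2} := by
    ext p
    simp only [SetLike.mem_coe, LinearPMap.mem_graph_iff, mem_ofPred_eq]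
    constructor
    · rintro ⟨x, hx, hp⟩
      rw [← hx, ← hp]; rfl
    · intro h
      exact ⟨⟨p.1, trivial⟩, rfl, h⟩
  rw [LinearPMap.IsClosed, this]
  exact isClosed_eq (F.continuous.comp continuous_fst) continuous_snd

theorem isBoundedInverse_shift_ofBounded {T : X →L[ℂ] X} {s : ℝ}
    (h : IsUnit (s • (1 : X →L[ℂ] X) + T)) :
    IsBoundedInverse (shift (ofBounded T) (s : ℂ)) (res T s) := by
  have key : ∀ x : X, (s : ℂ) • x + T x = (s • (1 : X →L[ℂ] X) + T) x := fun x => by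
    simp
  refine ⟨fun x => ?_, fun y => ⟨trivial, ?_⟩⟩
  · change res T s ((s : ℂ) • (x : X) + T x) = x
    rw [key, res]
    exact congrArg (fun F : X →L[ℂ] X => F x) (Ring.inverse_mul_cancel _ h)
  · change (s : ℂ) • (res T s y) + T (res T s y) = y
    rw [key, res]
    exact congrArg (fun F : X →L[ℂ] X => F y) (Ring.mul_inverse_cancel _ h)

end Operators

section Algebra

variable {𝔸 : Type*} [NormedRing 𝔸] [NormedAlgebra ℝ 𝔸]

/-- If `J` consists of the resolvents of the inverse of `T`, then `T` is non-negative. -/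
theorem nonnegBound_of_resolvent {T : 𝔸} {J : ℝ → 𝔸} {M : ℝ}
    (h₁ : ∀ r, 0 < r → T - J r = r • (T * J r)) (h₂ : ∀ r, 0 < r → T - J r = r • (J r * T))
    (hM : ∀ r, 0 < r → r * ‖J r‖ ≤ M) :
    NonnegBound T (‖(1 : 𝔸)‖ + M) ∧ ∀ t, 0 < t → resMul T t = t⁻¹ • J t⁻¹ := by
  -- If `J r = (r + T⁻¹)⁻¹`, then formally `(t + T)⁻¹ = t⁻¹ (1 - t⁻¹ J(t⁻¹))`; the two hypotheses on
  -- `J` are what is needed to verify this without an inverse of `T`.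
  have hinv : ∀ t : ℝ, 0 < t → IsUnit (t • (1 : 𝔸) + T) ∧
      res T t = t⁻¹ • (1 - t⁻¹ • J t⁻¹) := fun t ht => by
    have h1 := h₁ t⁻¹ (inv_pos.2 ht)
    have h2 := h₂ t⁻¹ (inv_pos.2 ht)
    have e1 : (t • (1 : 𝔸) + T) * (t⁻¹ • (1 - t⁻¹ • J t⁻¹)) = 1 := by
      have : T * J t⁻¹ = t • (T - J t⁻¹) := by rw [h1, smul_inv_smul₀ ht.ne']
      simp only [mul_smul_comm, mul_sub, add_mul, smul_mul_assoc, one_mul, mul_one, this, smul_sub,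
        smul_add, smul_smul]
      field_simp
      simp
    have e2 : (t⁻¹ • (1 - t⁻¹ • J t⁻¹)) * (t • (1 : 𝔸) + T) = 1 := by
      have : J t⁻¹ * T = t • (T - J t⁻¹) := by rw [h2, smul_inv_smul₀ ht.ne']
      simp only [mul_smul_comm, mul_add, sub_mul, smul_mul_assoc, one_mul, mul_one, this, smul_sub,
        smul_smul]
      field_simp
      simp
    exact ⟨⟨⟨_, _, e1, e2⟩, rfl⟩, Ring.inverse_unit ⟨_, _, e1, e2⟩⟩
  have hb : NonnegBound T (‖(1 : 𝔸)‖ + M) := fun t ht => by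
    refine ⟨(hinv t ht).1, ?_⟩
    rw [(hinv t ht).2, norm_smul, norm_inv, Real.norm_of_nonneg ht.le, inv_mul_eq_div]
    gcongr
    refine (norm_sub_le _ _).trans ?_
    gcongr
    rw [norm_smul, norm_inv, Real.norm_of_nonneg ht.le]
    exact hM _ (inv_pos.2 ht)
  refine ⟨hb, fun t ht => ?_⟩
  rw [hb.resMul_eq ht, (hinv t ht).2, smul_inv_smul₀ ht.ne', sub_sub_cancel]

theorem norm_le_one_add {E : Type*} [NormedAddCommGroup E] {R : ℝ → E} {M : ℝ}
    (hM : ∀ s, 0 < s → ‖R s‖ ≤ M / s) {s : ℝ} (hs : 0 < s) :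
    ‖R (1 + s)‖ ≤ M * (1 / (1 + s)) := by
  rw [mul_one_div]; exact hM _ (by linarith)

theorem nonneg_of_norm_le {E : Type*} [NormedAddCommGroup E] {R : ℝ → E} {M : ℝ}
    (hM : ∀ s, 0 < s → ‖R s‖ ≤ M / s) : 0 ≤ M := by
  have := (norm_nonneg _).trans (hM 1 one_pos)
  rwa [div_one] at this

theorem IsPseudoResolvent.one_sub {R : ℝ → 𝔸} (hR : IsPseudoResolvent R) {s : ℝ} (hs : 0 < s) :
    R 1 - R (1 + s) = s • (R 1 * R (1 + s)) ∧ R 1 - R (1 + s) = s • (R (1 + s) * R 1) := by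
  have h := hR 1 (1 + s) one_pos (by linarith)
  rw [add_sub_cancel_left] at h
  refine ⟨h, ?_⟩
  rw [h, (hR.commute one_pos (by linarith)).eq]

theorem IsPseudoResolvent.nonnegBound_one {R : ℝ → 𝔸} {M : ℝ} (hR : IsPseudoResolvent R)
    (hM : ∀ s, 0 < s → ‖R s‖ ≤ M / s) : NonnegBound (R 1) (‖(1 : 𝔸)‖ + M) ∧
      ∀ t, 0 < t → resMul (R 1) t = t⁻¹ • R (1 + t⁻¹) := by
  refine nonnegBound_of_resolvent (J := fun r => R (1 + r)) (fun r hr => (hR.one_sub hr).1)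
    (fun r hr => (hR.one_sub hr).2) fun r hr => ?_
  have hM0 := nonneg_of_norm_le hM
  calc r * ‖R (1 + r)‖ ≤ r * (M * (1 / (1 + r))) := by gcongr; exact norm_le_one_add hM hr
    _ = M * (r / (1 + r)) := by ring
    _ ≤ M * 1 := by gcongr; exact (div_le_one (by linarith)).2 (by linarith)
    _ = M := mul_one M

theorem NonnegBound.add_const {F : 𝔸} {M : ℝ} (h : NonnegBound F M) {a : ℝ} (ha : 0 ≤ a) :
    NonnegBound (a • 1 + F) M := by
  intro t ht
  have h1 := h (t + a) (by linarith)
  have h2 : t • (1 : 𝔸) + (a • 1 + F) = (t + a) • 1 + F := by rw [add_smul, add_assoc]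
  rw [res, h2]
  refine ⟨h1.1, h1.2.trans ?_⟩
  have : 0 ≤ M := h.nonneg
  gcongr
  linarith

end Algebra

/-! ### Complete Bernstein functions of bounded non-negative elements -/

theorem IsStieltjesRep.integrableOn {f : ℝ → ℝ} {a b : ℝ} {μ : Measure ℝ}
    (h : IsStieltjesRep f a b μ) : IntegrableOn (fun s : ℝ => 1 / (1 + s)) (Ioi 0) μ := by
  refine ⟨(by fun_prop : Measurable fun s : ℝ => 1 / (1 + s)).aestronglyMeasurable, ?_⟩
  rw [hasFiniteIntegral_iff_norm]
  refine lt_of_le_of_lt (le_of_eq ?_) h.2.2.1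
  refine setLIntegral_congr_fun measurableSet_Ioi fun s hs => ?_
  have : (0 : ℝ) < s := hs
  simp only [Real.norm_of_nonneg (by positivity : 0 ≤ 1 / (1 + s))]

theorem integrableOn_of_norm_le_one_add {E : Type*} [NormedAddCommGroup E] {μ : Measure ℝ}
    (hμ : IntegrableOn (fun s : ℝ => 1 / (1 + s)) (Ioi 0) μ) {g : ℝ → E}
    (hg : ContinuousOn g (Ioi 0)) {C : ℝ} (hC : ∀ s, 0 < s → ‖g s‖ ≤ C * (1 / (1 + s))) :
    IntegrableOn g (Ioi 0) μ := by
  refine (hμ.const_mul C).mono' (hg.aestronglyMeasurable measurableSet_Ioi) ?_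
  filter_upwards [ae_restrict_mem measurableSet_Ioi] with s hs using hC s hs

theorem norm_setIntegral_le_one_add {E : Type*} [NormedAddCommGroup E] [NormedSpace ℝ E]
    {μ : Measure ℝ} (hμ : IntegrableOn (fun s : ℝ => 1 / (1 + s)) (Ioi 0) μ) {g : ℝ → E}
    {C : ℝ} (hC : ∀ s, 0 < s → ‖g s‖ ≤ C * (1 / (1 + s))) :
    ‖∫ s in Ioi 0, g s ∂μ‖ ≤ C * ∫ s in Ioi 0, 1 / (1 + s) ∂μ := by
  rw [← integral_const_mul]
  refine norm_integral_le_of_norm_le (hμ.const_mul C) ?_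
  filter_upwards [ae_restrict_mem measurableSet_Ioi] with s hs using hC s hs

theorem min_one_inv_le {s : ℝ} (hs : 0 < s) : min 1 s⁻¹ ≤ 2 * (1 / (1 + s)) := by
  rw [mul_one_div, le_div_iff₀ (by linarith), mul_add, mul_one]
  have h1 : min 1 s⁻¹ ≤ 1 := min_le_left _ _
  have h2 : min 1 s⁻¹ * s ≤ 1 := by
    calc min 1 s⁻¹ * s ≤ s⁻¹ * s := by gcongr; exact min_le_right _ _
      _ = 1 := inv_mul_cancel₀ hs.ne'
  linarith

/-- `a + b T + ∫ T (T + s)⁻¹ dμ(s)`. -/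
def cbfOp {𝔸 : Type*} [NormedRing 𝔸] [NormedAlgebra ℝ 𝔸] (a b : ℝ) (μ : Measure ℝ) (T : 𝔸) : 𝔸 :=
  a • 1 + (b • T + ∫ s in Ioi 0, resMul T s ∂μ)

section Real

variable {𝔸 : Type*} [NormedRing 𝔸] [NormedAlgebra ℝ 𝔸] {a b : ℝ} {μ : Measure ℝ}

theorem NonnegBound.exists_norm_resMul_le {T : 𝔸} {M : ℝ} (h : NonnegBound T M) :
    ∃ C : ℝ, 0 ≤ C ∧ ∀ s, 0 < s → ‖resMul T s‖ ≤ C * (1 / (1 + s)) := by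
  have := h.nonneg
  refine ⟨(‖(1 : 𝔸)‖ + M + ‖T‖ * M) * 2, by positivity, fun s hs => ?_⟩
  refine (h.norm_resMul_le hs).trans ?_
  rw [mul_assoc]
  gcongr
  exact min_one_inv_le hs

variable [CompleteSpace 𝔸]

theorem NonnegBound.integrableOn_resMul {T : 𝔸} {M : ℝ} (h : NonnegBound T M)
    (hμ : IntegrableOn (fun s : ℝ => 1 / (1 + s)) (Ioi 0) μ) :
    IntegrableOn (resMul T) (Ioi 0) μ := by
  obtain ⟨C, -, hC⟩ := h.exists_norm_resMul_le
  exact integrableOn_of_norm_le_one_add hμ h.continuousOn_resMul hC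

open scoped NNReal in
-- The integrand lies in the closed cone, and so does `T`, being the limit of `s T (s + T)⁻¹` as `s
-- → ∞`. The non-negative constant only improves the resolvent bound.
theorem NonnegBound.nonnegBound_cbfOp {T : 𝔸} {M : ℝ} (h : NonnegBound T M) (ha : 0 ≤ a)
    (hb : 0 ≤ b) (hμ : IntegrableOn (fun s : ℝ => 1 / (1 + s)) (Ioi 0) μ) :
    NonnegBound (cbfOp a b μ T) (max ‖(1 : 𝔸)‖ M) := by
  have hmem : ∀ s : ℝ, 0 < s → resMul T s ∈ bernsteinCone (res T) := fun s hs => by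
    rw [h.resMul_eq hs]; exact mem_bernsteinCone _ hs
  have hT : T ∈ bernsteinCone (res T) := by
    obtain ⟨C, hC0, hC⟩ := h.exists_norm_resMul_le
    have h0 : Tendsto (fun s : ℝ => C * (1 / (1 + s))) atTop (𝓝 0) := by
      have : Tendsto (fun s : ℝ => 1 + s) atTop atTop := tendsto_atTop_add_const_left _ _ tendsto_id
      simpa using (this.inv_tendsto_atTop).const_mul C
    have h1 : Tendsto (resMul T) atTop (𝓝 0) :=
      squeeze_zero_norm' (by filter_upwards [eventually_gt_atTop 0] with s hs using hC s hs) h0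
    have h2 : Tendsto (fun s : ℝ => T * (1 - resMul T s)) atTop (𝓝 T) := by
      simpa using (h1.const_sub 1).const_mul T
    refine (isClosed_bernsteinCone (res T)).mem_of_tendsto h2 ?_
    filter_upwards [eventually_gt_atTop 0] with s hs
    rw [← h.smul_res hs, mul_smul_comm]
    exact Submodule.smul_mem (R := ℝ≥0) _ ⟨s, hs.le⟩ (hmem s hs)
  refine NonnegBound.add_const ?_ ha
  refine nonnegBound_of_mem_bernsteinCone h.isPseudoResolvent (fun s hs => (h s hs).2) ?_
  refine Submodule.add_mem _ (Submodule.smul_mem (R := ℝ≥0) _ ⟨b, hb⟩ hT) ?_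
  refine integral_mem_of_isClosed _ (isClosed_bernsteinCone _) (h.integrableOn_resMul hμ) ?_
  filter_upwards [ae_restrict_mem measurableSet_Ioi] with s hs using hmem s hs

end Real

/-! ### Complete Bernstein functions on the right half-plane -/

section Complex

variable {a b : ℝ} {μ : Measure ℝ} {w : ℂ}

theorem integrableOn_div_add (hμ : IntegrableOn (fun s : ℝ => 1 / (1 + s)) (Ioi 0) μ) {t : ℝ}
    (ht : 0 < t) : IntegrableOn (fun s : ℝ => t / (t + s)) (Ioi 0) μ := by
  refine integrableOn_of_norm_le_one_add hμ (C := t + 1) ?_ fun s hs => ?_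
  · refine continuousOn_const.div (by fun_prop) fun s hs => ?_
    have : (0 : ℝ) < s := hs
    positivity
  · rw [Real.norm_of_nonneg (by positivity), mul_one_div, div_le_div_iff₀ (by positivity)
      (by positivity)]
    nlinarith

theorem cbfOp_complex (a b : ℝ) (μ : Measure ℝ) (w : ℂ) :
    cbfOp a b μ w = a + (b * w + ∫ s in Ioi (0 : ℝ), w / ((s : ℂ) + w) ∂μ) := by
  simp only [cbfOp, resMul_complex, Complex.real_smul, mul_one]

theorem integrableOn_complex_div_add (hμ : IntegrableOn (fun s : ℝ => 1 / (1 + s)) (Ioi 0) μ)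
    (hw : 0 ≤ w.re) : IntegrableOn (fun s : ℝ => w / ((s : ℂ) + w)) (Ioi 0) μ := by
  refine ((nonnegBound_complex hw).integrableOn_resMul hμ).congr_fun (fun s _ => ?_)
    measurableSet_Ioi
  exact resMul_complex w s

theorem norm_cbfOp_complex_le (ha : 0 ≤ a) (hb : 0 ≤ b)
    (hμ : IntegrableOn (fun s : ℝ => 1 / (1 + s)) (Ioi 0) μ) (hw : 0 ≤ w.re) (hw0 : w ≠ 0) :
    ‖cbfOp a b μ w‖ ≤ 2 * (a + b * ‖w‖ + ∫ s in Ioi (0 : ℝ), ‖w‖ / (‖w‖ + s) ∂μ) := by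
  have hn : 0 < ‖w‖ := norm_pos_iff.2 hw0
  have h1 : ‖∫ s in Ioi (0 : ℝ), w / ((s : ℂ) + w) ∂μ‖ ≤
      2 * ∫ s in Ioi (0 : ℝ), ‖w‖ / (‖w‖ + s) ∂μ := by
    rw [← integral_const_mul]
    refine norm_integral_le_of_norm_le ((integrableOn_div_add hμ hn).const_mul 2) ?_
    filter_upwards [ae_restrict_mem measurableSet_Ioi] with s hs
    have hs' : (0 : ℝ) < s := hs
    rw [norm_div, mul_div_assoc', div_le_div_iff₀ (norm_pos_iff.2 (ofReal_add_ne_zero hw hs'))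
      (by positivity)]
    have := add_norm_le_two_mul hw hs'.le
    nlinarith
  rw [cbfOp_complex]
  refine (norm_add_le _ _).trans ((add_le_add_right (norm_add_le _ _) _).trans ?_)
  rw [norm_mul, Complex.norm_real, Complex.norm_real, Real.norm_of_nonneg ha,
    Real.norm_of_nonneg hb]
  have : 0 ≤ b * ‖w‖ := by positivity
  linarith

theorem div_ofReal_add_re (w : ℂ) (s : ℝ) :
    (w / ((s : ℂ) + w)).re = (s * w.re + ‖w‖ ^ 2) / ‖(s : ℂ) + w‖ ^ 2 := by
  rw [Complex.div_re, ← Complex.normSq_eq_norm_sq, ← Complex.normSq_eq_norm_sq,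
    Complex.normSq_apply w]
  simp only [Complex.add_re, Complex.ofReal_re, Complex.add_im, Complex.ofReal_im, zero_add]
  ring

theorem div_ofReal_add_im (w : ℂ) (s : ℝ) :
    (w / ((s : ℂ) + w)).im = s * w.im / ‖(s : ℂ) + w‖ ^ 2 := by
  rw [Complex.div_im, ← Complex.normSq_eq_norm_sq]
  simp only [Complex.add_re, Complex.ofReal_re, Complex.add_im, Complex.ofReal_im, zero_add]
  ring

theorem cbfOp_complex_re (hμ : IntegrableOn (fun s : ℝ => 1 / (1 + s)) (Ioi 0) μ)
    (hw : 0 ≤ w.re) : (cbfOp a b μ w).re =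
      a + (b * w.re + ∫ s in Ioi (0 : ℝ), (w / ((s : ℂ) + w)).re ∂μ) := by
  have h := Complex.reCLM.integral_comp_comm (integrableOn_complex_div_add hμ hw)
  simp only [Complex.reCLM_apply] at h
  rw [cbfOp_complex, h]
  simp

theorem cbfOp_complex_im (hμ : IntegrableOn (fun s : ℝ => 1 / (1 + s)) (Ioi 0) μ)
    (hw : 0 ≤ w.re) : (cbfOp a b μ w).im =
      b * w.im + ∫ s in Ioi (0 : ℝ), (w / ((s : ℂ) + w)).im ∂μ := by
  have h := Complex.imCLM.integral_comp_comm (integrableOn_complex_div_add hμ hw)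
  simp only [Complex.imCLM_apply] at h
  rw [cbfOp_complex, h]
  simp

theorem cbfOp_complex_re_nonneg (ha : 0 ≤ a) (hb : 0 ≤ b)
    (hμ : IntegrableOn (fun s : ℝ => 1 / (1 + s)) (Ioi 0) μ) (hw : 0 ≤ w.re) :
    0 ≤ (cbfOp a b μ w).re := by
  rw [cbfOp_complex_re hμ hw]
  have : 0 ≤ ∫ s in Ioi (0 : ℝ), (w / ((s : ℂ) + w)).re ∂μ := by
    refine setIntegral_nonneg measurableSet_Ioi fun s hs => ?_
    have : (0 : ℝ) < s := hs
    rw [div_ofReal_add_re]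
    positivity
  positivity

/-- For every `s` the real part of `w / (s + w)` is non-negative and its imaginary part has the sign
of `w.im`. Hence nothing cancels in the integral, and `|f(w)|` is bounded below by half of `f(|w|)`.
-/
theorem le_norm_cbfOp_complex (hb : 0 ≤ b)
    (hμ : IntegrableOn (fun s : ℝ => 1 / (1 + s)) (Ioi 0) μ) (hw : 0 ≤ w.re) (hw0 : w ≠ 0) :
    a + b * ‖w‖ + ∫ s in Ioi (0 : ℝ), ‖w‖ / (‖w‖ + s) ∂μ ≤ 2 * ‖cbfOp a b μ w‖ := by
  have hn : 0 < ‖w‖ := norm_pos_iff.2 hw0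
  obtain ⟨σ, hσ, hσw⟩ : ∃ σ : ℝ, |σ| = 1 ∧ σ * w.im = |w.im| := by
    rcases le_total 0 w.im with h | h
    · exact ⟨1, abs_one, by rw [one_mul, abs_of_nonneg h]⟩
    · exact ⟨-1, by simp, by rw [abs_of_nonpos h, neg_one_mul]⟩
  have hww : ‖w‖ ≤ w.re + |w.im| := by
    simpa only [abs_of_nonneg hw] using Complex.norm_le_abs_re_add_abs_im w
  have hi := integrableOn_complex_div_add hμ hw
  have hire := Complex.reCLM.integrable_comp hi
  have hiim := (Complex.imCLM.integrable_comp hi).const_mul σ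
  simp only [Complex.reCLM_apply] at hire
  simp only [Complex.imCLM_apply] at hiim
  have h1 : ∫ s in Ioi (0 : ℝ), ‖w‖ / (‖w‖ + s) ∂μ ≤
      (∫ s in Ioi (0 : ℝ), (w / ((s : ℂ) + w)).re ∂μ) +
        σ * ∫ s in Ioi (0 : ℝ), (w / ((s : ℂ) + w)).im ∂μ := by
    rw [← integral_const_mul, ← integral_add hire hiim]
    refine setIntegral_mono_on (integrableOn_div_add hμ hn) (hire.add hiim) measurableSet_Ioi
      fun s hs => ?_
    have hs' : (0 : ℝ) < s := hs
    have hne : 0 < ‖(s : ℂ) + w‖ := norm_pos_iff.2 (ofReal_add_ne_zero hw hs')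
    have hle : ‖(s : ℂ) + w‖ ≤ s + ‖w‖ := by
      refine (norm_add_le _ _).trans_eq ?_
      rw [Complex.norm_real, Real.norm_of_nonneg hs'.le]
    have e : (w / ((s : ℂ) + w)).re + σ * (w / ((s : ℂ) + w)).im =
        (s * (w.re + |w.im|) + ‖w‖ ^ 2) / ‖(s : ℂ) + w‖ ^ 2 := by
      rw [div_ofReal_add_re, div_ofReal_add_im, ← hσw]; ring
    rw [e, div_le_div_iff₀ (by positivity) (by positivity)]
    calc ‖w‖ * ‖(s : ℂ) + w‖ ^ 2 ≤ ‖w‖ * (s + ‖w‖) ^ 2 := by gcongr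
      _ = (s * ‖w‖ + ‖w‖ ^ 2) * (‖w‖ + s) := by ring
      _ ≤ _ := by gcongr
  have h2 : (cbfOp a b μ w).re + σ * (cbfOp a b μ w).im ≤ 2 * ‖cbfOp a b μ w‖ := by
    have e1 := Complex.re_le_norm (cbfOp a b μ w)
    have e2 : σ * (cbfOp a b μ w).im ≤ ‖cbfOp a b μ w‖ := by
      refine (le_abs_self _).trans ?_
      rw [abs_mul, hσ, one_mul]
      exact Complex.abs_im_le_norm _
    linarith
  rw [cbfOp_complex_re hμ hw, cbfOp_complex_im hμ hw] at h2
  have h3 : b * ‖w‖ ≤ b * (w.re + |w.im|) := by gcongr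
  rw [← hσw] at h3
  linarith

end Complex

/-! ### Resolvent estimates -/

section Algebra

variable {𝔸 : Type*} [NormedRing 𝔸] [NormedAlgebra ℂ 𝔸] [CompleteSpace 𝔸] {a b : ℝ} {μ : Measure ℝ}

/-- With the error term `E = c T`, the defect at node `s` is `s (s + c)⁻¹ c T (s + T)⁻¹`, of norm at
most a multiple of `‖c‖ / (1 + s)`. It is integrable against `μ`, so the total error is linear in
`‖c‖`. -/
theorem NonnegBound.exists_norm_cbfOp_sub_le {T : 𝔸} {M : ℝ} (h : NonnegBound T M) (hb : 0 ≤ b)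
    (hμ : IntegrableOn (fun s : ℝ => 1 / (1 + s)) (Ioi 0) μ) :
    ∃ C : ℝ, 0 ≤ C ∧ ∀ (R : 𝔸) (c : ℂ), 0 ≤ c.re → R * T = c • R - c • T →
      ‖cbfOp a b μ c • R - R * cbfOp a b μ T‖ ≤ C * ‖c‖ := by
  obtain ⟨C, hC0, hC⟩ := h.exists_norm_resMul_le
  have hI0 : 0 ≤ ∫ s in Ioi (0 : ℝ), 1 / (1 + s) ∂μ := by
    refine setIntegral_nonneg measurableSet_Ioi fun s hs => ?_
    have : (0 : ℝ) < s := hs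
    positivity
  refine ⟨b * ‖T‖ + 2 * C * ∫ s in Ioi (0 : ℝ), 1 / (1 + s) ∂μ, by positivity,
    fun R c hc hR => ?_⟩
  have hi := h.integrableOn_resMul hμ
  have hic := (nonnegBound_complex hc).integrableOn_resMul hμ
  have e : cbfOp a b μ c • R - R * cbfOp a b μ T =
      b • (c • T) + ∫ s in Ioi (0 : ℝ), (resMul c s • R - R * resMul T s) ∂μ := by
    rw [integral_sub (hic.smul_const R) (Integrable.const_mul (f := fun s => resMul T s) hi R), integral_smul_const,
      integral_const_mul_of_integrable hi]
    simp only [cbfOp, add_smul, mul_add, smul_assoc, one_smul, mul_smul_comm, mul_one, hR, smul_sub]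
    abel
  rw [e, add_mul]
  refine (norm_add_le _ _).trans (add_le_add (le_of_eq ?_) ?_)
  · rw [norm_smul, norm_smul, Real.norm_of_nonneg hb]; ring
  · have : 2 * C * (∫ s in Ioi (0 : ℝ), 1 / (1 + s) ∂μ) * ‖c‖ =
      (2 * C * ‖c‖) * ∫ s in Ioi (0 : ℝ), 1 / (1 + s) ∂μ := by ring
    rw [this]
    refine norm_setIntegral_le_one_add hμ fun s hs => ?_
    have hne : 0 < ‖(s : ℂ) + c‖ := norm_pos_iff.2 (ofReal_add_ne_zero hc hs)
    rw [h.mul_resMul_of_mul_eq hc hR hs, sub_sub_cancel, ← h.smul_res hs, smul_mul_assoc,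
      mul_smul_comm, ← resMul, norm_smul, norm_smul, norm_smul, norm_inv, Real.norm_of_nonneg hs.le]
    have h2 := add_norm_le_two_mul hc hs.le
    have h3 : ‖(s : ℂ) + c‖⁻¹ * s ≤ 2 := by
      rw [inv_mul_le_iff₀ hne]; linarith [norm_nonneg c]
    calc ‖(s : ℂ) + c‖⁻¹ * (‖c‖ * (s * ‖resMul T s‖)) =
          (‖(s : ℂ) + c‖⁻¹ * s) * ‖c‖ * ‖resMul T s‖ := by ring
      _ ≤ 2 * ‖c‖ * (C * (1 / (1 + s))) := by gcongr; exact hC s hs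
      _ = _ := by ring

theorem IsIncreasingSlowlyVarying.exists_rpow_mul_rpow_le {κ : ℝ → ℝ}
    (hκ : IsIncreasingSlowlyVarying κ) {p δ : ℝ} (hp : 0 ≤ p) (hδ : 0 < δ) :
    ∃ C : ℝ, 0 < C ∧ ∀ r : ℝ, 1 ≤ r → κ r ^ p * r ^ (-δ) ≤ C := by
  obtain ⟨C, hC, h⟩ := hκ.exists_le_rpow (δ := δ / (p + 1)) (by positivity)
  refine ⟨C ^ p, by positivity, fun r hr => ?_⟩
  have hr0 : 0 < r := by linarith
  have h1 : κ r ^ p ≤ C ^ p * r ^ δ := by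
    calc κ r ^ p ≤ (C * r ^ (δ / (p + 1))) ^ p :=
          Real.rpow_le_rpow (hκ.pos r hr0).le (h r hr) hp
      _ = C ^ p * r ^ (δ / (p + 1) * p) := by
          rw [Real.mul_rpow hC.le (by positivity), ← Real.rpow_mul hr0.le]
      _ ≤ C ^ p * r ^ δ := by
          gcongr
          rw [div_mul_eq_mul_div, div_le_iff₀ (by positivity)]
          nlinarith
  calc κ r ^ p * r ^ (-δ) ≤ C ^ p * r ^ δ * r ^ (-δ) := by gcongr
    _ = C ^ p := by rw [mul_assoc, ← Real.rpow_add hr0]; simp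

/-- The resolvent estimate for products of fractional powers of `T` and of a complete Bernstein
function of `T` comparable to the reciprocal of a slowly varying function. -/
theorem NonnegBound.exists_norm_mul_balPow_mul_balPow_le {T : 𝔸} {M : ℝ} (h : NonnegBound T M)
    (ha : 0 ≤ a) (hb : 0 ≤ b) (hμ : IntegrableOn (fun s : ℝ => 1 / (1 + s)) (Ioi 0) μ)
    {κ : ℝ → ℝ} (hκ : IsIncreasingSlowlyVarying κ) {k₁ k₂ : ℝ} (hk₁ : 0 < k₁)
    (hk : ∀ r : ℝ, 1 ≤ r →
      k₁ ≤ κ r * (a + b * r⁻¹ + ∫ s in Ioi (0 : ℝ), r⁻¹ / (r⁻¹ + s) ∂μ) ∧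
      κ r * (a + b * r⁻¹ + ∫ s in Ioi (0 : ℝ), r⁻¹ / (r⁻¹ + s) ∂μ) ≤ k₂)
    {β p : ℝ} (hβ : 0 < β) (hp : 0 ≤ p) (K : ℝ) :
    ∃ C : ℝ, ∀ (R : 𝔸) (w : ℂ) (r : ℝ), 1 ≤ r → 0 ≤ w.re → ‖w‖ = r⁻¹ → R * T = w • R - w • T →
      ‖R‖ ≤ K * (r ^ β * κ r) →
      κ r ^ p * ‖R * balPow T β * balPow (cbfOp a b μ T) (1 + p)‖ ≤ C := by
  set F := cbfOp a b μ T with hF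
  -- Any `0 < δ ≤ 1` below `β` would do; errors of order `r ^ (-δ)` absorb every power of `κ r`.
  set δ := min β 1 / 2 with hδ
  have hδ0 : 0 < δ := by rw [hδ]; positivity
  have hδβ : δ < β := by
    have : min β 1 ≤ β := min_le_left _ _
    have : 0 < min β 1 := by positivity
    rw [hδ]; linarith
  have hδ1 : δ ≤ 1 := by
    have : min β 1 ≤ 1 := min_le_right _ _
    rw [hδ]; linarith
  have hκ1 := hκ.pos 1 one_pos
  have hk₂ : 0 < k₂ := lt_of_lt_of_le hk₁ ((hk 1 le_rfl).1.trans (hk 1 le_rfl).2)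
  obtain ⟨C₁, hC₁, h1⟩ := exists_norm_mul_balPow_sub_le 𝔸 hβ hδ0 hδ1 hδβ M (‖T‖ + 1)
  obtain ⟨C₂, hC₂, h2⟩ := h.exists_norm_cbfOp_sub_le hb hμ (a := a)
  obtain ⟨C₃, hC₃, h3⟩ := exists_norm_mul_balPow_sub_le 𝔸 (α := 1 + p) (δ := 1 / 2) (by linarith)
    (by norm_num) (by norm_num) (by linarith) (max ‖(1 : 𝔸)‖ M) (‖F‖ + 2 * (k₂ / κ 1))
  obtain ⟨C₄, hC₄, h4⟩ := exists_norm_balPow_complex_le hβ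
  obtain ⟨C₅, hC₅, h5⟩ := exists_norm_balPow_complex_le (α := 1 + p) (by linarith)
  obtain ⟨C₆, hC₆, h6⟩ := hκ.exists_rpow_mul_rpow_le hp hδ0
  obtain ⟨C₇, hC₇, h7⟩ := hκ.exists_rpow_mul_rpow_le (p := p + 1) (by linarith) hδ0
  have hFb : NonnegBound F (max ‖(1 : 𝔸)‖ M) := h.nonnegBound_cbfOp ha hb hμ
  set Q := balPow F (1 + p) with hQ
  refine ⟨C₁ * ‖T‖ * 2 * ‖Q‖ * C₆ +
    C₄ * C₃ * C₂ * (2 * C₆ + 2 / k₁ * C₇) + C₄ * C₅ * (2 * k₂) ^ (1 + p) * |K|,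
    fun R w r hr hw hwr hR hRn => ?_⟩
  have hr0 : 0 < r := by linarith
  have hx : 0 < κ r := hκ.pos r hr0
  have hw0 : 0 < ‖w‖ := by rw [hwr]; positivity
  have hwne : w ≠ 0 := norm_pos_iff.1 hw0
  have hw1 : ‖w‖ ≤ 1 := by rw [hwr]; exact inv_le_one_of_one_le₀ hr
  have hwδ : ‖w‖ ^ δ = r ^ (-δ) := by rw [hwr, Real.inv_rpow hr0.le, Real.rpow_neg hr0.le]
  have hwle : ‖w‖ ≤ ‖w‖ ^ δ := by
    simpa using Real.rpow_le_rpow_of_exponent_ge hw0 hw1 hδ1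
  set φ := cbfOp a b μ w with hφ
  have hφre : 0 ≤ φ.re := cbfOp_complex_re_nonneg ha hb hμ hw
  have hφl := le_norm_cbfOp_complex hb hμ hw hwne (a := a)
  have hφu := norm_cbfOp_complex_le ha hb hμ hw hwne
  rw [← hφ, hwr] at hφl hφu
  have hφ1 : k₁ ≤ κ r * (2 * ‖φ‖) := (hk r hr).1.trans (by gcongr)
  have hφ2 : κ r * ‖φ‖ ≤ 2 * k₂ := by
    calc κ r * ‖φ‖ ≤ κ r * (2 * (a + b * r⁻¹ + ∫ s in Ioi (0 : ℝ), r⁻¹ / (r⁻¹ + s) ∂μ)) := by gcongr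
      _ = 2 * (κ r * (a + b * r⁻¹ + ∫ s in Ioi (0 : ℝ), r⁻¹ / (r⁻¹ + s) ∂μ)) := by ring
      _ ≤ 2 * k₂ := by gcongr; exact (hk r hr).2
  have hφ0 : 0 < ‖φ‖ := by
    by_contra hcon
    have : ‖φ‖ = 0 := le_antisymm (not_lt.1 hcon) (norm_nonneg _)
    rw [this] at hφ1
    linarith
  have hφne : φ ≠ 0 := norm_pos_iff.1 hφ0
  have hφK : ‖φ‖ ≤ ‖F‖ + 2 * (k₂ / κ 1) := by
    have : κ 1 ≤ κ r := hκ.le_of_le one_pos hr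
    have : κ 1 * ‖φ‖ ≤ 2 * k₂ := le_trans (by gcongr) hφ2
    have : ‖φ‖ ≤ 2 * (k₂ / κ 1) := by
      rw [mul_div_assoc', le_div_iff₀ hκ1]; linarith
    linarith [norm_nonneg F]
  have b1 := h1 T R (w • T) w h (by linarith) hw hwne (by linarith [norm_nonneg T]) hR
  have b3 := h3 F R (φ • R - R * F) φ hFb (by have := div_pos hk₂ hκ1; linarith) hφre hφne hφK
    (by abel)
  have b2 := h2 R w hw hR
  rw [← hφ, ← hF] at b2
  -- First `T ^ β` is replaced by the scalar `w ^ β`, then `F ^ (1 + p)` by `φ ^ (1 + p)`. The first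
  -- two terms are errors; in the last, `‖w‖ ^ β` cancels `r ^ β`, and `‖φ‖ ^ (1 + p)` is of order
  -- `κ r ^ (-1 - p)`.
  have hsplit : R * balPow T β * Q = (R * balPow T β - balPow w β • R) * Q +
      (balPow w β • (R * Q - balPow φ (1 + p) • R) + (balPow w β * balPow φ (1 + p)) • R) := by
    rw [sub_mul, smul_sub, smul_smul, smul_mul_assoc]; abel
  have t1 : κ r ^ p * ‖(R * balPow T β - balPow w β • R) * Q‖ ≤ C₁ * ‖T‖ * 2 * ‖Q‖ * C₆ := by
    have e1 : ‖R * balPow T β - balPow w β • R‖ ≤ C₁ * ‖T‖ * 2 * r ^ (-δ) := by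
      refine b1.trans ?_
      rw [norm_smul]
      have : ‖w‖ * ‖w‖ ^ (δ - 1) = ‖w‖ ^ δ := by
        rw [← Real.rpow_one_add' hw0.le (by linarith)]; ring_nf
      calc C₁ * (‖w‖ * ‖T‖ * (1 + ‖w‖ ^ (δ - 1))) =
            C₁ * ‖T‖ * (‖w‖ + ‖w‖ * ‖w‖ ^ (δ - 1)) := by ring
        _ ≤ C₁ * ‖T‖ * (‖w‖ ^ δ + ‖w‖ ^ δ) := by rw [this]; gcongr
        _ = _ := by rw [hwδ]; ring
    calc κ r ^ p * ‖(R * balPow T β - balPow w β • R) * Q‖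
        ≤ κ r ^ p * (C₁ * ‖T‖ * 2 * r ^ (-δ) * ‖Q‖) := by
          gcongr
          exact (norm_mul_le _ _).trans (by gcongr)
      _ = C₁ * ‖T‖ * 2 * ‖Q‖ * (κ r ^ p * r ^ (-δ)) := by ring
      _ ≤ _ := by gcongr; exact h6 r hr
  have t2 : κ r ^ p * ‖balPow w β • (R * Q - balPow φ (1 + p) • R)‖ ≤
      C₄ * C₃ * C₂ * (2 * C₆ + 2 / k₁ * C₇) := by
    -- Since `‖φ‖` is of order `1 / κ r`, the price of the perturbation lemma is bounded crudely by
    -- one extra power of `κ r`.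
    have e1 : ‖φ‖ ^ ((1 / 2 : ℝ) - 1) ≤ 1 + 2 * κ r / k₁ := by
      have e0 : ‖φ‖⁻¹ ≤ 2 * κ r / k₁ := by
        rw [inv_le_iff_one_le_mul₀ hφ0, div_mul_eq_mul_div, le_div_iff₀ hk₁]; linarith
      rcases le_total 1 ‖φ‖ with hc | hc
      · have := Real.rpow_le_one_of_one_le_of_nonpos hc (by norm_num : (1 / 2 : ℝ) - 1 ≤ 0)
        have : 0 ≤ 2 * κ r / k₁ := by positivity
        linarith
      · have := Real.rpow_le_rpow_of_exponent_ge hφ0 hc (by norm_num : (-1 : ℝ) ≤ (1 / 2 : ℝ) - 1)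
        rw [Real.rpow_neg_one] at this
        linarith
    have e2 : ‖w‖ ^ β ≤ 1 := Real.rpow_le_one hw0.le hw1 hβ.le
    have e3 : κ r ^ p * κ r = κ r ^ (p + 1) := by rw [Real.rpow_add_one hx.ne']
    calc κ r ^ p * ‖balPow w β • (R * Q - balPow φ (1 + p) • R)‖
        ≤ κ r ^ p * (C₄ * 1 * (C₃ * (C₂ * r ^ (-δ) * (1 + (1 + 2 * κ r / k₁))))) := by
          rw [norm_smul]
          gcongr
          · exact (h4 w hw hwne).trans (by gcongr)
          · refine b3.trans ?_
            gcongr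
            refine b2.trans ?_
            gcongr
            rw [← hwδ]
            exact hwle
      _ = C₄ * C₃ * C₂ * (2 * (κ r ^ p * r ^ (-δ)) +
          2 / k₁ * ((κ r ^ p * κ r) * r ^ (-δ))) := by ring
      _ ≤ _ := by rw [e3]; gcongr; exacts [h6 r hr, h7 r hr]
  have t3 : κ r ^ p * ‖(balPow w β * balPow φ (1 + p)) • R‖ ≤
      C₄ * C₅ * (2 * k₂) ^ (1 + p) * |K| := by
    have e1 : ‖φ‖ ^ (1 + p) * κ r ^ (1 + p) ≤ (2 * k₂) ^ (1 + p) := by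
      rw [← Real.mul_rpow hφ0.le hx.le]
      exact Real.rpow_le_rpow (by positivity) (by linarith) (by linarith)
    have e2 : ‖R‖ ≤ |K| * (r ^ β * κ r) := hRn.trans (by gcongr; exact le_abs_self K)
    have e3 : ‖w‖ ^ β * r ^ β = 1 := by
      rw [hwr, ← Real.mul_rpow (by positivity) hr0.le, inv_mul_cancel₀ hr0.ne', Real.one_rpow]
    have e4 : κ r ^ p * κ r = κ r ^ (1 + p) := by rw [add_comm, Real.rpow_add_one hx.ne']
    calc κ r ^ p * ‖(balPow w β * balPow φ (1 + p)) • R‖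
        ≤ κ r ^ p * (C₄ * ‖w‖ ^ β * (C₅ * ‖φ‖ ^ (1 + p)) * (|K| * (r ^ β * κ r))) := by
          rw [norm_smul, norm_mul]
          gcongr
          · exact h4 w hw hwne
          · exact h5 φ hφre hφne
      _ = C₄ * C₅ * (‖φ‖ ^ (1 + p) * (κ r ^ p * κ r)) * |K| * (‖w‖ ^ β * r ^ β) := by ring
      _ ≤ _ := by rw [e3, e4, mul_one]; gcongr
  rw [hsplit]
  calc _ ≤ κ r ^ p * (‖(R * balPow T β - balPow w β • R) * Q‖ +
        (‖balPow w β • (R * Q - balPow φ (1 + p) • R)‖ +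
          ‖(balPow w β * balPow φ (1 + p)) • R‖)) := by
        gcongr
        exact (norm_add_le _ _).trans (by gcongr; exact norm_add_le _ _)
    _ ≤ _ := by rw [mul_add, mul_add, add_assoc]; gcongr

end Algebra

section Operators

variable {X : Type*} [NormedAddCommGroup X] [NormedSpace ℂ X] {A : X →ₗ.[ℂ] X}

theorem exists_isStieltjesRep_and_cbf_eq {f : ℝ → ℝ} (hf : IsCBF f) (A : X →ₗ.[ℂ] X) :
    ∃ (a b : ℝ) (μ : Measure ℝ), IsStieltjesRep f a b μ ∧ cbf A f = (cbfPre A a b μ).closure := by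
  obtain ⟨a, b, μ, h⟩ := hf
  have hex : ∃ p : ℝ × ℝ × Measure ℝ, IsStieltjesRep f p.1 p.2.1 p.2.2 := ⟨(a, b, μ), h⟩
  exact ⟨_, _, _, hex.choose_spec, by rw [cbf, dif_pos hex]⟩

theorem isPseudoResolvent_binv_shift (hρ : ∀ z : ℂ, z.re ≤ 0 → z ∈ resolventSet A) :
    IsPseudoResolvent fun s : ℝ => binv (shift A s) := fun s u hs hu => by
  have h := (exists_isBoundedInverse_shift hρ (z := (s : ℂ)) (by simpa using hs.le)).sub_eq
    (exists_isBoundedInverse_shift hρ (z := (u : ℂ)) (by simpa using hu.le))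
  rw [← Complex.coe_smul, Complex.ofReal_sub]
  exact h

theorem binv_shift_mul_binv_shift_one {z : ℂ} (hz1 : 1 - z ≠ 0)
    (hz : IsBoundedInverse (shift A z) (binv (shift A z)))
    (h1 : IsBoundedInverse (shift A 1) (binv (shift A 1))) :
    binv (shift A z) * binv (shift A 1) =
      (1 - z)⁻¹ • binv (shift A z) - (1 - z)⁻¹ • binv (shift A 1) := by
  rw [← smul_sub, hz.sub_eq h1, inv_smul_smul₀ hz1]

theorem one_le_norm_one_sub {z : ℂ} (hz : z.re = 0) :
    1 ≤ ‖1 - z‖ ∧ ‖z‖ ≤ ‖1 - z‖ ∧ ‖1 - z‖ ≤ 1 + ‖z‖ := by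
  refine ⟨?_, ?_, (norm_sub_le _ _).trans_eq (by simp)⟩
  · refine le_trans ?_ (Complex.re_le_norm _)
    simp [hz]
  · have : ‖z‖ = |z.im| := by
      rw [← Complex.re_add_im z, hz]; simp
    rw [this]
    refine le_trans ?_ (Complex.abs_im_le_norm _)
    simp

variable [CompleteSpace X]

theorem cbfPre_ofBounded {T : X →L[ℂ] X} {M : ℝ} (h : NonnegBound T M) {a b : ℝ} {μ : Measure ℝ}
    (hμ : IntegrableOn (fun s : ℝ => 1 / (1 + s)) (Ioi 0) μ) :
    cbfPre (ofBounded T) a b μ = ofBounded (cbfOp a b μ T) := by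
  have hpt : ∀ s : ℝ, 0 < s → ∀ x : X, binv (shift (ofBounded T) (s : ℂ)) (T x) =
      resMul T s x := fun s hs x => by
    rw [(isBoundedInverse_shift_ofBounded (h s hs).1).binv_eq, h.resMul_eq hs, ← h.res_mul_eq hs]
    rfl
  have hi := h.integrableOn_resMul hμ
  have hx : ∀ x : X, IntegrableOn (fun s => resMul T s x) (Ioi 0) μ := fun x =>
    (ContinuousLinearMap.apply ℂ X x).integrable_comp hi
  refine LinearPMap.ext ?_ fun x h1 h2 => ?_
  · refine eq_top_iff.2 fun x _ => ⟨trivial, ?_⟩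
    exact (hx x).congr_fun (fun s hs => (hpt s hs x).symm) measurableSet_Ioi
  · change (a : ℂ) • x + (b : ℂ) • T x +
      ∫ s in Ioi (0 : ℝ), binv (shift (ofBounded T) (s : ℂ)) (T x) ∂μ = cbfOp a b μ T x
    rw [setIntegral_congr_fun measurableSet_Ioi fun s hs => hpt s hs x, cbfOp, add_assoc,
      ← ContinuousLinearMap.integral_apply hi]
    simp

/-- The resolvent estimate in the case of a slowly varying loss. -/
theorem exists_norm_binv_mul_fracPow_mul_fracPow_le {ω : ℝ} (hω' : ω < Real.pi)
    (hA : IsSectorial A ω) (hρ : ∀ z : ℂ, z.re ≤ 0 → z ∈ resolventSet A) {β p : ℝ} (hβ : 0 < β)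
    (hp : 0 ≤ p) {ℓ : ℝ → ℝ} (hℓ : IsIncreasingSlowlyVarying ℓ) {K : ℝ}
    (hK : ∀ ξ : ℝ, ‖binv (shift A (Complex.I * (ξ : ℂ)))‖ ≤ K * ((1 + |ξ|) ^ β * ℓ (1 + |ξ|)))
    {ε : ℝ} (hε : 0 < ε) (hΨ : IsCBF (Psi ℓ ε)) :
    ∃ F : X →L[ℂ] X, cbf (ofBounded (binv (shift A 1))) (Psi ℓ ε) = ofBounded F ∧
      ∃ C : ℝ, ∀ z : ℂ, z.re = 0 → 1 ≤ ‖z‖ → ℓ ‖z‖ ^ p *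
        ‖binv (shift A z) * fracPow (binv (shift A 1)) β * fracPow F (1 + p)‖ ≤ C := by
  obtain ⟨M, hM0, hM⟩ := hA.exists_norm_binv_le hω'
  obtain ⟨hT, -⟩ := (isPseudoResolvent_binv_shift hρ).nonnegBound_one hM
  rw [Complex.ofReal_one] at hT
  have h1 := exists_isBoundedInverse_shift hρ (z := 1) (by simp)
  set T := binv (shift A 1) with hTdef
  obtain ⟨a, b, μ, hrep, hcbf⟩ := exists_isStieltjesRep_and_cbf_eq hΨ (ofBounded T)
  have hμ := hrep.integrableOn
  refine ⟨cbfOp a b μ T, ?_, ?_⟩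
  · rw [hcbf, cbfPre_ofBounded hT hμ]
    have hcl := isClosed_ofBounded (cbfOp a b μ T)
    refine LinearPMap.eq_of_eq_graph ?_
    rw [← hcl.isClosable.graph_closure_eq_closure_graph]
    exact hcl.submodule_topologicalClosure_eq
  obtain ⟨k₁, k₂, hk₁, -, hk⟩ := hℓ.exists_Psi_bounds hε
  obtain ⟨c, hc, hpot⟩ := hℓ.exists_potter one_pos
  obtain ⟨C, hC⟩ := hT.exists_norm_mul_balPow_mul_balPow_le hrep.1 hrep.2.1 hμ hℓ hk₁
    (k₂ := k₂) (fun r hr => by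
      have hr0 : 0 < r := by linarith
      have := hk r hr
      rwa [hrep.2.2.2 r⁻¹ (inv_pos.2 hr0)] at this) hβ hp (|K| * (2 ^ β * (c * 2 ^ (1 : ℝ))))
  refine ⟨C, fun z hz hz1 => ?_⟩
  obtain ⟨hr1, hzr, -⟩ := one_le_norm_one_sub hz
  have hzne : 1 - z ≠ 0 := norm_pos_iff.1 (by linarith)
  have hR := exists_isBoundedInverse_shift hρ (z := z) hz.ge
  rw [fracPow_eq_balPow, fracPow_eq_balPow]
  -- The natural parameters are `w = (1 - z)⁻¹` and `r = ‖1 - z‖`. The passage between `‖1 - z‖` and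
  -- `1 + ‖z‖` costs a factor `2`, absorbed by the Potter bound.
  have key := hC (binv (shift A z)) (1 - z)⁻¹ ‖1 - z‖ hr1 ?_ (norm_inv _)
    (binv_shift_mul_binv_shift_one hzne hR h1) ?_
  · refine le_trans ?_ key
    have := (hℓ.pos ‖z‖ (by linarith)).le
    have := hℓ.le_of_le (by linarith) hzr
    gcongr
  · rw [Complex.inv_re]
    refine div_nonneg ?_ (Complex.normSq_nonneg _)
    simp [hz]
  · have hzI : z = Complex.I * (z.im : ℂ) := by
      apply Complex.ext <;> simp [hz]
    have hnz : ‖z‖ = |z.im| := by rw [hzI]; simp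
    have h2 := hK z.im
    rw [← hzI, ← hnz] at h2
    refine h2.trans ?_
    have h3 : 1 + ‖z‖ ≤ 2 * ‖1 - z‖ := by linarith
    have h4 : ℓ (1 + ‖z‖) ≤ c * 2 ^ (1 : ℝ) * ℓ ‖1 - z‖ :=
      (hℓ.le_of_le (by linarith) h3).trans (hpot 2 ‖1 - z‖ one_le_two hr1)
    have h5 : (1 + ‖z‖) ^ β ≤ 2 ^ β * ‖1 - z‖ ^ β := by
      rw [← Real.mul_rpow zero_le_two (by linarith)]
      exact Real.rpow_le_rpow (by linarith) h3 hβ.le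
    have h6 := (hℓ.pos (1 + ‖z‖) (by linarith)).le
    calc K * ((1 + ‖z‖) ^ β * ℓ (1 + ‖z‖)) ≤ |K| * ((1 + ‖z‖) ^ β * ℓ (1 + ‖z‖)) := by
          gcongr; exact le_abs_self K
      _ ≤ |K| * ((2 ^ β * ‖1 - z‖ ^ β) * (c * 2 ^ (1 : ℝ) * ℓ ‖1 - z‖)) := by gcongr
      _ = _ := by ring

end Operators

/-! ### Inverses of functions of an operator, in terms of the bounded inverse of the operator -/

section DenseRange

variable {X : Type*} [NormedAddCommGroup X] [NormedSpace ℂ X]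

theorem eq_of_mul_eq_mul_of_denseRange {T F G : X →L[ℂ] X} (hT : DenseRange T)
    (h : F * T = G * T) : F = G := by
  refine ContinuousLinearMap.ext fun x => ?_
  refine congrFun (hT.equalizer F.continuous G.continuous (funext fun y => ?_)) x
  exact congrArg (fun S : X →L[ℂ] X => S y) h

variable [CompleteSpace X]

/-- If `P n` are uniformly boundedly invertible and `P n * T → V` for an operator `T` of dense
range, then `V` factors `T` with a bounded factor. -/
theorem exists_factor_of_tendsto {T V : X →L[ℂ] X} (hT : DenseRange T) {P : ℕ → X →L[ℂ] X} {C : ℝ}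
    (hP : ∀ n, IsUnit (P n) ∧ ‖Ring.inverse (P n)‖ ≤ C) (hc : ∀ n, Commute T (P n))
    (hV : Tendsto (fun n => P n * T) atTop (𝓝 V)) :
    ∃ J : X →L[ℂ] X, ‖J‖ ≤ C ∧ Commute J T ∧ J * V = T ∧ V * J = T := by
  set Q : ℕ → X →L[ℂ] X := fun n => Ring.inverse (P n) with hQ
  have hQP : ∀ n, Q n * P n = 1 := fun n => Ring.inverse_mul_cancel _ (hP n).1
  have hPQ : ∀ n, P n * Q n = 1 := fun n => Ring.mul_inverse_cancel _ (hP n).1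
  have hQT : ∀ n, Commute T (Q n) := fun n => by
    calc T * Q n = Q n * P n * (T * Q n) := by rw [hQP, one_mul]
      _ = Q n * (P n * T) * Q n := by simp only [mul_assoc]
      _ = Q n * (T * P n) * Q n := by rw [(hc n).eq]
      _ = Q n * T * (P n * Q n) := by simp only [mul_assoc]
      _ = Q n * T := by rw [hPQ, mul_one]
  have hC0 : 0 ≤ C := (norm_nonneg _).trans (hP 0).2
  have hcauchy : CauchySeq fun n => Q n * T := by
    have hV' := hV.cauchySeq
    rw [Metric.cauchySeq_iff] at hV' ⊢
    intro ε hε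
    obtain ⟨N, hN⟩ := hV' (ε / (C * C + 1)) (by positivity)
    refine ⟨N, fun m hm n hn => ?_⟩
    have h1 := hN m hm n hn
    rw [dist_eq_norm] at h1 ⊢
    -- The inverses `Q n` need not converge in norm, but after multiplication by `T` their
    -- differences are controlled by those of `P n * T`.
    have e : Q m * T - Q n * T = -(Q m * (P m * T - P n * T) * Q n) := by
      have e1 : Q m * (P m * T) * Q n = Q n * T := by
        rw [← mul_assoc (Q m), hQP, one_mul, (hQT n).eq]
      have e2 : Q m * (P n * T) * Q n = Q m * T := by
        rw [← (hc n).eq, mul_assoc, mul_assoc, hPQ, mul_one]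
      rw [mul_sub, sub_mul, e1, e2, neg_sub]
    rw [e, norm_neg]
    calc ‖Q m * (P m * T - P n * T) * Q n‖ ≤ C * ‖P m * T - P n * T‖ * C := by
          refine (norm_mul_le _ _).trans ?_
          gcongr
          · refine (norm_mul_le _ _).trans ?_
            gcongr
            exact (hP m).2
          · exact (hP n).2
      _ = (C * C) * ‖P m * T - P n * T‖ := by ring
      _ ≤ (C * C) * (ε / (C * C + 1)) := by gcongr
      _ < ε := by
          rw [mul_div_assoc', div_lt_iff₀ (by positivity)]
          nlinarith
  obtain ⟨U, hU⟩ := cauchySeq_tendsto_of_complete hcauchy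
  have hUn : ∀ x, ‖(U : X →ₗ[ℂ] X) x‖ ≤ C * ‖(T : X →ₗ[ℂ] X) x‖ := fun x => by
    have h1 : Tendsto (fun n => (Q n * T) x) atTop (𝓝 (U x)) :=
      ((ContinuousLinearMap.apply ℂ X x).continuous.tendsto U).comp hU
    refine le_of_tendsto h1.norm (.of_forall fun n => ?_)
    refine ((Q n).le_opNorm (T x)).trans ?_
    gcongr
    · exact (hP n).2
    · exact le_rfl
  -- The map `T x ↦ U x` is well defined and bounded by `C` on the dense range of `T`; `J` is its
  -- continuous extension.
  set J := (U : X →ₗ[ℂ] X).extendOfNorm (T : X →ₗ[ℂ] X) with hJ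
  have hJT : J * T = U := ContinuousLinearMap.ext fun x =>
    LinearMap.extendOfNorm_eq (f := (U : X →ₗ[ℂ] X)) (e := (T : X →ₗ[ℂ] X)) hT ⟨C, hUn⟩ x
  have hTU : Commute T U := by
    refine tendsto_nhds_unique (hU.const_mul T) ?_
    refine (hU.mul_const T).congr fun n => ?_
    rw [← mul_assoc T, (hQT n).eq]
  have hTV : Commute T V := by
    refine tendsto_nhds_unique (hV.const_mul T) ?_
    refine (hV.mul_const T).congr fun n => ?_
    rw [← mul_assoc T, (hc n).eq]
  have hUV : U * V = T * T := by
    refine tendsto_nhds_unique (hU.mul hV) ?_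
    refine tendsto_const_nhds.congr fun n => ?_
    rw [mul_assoc, ← mul_assoc T, (hc n).eq, ← mul_assoc, ← mul_assoc, hQP, one_mul]
  have hVU : V * U = T * T := by
    refine tendsto_nhds_unique (hV.mul hU) ?_
    refine tendsto_const_nhds.congr fun n => ?_
    rw [mul_assoc, ← mul_assoc T, (hQT n).eq, ← mul_assoc, ← mul_assoc, hPQ, one_mul]
  refine ⟨J, LinearMap.opNorm_extendOfNorm_le hT hC0 hUn, ?_, ?_, ?_⟩
  · refine eq_of_mul_eq_mul_of_denseRange hT ?_
    rw [hJT, mul_assoc, hJT, hTU.eq]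
  · refine eq_of_mul_eq_mul_of_denseRange hT ?_
    rw [mul_assoc, ← hTV.eq, ← mul_assoc, hJT, hUV]
  · refine eq_of_mul_eq_mul_of_denseRange hT ?_
    rw [mul_assoc, hJT, hVU]

end DenseRange

/-! ### Complete Bernstein functions of `1 + A` in terms of the resolvents of `A` -/

section Algebra

variable {𝔸 : Type*} [NormedRing 𝔸] [NormedAlgebra ℝ 𝔸] {R : ℝ → 𝔸} {M : ℝ}

theorem norm_one_sub_smul_le (hM : ∀ s, 0 < s → ‖R s‖ ≤ M / s) {s : ℝ} (hs : 0 < s) :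
    ‖1 - s • R (1 + s)‖ ≤ ‖(1 : 𝔸)‖ + M := by
  refine (norm_sub_le _ _).trans ?_
  gcongr
  rw [norm_smul, Real.norm_of_nonneg hs.le]
  have hM0 := nonneg_of_norm_le hM
  calc s * ‖R (1 + s)‖ ≤ s * (M * (1 / (1 + s))) := by gcongr; exact norm_le_one_add hM hs
    _ = M * (s / (1 + s)) := by ring
    _ ≤ M * 1 := by gcongr; exact (div_le_one (by linarith)).2 (by linarith)
    _ = M := mul_one M

variable [CompleteSpace 𝔸]

theorem IsPseudoResolvent.continuousOn_one_add (hR : IsPseudoResolvent R)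
    (hM : ∀ s, 0 < s → ‖R s‖ ≤ M / s) : ContinuousOn (fun s => R (1 + s)) (Ioi 0) := by
  obtain ⟨h1, h2⟩ := hR.nonnegBound_one hM
  have hinv : ContinuousOn (fun s : ℝ => s⁻¹) (Ioi 0) :=
    continuousOn_inv₀.mono fun s hs => ne_of_gt hs
  have h3 : ContinuousOn (fun s : ℝ => s⁻¹ • resMul (R 1) s⁻¹) (Ioi 0) :=
    hinv.smul (h1.continuousOn_resMul.comp hinv fun s hs => mem_Ioi.2 (inv_pos.2 hs))
  refine h3.congr fun s hs => ?_
  have hs' : (0 : ℝ) < s := hs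
  change R (1 + s) = s⁻¹ • resMul (R 1) s⁻¹
  rw [h2 _ (inv_pos.2 hs'), inv_inv, inv_smul_smul₀ hs'.ne']

variable {a : ℝ} {μ : Measure ℝ}

theorem IsPseudoResolvent.integrableOn_one_add (hR : IsPseudoResolvent R)
    (hM : ∀ s, 0 < s → ‖R s‖ ≤ M / s)
    (hμ : IntegrableOn (fun s : ℝ => 1 / (1 + s)) (Ioi 0) μ) :
    IntegrableOn (fun s => R (1 + s)) (Ioi 0) μ :=
  integrableOn_of_norm_le_one_add hμ (hR.continuousOn_one_add hM) fun _ hs => norm_le_one_add hM hs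

/-- The bounded operator `f(B) B⁻¹`, where `R s = (s + A)⁻¹`, `B = 1 + A` and
`f(t) = a + ∫ t / (t + s) dμ(s)`. -/
def cbfMulInv (a : ℝ) (μ : Measure ℝ) (R : ℝ → 𝔸) : 𝔸 :=
  a • R 1 + ∫ s in Ioi (0 : ℝ), R (1 + s) ∂μ

/-- A bounded approximation of the (unbounded) operator `f(B)`. -/
def cbfApprox (a : ℝ) (μ : Measure ℝ) (R : ℝ → 𝔸) (n : ℝ) : 𝔸 :=
  a • 1 + ∫ s in Ioi (0 : ℝ), (n / (n + s)) • (1 - s • R (1 + s)) ∂μ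

theorem IsPseudoResolvent.integrableOn_cbfApprox (hR : IsPseudoResolvent R)
    (hM : ∀ s, 0 < s → ‖R s‖ ≤ M / s)
    (hμ : IntegrableOn (fun s : ℝ => 1 / (1 + s)) (Ioi 0) μ) {n : ℝ} (hn : 1 ≤ n) :
    IntegrableOn (fun s => (n / (n + s)) • (1 - s • R (1 + s))) (Ioi 0) μ := by
  refine integrableOn_of_norm_le_one_add hμ (C := n * (‖(1 : 𝔸)‖ + M)) ?_ fun s hs => ?_
  · refine ContinuousOn.smul (continuousOn_const.div (by fun_prop) fun s hs => ?_)
      (continuousOn_const.sub (continuousOn_id.smul (hR.continuousOn_one_add hM)))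
    have : (0 : ℝ) < s := hs
    positivity
  · rw [norm_smul, Real.norm_of_nonneg (by positivity)]
    have hM0 := nonneg_of_norm_le hM
    calc n / (n + s) * ‖1 - s • R (1 + s)‖ ≤ n / (1 + s) * (‖(1 : 𝔸)‖ + M) := by
          gcongr; exact norm_one_sub_smul_le hM hs
      _ = _ := by ring

theorem IsPseudoResolvent.commute_cbfApprox (hR : IsPseudoResolvent R)
    (hM : ∀ s, 0 < s → ‖R s‖ ≤ M / s)
    (hμ : IntegrableOn (fun s : ℝ => 1 / (1 + s)) (Ioi 0) μ) {n : ℝ} (hn : 1 ≤ n) :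
    Commute (R 1) (cbfApprox a μ R n) := by
  have hi := hR.integrableOn_cbfApprox hM hμ hn
  refine ((Commute.one_right _).smul_right a).add_right ?_
  rw [Commute, SemiconjBy, ← integral_const_mul_of_integrable hi,
    ← integral_mul_const_of_integrable hi]
  refine setIntegral_congr_fun measurableSet_Ioi fun s hs => ?_
  have hs' : (0 : ℝ) < s := hs
  exact (((Commute.one_right _).sub_right
    ((hR.commute one_pos (by linarith)).smul_right s)).smul_right _).eq

theorem IsPseudoResolvent.cbfApprox_mul (hR : IsPseudoResolvent R)
    (hM : ∀ s, 0 < s → ‖R s‖ ≤ M / s)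
    (hμ : IntegrableOn (fun s : ℝ => 1 / (1 + s)) (Ioi 0) μ) {n : ℝ} (hn : 1 ≤ n) :
    cbfApprox a μ R n * R 1 =
      a • R 1 + ∫ s in Ioi (0 : ℝ), (n / (n + s)) • R (1 + s) ∂μ := by
  rw [cbfApprox, add_mul, smul_mul_assoc, one_mul,
    ← integral_mul_const_of_integrable (hR.integrableOn_cbfApprox hM hμ hn)]
  congr 1
  refine setIntegral_congr_fun measurableSet_Ioi fun s hs => ?_
  change (n / (n + s)) • (1 - s • R (1 + s)) * R 1 = (n / (n + s)) • R (1 + s)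
  rw [smul_mul_assoc, sub_mul, one_mul, smul_mul_assoc, ← (hR.one_sub hs).2, sub_sub_cancel]

theorem IsPseudoResolvent.tendsto_cbfApprox_mul (hR : IsPseudoResolvent R)
    (hM : ∀ s, 0 < s → ‖R s‖ ≤ M / s)
    (hμ : IntegrableOn (fun s : ℝ => 1 / (1 + s)) (Ioi 0) μ) :
    Tendsto (fun n : ℕ => cbfApprox a μ R ((n : ℝ) + 1) * R 1) atTop (𝓝 (cbfMulInv a μ R)) := by
  have hn : ∀ n : ℕ, (1 : ℝ) ≤ (n : ℝ) + 1 := fun n => by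
    have : (0 : ℝ) ≤ n := n.cast_nonneg
    linarith
  refine Tendsto.congr (fun n => (hR.cbfApprox_mul hM hμ (hn n)).symm) ?_
  refine Tendsto.const_add _ ?_
  refine tendsto_integral_of_dominated_convergence (fun s => M * (1 / (1 + s))) (fun n => ?_)
    (hμ.const_mul M) (fun n => ?_) ?_
  · refine ContinuousOn.aestronglyMeasurable ?_ measurableSet_Ioi
    refine ContinuousOn.smul (continuousOn_const.div (by fun_prop) fun s hs => ?_)
      (hR.continuousOn_one_add hM)
    have : (0 : ℝ) < s := hs
    positivity
  · filter_upwards [ae_restrict_mem measurableSet_Ioi] with s hs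
    have hs' : (0 : ℝ) < s := hs
    have hn0 : (0 : ℝ) < (n : ℝ) + 1 := by positivity
    rw [norm_smul, Real.norm_of_nonneg (by positivity)]
    refine (mul_le_of_le_one_left (norm_nonneg _) ?_).trans (norm_le_one_add hM hs)
    exact (div_le_one (by positivity)).2 (by linarith)
  · filter_upwards [ae_restrict_mem measurableSet_Ioi] with s hs
    have h1 : Tendsto (fun n : ℕ => ((n : ℝ) + 1) / ((n : ℝ) + 1 + s)) atTop (𝓝 1) := by
      have h2 : Tendsto (fun n : ℕ => (n : ℝ) + 1 + s) atTop atTop :=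
        tendsto_atTop_add_const_right _ _ (tendsto_atTop_add_const_right _ _
          tendsto_natCast_atTop_atTop)
      have h3 := (h2.inv_tendsto_atTop.const_mul s).const_sub 1
      rw [mul_zero, sub_zero] at h3
      refine h3.congr fun n => ?_
      have hs' : (0 : ℝ) < s := hs
      have hn0 : (0 : ℝ) < (n : ℝ) + 1 := by positivity
      simp only [Pi.inv_apply]
      field_simp
      ring
    simpa using h1.smul_const (R (1 + s))

open scoped NNReal in
/-- Uniform invertibility of the approximations. -/
theorem IsPseudoResolvent.isUnit_cbfApprox (hR : IsPseudoResolvent R)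
    (hM : ∀ s, 0 < s → ‖R s‖ ≤ M / s)
    (hμ : IntegrableOn (fun s : ℝ => 1 / (1 + s)) (Ioi 0) μ) {n : ℝ} (hn : 1 ≤ n) {r ν : ℝ}
    (hr : 0 ≤ r) (hν : 0 < ν)
    (hνle : ν ≤ a + ∫ s in Ioi (0 : ℝ), (1 / (1 + s)) * (1 / (1 + s)) ∂μ) :
    IsUnit (r • 1 + cbfApprox a μ R n) ∧
      ‖Ring.inverse (r • 1 + cbfApprox a μ R n)‖ ≤ max ‖(1 : 𝔸)‖ M / (r + ν) := by
  have hn0 : 0 < n := by linarith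
  have hcont : ContinuousOn (fun s : ℝ => (n / (n + s)) * (1 / (1 + s))) (Ioi 0) := by
    refine ContinuousOn.mul (continuousOn_const.div (by fun_prop) fun s hs => ?_)
      (continuousOn_const.div (by fun_prop) fun s hs => ?_)
    all_goals
      have : (0 : ℝ) < s := hs
      positivity
  have hq : ∀ s : ℝ, 0 < s → n / (n + s) ≤ 1 := fun s hs =>
    (div_le_one (by positivity)).2 (by linarith)
  have hi1 : IntegrableOn (fun s : ℝ => (n / (n + s)) * (1 / (1 + s))) (Ioi 0) μ := by
    refine integrableOn_of_norm_le_one_add hμ hcont (C := 1) fun s hs => ?_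
    rw [Real.norm_of_nonneg (by positivity)]
    gcongr
    exact hq s hs
  -- Each `1 - s R(1 + s)` splits into the scalar `1 / (1 + s)` and `s / (1 + s)` times the
  -- generator `1 - (1 + s) R(1 + s)` of the cone. The accumulated scalar `ν'` is at least `ν` for
  -- every `n ≥ 1`, because `n / (n + s) ≥ 1 / (1 + s)`.
  set ν' := a + ∫ s in Ioi (0 : ℝ), (n / (n + s)) * (1 / (1 + s)) ∂μ with hν'
  have hνν' : ν ≤ ν' := by
    refine hνle.trans ?_
    rw [hν']
    refine add_le_add le_rfl ?_
    refine integral_mono_of_nonneg ?_ hi1 ?_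
    · filter_upwards [ae_restrict_mem measurableSet_Ioi] with s hs
      have : (0 : ℝ) < s := hs
      simp only [Pi.zero_apply]
      positivity
    · filter_upwards [ae_restrict_mem measurableSet_Ioi] with s hs
      have : (0 : ℝ) < s := hs
      gcongr ?_ * _
      rw [div_le_div_iff₀ (by positivity) (by positivity)]
      nlinarith
  set F := ∫ s in Ioi (0 : ℝ), (n / (n + s) * (s / (1 + s))) • (1 - (1 + s) • R (1 + s)) ∂μ with hF
  have hpt : ∀ s : ℝ, 0 < s → (n / (n + s)) • (1 - s • R (1 + s)) -
      ((n / (n + s)) * (1 / (1 + s))) • (1 : 𝔸) =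
      (n / (n + s) * (s / (1 + s))) • (1 - (1 + s) • R (1 + s)) := fun s hs => by
    simp only [smul_sub, smul_smul]
    have e1 : n / (n + s) * (s / (1 + s)) * (1 + s) = n / (n + s) * s := by field_simp
    have e2 : n / (n + s) = n / (n + s) * (1 / (1 + s)) + n / (n + s) * (s / (1 + s)) := by
      field_simp
    rw [e1]
    nth_rewrite 1 [e2]
    rw [add_smul]
    abel
  have hi2 := hR.integrableOn_cbfApprox hM hμ hn
  have hi3 : IntegrableOn (fun s : ℝ => ((n / (n + s)) * (1 / (1 + s))) • (1 : 𝔸)) (Ioi 0) μ :=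
    hi1.smul_const 1
  have hsum : cbfApprox a μ R n = ν' • 1 + F := by
    have e : F = (∫ s in Ioi (0 : ℝ), (n / (n + s)) • (1 - s • R (1 + s)) ∂μ) -
        (∫ s in Ioi (0 : ℝ), (n / (n + s)) * (1 / (1 + s)) ∂μ) • (1 : 𝔸) := by
      rw [← integral_smul_const, ← integral_sub hi2 hi3]
      exact (setIntegral_congr_fun measurableSet_Ioi fun s hs => hpt s hs).symm
    rw [cbfApprox, hν', e, add_smul]
    abel
  have hFmem : F ∈ bernsteinCone R := by
    refine integral_mem_of_isClosed _ (isClosed_bernsteinCone _) ?_ ?_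
    · exact IntegrableOn.congr_fun (hi2.sub hi3) (fun s hs => hpt s hs) measurableSet_Ioi
    · filter_upwards [ae_restrict_mem measurableSet_Ioi] with s hs
      have : (0 : ℝ) < s := hs
      exact Submodule.smul_mem (R := ℝ≥0) _ ⟨_, by positivity⟩
        (mem_bernsteinCone R (s := 1 + s) (by linarith))
  have h := nonnegBound_of_mem_bernsteinCone hR hM hFmem (r + ν') (by linarith)
  rw [hsum, ← add_assoc, ← add_smul]
  refine ⟨h.1, h.2.trans ?_⟩
  have : 0 ≤ max ‖(1 : 𝔸)‖ M := (norm_nonneg _).trans (le_max_left _ _)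
  gcongr

end Algebra

/-! ### The bounded inverse of `f(1 + A)` -/

section Inverse

variable {X : Type*} [NormedAddCommGroup X] [NormedSpace ℂ X] [CompleteSpace X]

theorem pos_integral_one_add_mul {a : ℝ} {μ : Measure ℝ} (ha : 0 ≤ a)
    (hμ : IntegrableOn (fun s : ℝ => 1 / (1 + s)) (Ioi 0) μ)
    (hpos : 0 < a + ∫ s in Ioi (0 : ℝ), 1 / (1 + s) ∂μ) :
    0 < a + ∫ s in Ioi (0 : ℝ), (1 / (1 + s)) * (1 / (1 + s)) ∂μ := by
  have hnn : 0 ≤ᵐ[μ.restrict (Ioi 0)] fun s : ℝ => (1 / (1 + s)) * (1 / (1 + s)) := by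
    filter_upwards with s using mul_self_nonneg _
  have hi : IntegrableOn (fun s : ℝ => (1 / (1 + s)) * (1 / (1 + s))) (Ioi 0) μ := by
    refine integrableOn_of_norm_le_one_add hμ (C := 1) ?_ fun s hs => ?_
    · have : ContinuousOn (fun s : ℝ => 1 / (1 + s)) (Ioi 0) :=
        continuousOn_const.div (by fun_prop) fun s hs => by
          have : (0 : ℝ) < s := hs
          positivity
      exact this.mul this
    · rw [Real.norm_of_nonneg (by positivity)]
      gcongr
      exact (div_le_one (by positivity)).2 (by linarith)
  have h0 : 0 ≤ ∫ s in Ioi (0 : ℝ), (1 / (1 + s)) * (1 / (1 + s)) ∂μ :=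
    integral_nonneg_of_ae hnn
  refine lt_of_le_of_ne (by linarith) fun hcon => ?_
  have h1 : ∫ s in Ioi (0 : ℝ), (1 / (1 + s)) * (1 / (1 + s)) ∂μ = 0 := by linarith
  have h2 := (integral_eq_zero_iff_of_nonneg_ae hnn hi).1 h1
  have h3 : ∫ s in Ioi (0 : ℝ), 1 / (1 + s) ∂μ = 0 := by
    refine integral_eq_zero_of_ae ?_
    filter_upwards [h2] with s hs using mul_self_eq_zero.1 hs
  linarith

/-- The bounded inverse of `f(1 + A)` is a non-negative operator. -/
theorem IsPseudoResolvent.exists_nonnegBound_inverse {R : ℝ → X →L[ℂ] X} {M : ℝ}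
    (hR : IsPseudoResolvent R) (hM : ∀ s, 0 < s → ‖R s‖ ≤ M / s) (hT : DenseRange (R 1)) {a : ℝ}
    {μ : Measure ℝ} (ha : 0 ≤ a) (hμ : IntegrableOn (fun s : ℝ => 1 / (1 + s)) (Ioi 0) μ)
    (hpos : 0 < a + ∫ s in Ioi (0 : ℝ), 1 / (1 + s) ∂μ) :
    ∃ (G : X →L[ℂ] X) (M' : ℝ), NonnegBound G M' ∧ Commute G (R 1) ∧
      G * cbfMulInv a μ R = R 1 ∧ cbfMulInv a μ R * G = R 1 := by
  set T := R 1 with hTdef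
  set V := cbfMulInv a μ R with hV
  set ν := a + ∫ s in Ioi (0 : ℝ), (1 / (1 + s)) * (1 / (1 + s)) ∂μ with hν
  have hν0 : 0 < ν := pos_integral_one_add_mul ha hμ hpos
  set M₁ := max ‖(1 : X →L[ℂ] X)‖ M with hM₁
  have hM₁0 : 0 ≤ M₁ := (norm_nonneg _).trans (le_max_left _ _)
  have hn : ∀ n : ℕ, (1 : ℝ) ≤ (n : ℝ) + 1 := fun n => by
    have : (0 : ℝ) ≤ n := n.cast_nonneg
    linarith
  -- The operator `J r` plays the role of `(r + f(B))⁻¹`. The value `r = 0` gives `G`; the values `r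
  -- > 0` give the resolvents of `f(B)`, from which non-negativity of `G` follows.
  have key : ∀ r : ℝ, 0 ≤ r → ∃ J : X →L[ℂ] X, ‖J‖ ≤ M₁ / (r + ν) ∧ Commute J T ∧
      J * (r • T + V) = T ∧ (r • T + V) * J = T := fun r hr => by
    refine exists_factor_of_tendsto hT
      (P := fun n : ℕ => r • 1 + cbfApprox a μ R ((n : ℝ) + 1))
      (fun n => hR.isUnit_cbfApprox hM hμ (hn n) hr hν0 le_rfl)
      (fun n => ((Commute.one_right _).smul_right r).add_right
        (hR.commute_cbfApprox hM hμ (hn n))) ?_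
    have h := (hR.tendsto_cbfApprox_mul hM hμ (a := a)).const_add (r • T)
    refine h.congr fun n => ?_
    rw [add_mul, smul_mul_assoc, one_mul]
  obtain ⟨G, -, hGT, hGV, hVG⟩ := key 0 le_rfl
  rw [zero_smul, zero_add] at hGV hVG
  choose! J hJn hJT hJV hVJ using key
  have h1 : ∀ r, 0 < r → G - J r = r • (G * J r) := fun r hr => by
    refine eq_of_mul_eq_mul_of_denseRange hT ?_
    have h := congrArg (G * ·) (hVJ r hr.le)
    simp only [← mul_assoc, mul_add, mul_smul_comm, hGV] at h
    rw [sub_mul, smul_mul_assoc, mul_assoc, (hJT r hr.le).eq, ← h, add_mul, smul_mul_assoc,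
      ← mul_assoc]
    abel
  have h2 : ∀ r, 0 < r → G - J r = r • (J r * G) := fun r hr => by
    refine eq_of_mul_eq_mul_of_denseRange hT ?_
    have h := congrArg (· * G) (hJV r hr.le)
    simp only [mul_assoc, add_mul, smul_mul_assoc, hVG] at h
    rw [sub_mul, smul_mul_assoc, mul_assoc, hGT.eq]
    nth_rewrite 1 [← h]
    rw [mul_add, mul_smul_comm]
    abel
  have h3 : ∀ r, 0 < r → r * ‖J r‖ ≤ M₁ := fun r hr => by
    calc r * ‖J r‖ ≤ r * (M₁ / (r + ν)) := by gcongr; exact hJn r hr.le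
      _ = M₁ * (r / (r + ν)) := by ring
      _ ≤ M₁ * 1 := by gcongr; exact (div_le_one (by linarith)).2 (by linarith)
      _ = M₁ := mul_one _
  exact ⟨G, _, (nonnegBound_of_resolvent h1 h2 h3).1, hGT, hGV, hVG⟩

end Inverse

/-! ### Powers of `B⁻¹` factor through powers of `f(B)⁻¹` -/

section Factorization

variable {𝔸 : Type*} [NormedRing 𝔸] [NormedAlgebra ℝ 𝔸] [CompleteSpace 𝔸] {R : ℝ → 𝔸} {M a : ℝ}
  {μ : Measure ℝ}

/-- The operator `f(B) (1 + t B)⁻¹` is bounded by a multiple of `f(1 / t)`. -/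
theorem IsPseudoResolvent.exists_norm_res_mul_cbfMulInv_le (hR : IsPseudoResolvent R)
    (hM : ∀ s, 0 < s → ‖R s‖ ≤ M / s) (ha : 0 ≤ a)
    (hμ : IntegrableOn (fun s : ℝ => 1 / (1 + s)) (Ioi 0) μ) :
    ∃ C : ℝ, 0 < C ∧ ∀ r : ℝ, 0 < r → ‖res (R 1) r⁻¹ * cbfMulInv a μ R‖ ≤
      C * (a + ∫ s in Ioi (0 : ℝ), r / (r + s) ∂μ) := by
  obtain ⟨hT, -⟩ := hR.nonnegBound_one hM
  set T := R 1 with hTdef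
  have hM0 := nonneg_of_norm_le hM
  set M₁ := ‖(1 : 𝔸)‖ + M with hM₁
  have hM₁0 : 0 ≤ M₁ := by positivity
  obtain ⟨C, hC0, hC⟩ := hT.exists_norm_resMul_le
  have hCb : ∀ t, 0 < t → ‖resMul T t‖ ≤ C := fun t ht => (hC t ht).trans
    (mul_le_of_le_one_right hC0 ((div_le_one (by linarith)).2 (by linarith)))
  refine ⟨C + 2 * (M * M₁) + 2 * (M₁ * C) + 1, by positivity, fun r hr => ?_⟩
  have hr' := inv_pos.2 hr
  have hpt : ∀ s, 0 < s → ‖res T r⁻¹ * R (1 + s)‖ ≤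
      (2 * (M * M₁) + 2 * (M₁ * C)) * (r / (r + s)) := fun s hs => by
    have hS := norm_le_one_add hM hs
    -- For `s ≥ r` the norms of both resolvents are multiplied. For `s ≤ r` the singularity is
    -- removed by writing `R (1 + s) = T (1 - s R (1 + s))`, so that `T` combines with the resolvent
    -- of `T` to a bounded operator.
    rcases le_total r s with h | h
    · have e : r / s ≤ 2 * (r / (r + s)) := by
        rw [mul_div_assoc', div_le_div_iff₀ hs (by positivity)]; nlinarith
      have e0 : 1 / (1 + s) ≤ 1 / s := one_div_le_one_div_of_le hs (by linarith)
      calc ‖res T r⁻¹ * R (1 + s)‖ ≤ (M₁ / r⁻¹) * (M * (1 / s)) := by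
            refine (norm_mul_le _ _).trans ?_
            gcongr
            · exact (hT _ hr').2
            · exact hS.trans (by gcongr)
        _ = (M * M₁) * (r / s) := by rw [div_inv_eq_mul]; ring
        _ ≤ (M * M₁) * (2 * (r / (r + s))) := by gcongr
        _ ≤ _ := by
            have : 0 ≤ 2 * (M₁ * C) * (r / (r + s)) := by positivity
            linarith
    · have e : 1 ≤ 2 * (r / (r + s)) := by
        rw [mul_div_assoc', le_div_iff₀ (by positivity)]; linarith
      have e1 : res T r⁻¹ * R (1 + s) = resMul T r⁻¹ * (1 - s • R (1 + s)) := by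
        have h1 : R (1 + s) = T * (1 - s • R (1 + s)) := by
          rw [mul_sub, mul_one, mul_smul_comm, ← (hR.one_sub hs).1, sub_sub_cancel]
        nth_rewrite 1 [h1]
        rw [← mul_assoc, resMul, (hT.commute_res hr').eq]
      calc ‖res T r⁻¹ * R (1 + s)‖ ≤ C * M₁ := by
            rw [e1]
            refine (norm_mul_le _ _).trans ?_
            gcongr
            · exact hCb _ hr'
            · exact norm_one_sub_smul_le hM hs
        _ ≤ C * M₁ * (2 * (r / (r + s))) := le_mul_of_one_le_right (by positivity) e
        _ ≤ _ := by
            have : 0 ≤ 2 * (M * M₁) * (r / (r + s)) := by positivity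
            linarith
  have hi := hR.integrableOn_one_add hM hμ
  have hf0 : 0 ≤ ∫ s in Ioi (0 : ℝ), r / (r + s) ∂μ := by
    refine setIntegral_nonneg measurableSet_Ioi fun s hs => ?_
    have : (0 : ℝ) < s := hs
    positivity
  have h2 : ‖∫ s in Ioi (0 : ℝ), res T r⁻¹ * R (1 + s) ∂μ‖ ≤
      (2 * (M * M₁) + 2 * (M₁ * C)) * ∫ s in Ioi (0 : ℝ), r / (r + s) ∂μ := by
    rw [← integral_const_mul]
    refine norm_integral_le_of_norm_le ((integrableOn_div_add hμ hr).const_mul _) ?_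
    filter_upwards [ae_restrict_mem measurableSet_Ioi] with s hs using hpt s hs
  rw [cbfMulInv, mul_add, mul_smul_comm, ← (hT.commute_res hr').eq, ← resMul,
    ← integral_const_mul_of_integrable hi]
  refine (norm_add_le _ _).trans ?_
  rw [norm_smul, Real.norm_of_nonneg ha]
  have h3 : a * ‖resMul T r⁻¹‖ ≤ a * C := by gcongr; exact hCb _ hr'
  have h4 : 0 ≤ (2 * (M * M₁) + 2 * (M₁ * C) + 1) * a := by positivity
  have h5 : 0 ≤ (C + 1) * ∫ s in Ioi (0 : ℝ), r / (r + s) ∂μ := by positivity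
  linarith

theorem NonnegBound.exists_balPow_eq_smul_balInt {T : 𝔸} (h : NonnegBound T M) {α : ℝ} (hα : 0 < α)
    {n : ℕ} (hn : ⌊α⌋₊ + 1 ≤ n) : ∃ c : ℝ, balPow T α = c • balInt T α n := by
  induction n, hn using Nat.le_induction with
  | base => exact ⟨_, rfl⟩
  | succ n hn ih =>
    obtain ⟨c, hc⟩ := ih
    have hlt : α < n := (Nat.lt_floor_add_one α).trans_le (by exact_mod_cast hn)
    have h1 := h.balInt_succ hα hlt
    refine ⟨c * (((n : ℝ) - α)⁻¹ * n), ?_⟩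
    rw [hc, mul_smul, mul_smul, h1, inv_smul_smul₀ (by linarith)]

theorem NonnegBound.exists_pow_eq_mul_balPow {G : 𝔸} (h : NonnegBound G M) {α : ℝ} (hα : 0 < α) :
    ∃ W : 𝔸, G ^ (⌊α⌋₊ + 1) = W * balPow G α ∧ G ^ (⌊α⌋₊ + 1) = balPow G α * W := by
  obtain ⟨C, hC, H⟩ := exists_balPow_mul_balPow 𝔸 hα
  have h1 := H G M h
  have hc : Commute (balPow G α) (balPow G (⌊α⌋₊ + 1 - α)) :=
    h.commute_balPow (h.commute_balPow (Commute.refl G) hα).symm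
      (by linarith [Nat.lt_floor_add_one α])
  refine ⟨C⁻¹ • balPow G (⌊α⌋₊ + 1 - α), ?_, ?_⟩
  · rw [smul_mul_assoc, ← hc.eq, h1, inv_smul_smul₀ hC.ne']
  · rw [mul_smul_comm, h1, inv_smul_smul₀ hC.ne']

/-- A power of `T = B⁻¹` of arbitrary positive order factors through every power of
`G = f(B)⁻¹`, provided that `f` grows more slowly than any power. -/
theorem IsPseudoResolvent.exists_balPow_eq_mul_balPow (hR : IsPseudoResolvent R)
    (hM : ∀ s, 0 < s → ‖R s‖ ≤ M / s) (ha : 0 ≤ a)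
    (hμ : IntegrableOn (fun s : ℝ => 1 / (1 + s)) (Ioi 0) μ)
    (hf : ∀ δ : ℝ, 0 < δ → ∃ C : ℝ, ∀ r : ℝ, 1 ≤ r →
      a + ∫ s in Ioi (0 : ℝ), r / (r + s) ∂μ ≤ C * r ^ δ)
    {G : 𝔸} {M' : ℝ} (hG : NonnegBound G M') (hGT : Commute G (R 1))
    (hGV : G * cbfMulInv a μ R = R 1) (hVG : cbfMulInv a μ R * G = R 1) {α β : ℝ} (hα : 0 < α)
    (hβ : 0 < β) : ∃ Q : 𝔸, balPow (R 1) β = Q * balPow G α := by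
  obtain ⟨hT, -⟩ := hR.nonnegBound_one hM
  set T := R 1 with hTdef
  set V := cbfMulInv a μ R with hV
  set N := ⌊α⌋₊ + 1 with hN
  set n := max (⌊β⌋₊ + 1) N with hn
  have hNn : N ≤ n := le_max_right _ _
  obtain ⟨c, hc⟩ := hT.exists_balPow_eq_smul_balInt hβ (n := n) (le_max_left _ _)
  have hβn : β < n := (Nat.lt_floor_add_one β).trans_le (by exact_mod_cast le_max_left _ _)
  obtain ⟨W, hW, -⟩ := hG.exists_pow_eq_mul_balPow hα
  -- Since `(t + T)⁻¹ V G = T (t + T)⁻¹`, the factor `G ^ N` can be pulled out of the Balakrishnan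
  -- integrand, leaving powers of `(t + T)⁻¹ V`, which grows slowly as `t → 0`.
  have hpow : ∀ t, 0 < t → resMul T t ^ n =
      resMul T t ^ (n - N) * (res T t * V) ^ N * G ^ N := fun t ht => by
    have h1 : res T t * V * G = resMul T t := by
      rw [mul_assoc, hVG, resMul, (hT.commute_res ht).eq]
    have h2 : Commute (res T t * V) G :=
      (hT.commute_of_commute hGT ht).symm.mul_left (hVG.trans hGV.symm)
    rw [mul_assoc, ← h2.mul_pow, h1, ← pow_add, Nat.sub_add_cancel hNn]
  -- The `N` factors together cost `t ^ (-β / 2)` at the origin, so half of the available exponent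
  -- `β` remains for convergence.
  set δ := β / (2 * N) with hδ
  have hN0 : (0 : ℝ) < N := by rw [hN]; positivity
  have hδ0 : 0 < δ := by positivity
  have hδN : δ * N = β / 2 := by rw [hδ]; field_simp
  obtain ⟨C₁, hC₁0, hC₁⟩ := hR.exists_norm_res_mul_cbfMulInv_le hM ha hμ
  obtain ⟨C₂, hC₂⟩ := hf δ hδ0
  set C₃ := ‖(1 : 𝔸)‖ + M with hC₃
  have hC₃0 : 0 ≤ C₃ := hT.nonneg
  set K := C₁ * |C₂| + C₃ * ‖V‖ with hK
  have hL : ∀ t, 0 < t → ‖res T t * V‖ ≤ K * (t ^ (-δ) * (min 1 t⁻¹) ^ (1 - δ)) := fun t ht => by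
    rcases le_total t 1 with h | h
    · rw [min_eq_left (one_le_inv_iff₀.2 ⟨ht, h⟩), Real.one_rpow, mul_one]
      have h1 := hC₁ t⁻¹ (inv_pos.2 ht)
      rw [inv_inv] at h1
      have h2 := hC₂ t⁻¹ (one_le_inv_iff₀.2 ⟨ht, h⟩)
      rw [Real.inv_rpow ht.le, ← Real.rpow_neg ht.le] at h2
      have h3 := Real.rpow_pos_of_pos ht (-δ)
      calc _ ≤ C₁ * (C₂ * t ^ (-δ)) := h1.trans (by gcongr)
        _ ≤ C₁ * (|C₂| * t ^ (-δ)) := by gcongr; exact le_abs_self _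
        _ ≤ _ := by
          have : 0 ≤ C₃ * ‖V‖ * t ^ (-δ) := by positivity
          rw [hK]; linarith
    · rw [min_eq_right (inv_le_one_of_one_le₀ h), Real.inv_rpow ht.le, ← Real.rpow_neg ht.le,
        ← Real.rpow_add ht]
      have e : -δ + -(1 - δ) = -1 := by ring
      rw [e, Real.rpow_neg_one]
      calc ‖res T t * V‖ ≤ C₃ / t * ‖V‖ := (norm_mul_le _ _).trans (by gcongr; exact (hT t ht).2)
        _ = C₃ * ‖V‖ * t⁻¹ := by ring
        _ ≤ _ := by
          have : 0 ≤ C₁ * |C₂| * t⁻¹ := by positivity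
          rw [hK]; linarith
  have hK0 : 0 ≤ K := by positivity
  set C₄ := ‖(1 : 𝔸)‖ + C₃ + ‖T‖ * C₃ with hC₄
  have hLpow : ∀ t, 0 < t → ∀ k : ℕ, ‖(res T t * V) ^ k‖ ≤
      ‖(1 : 𝔸)‖ * (K * (t ^ (-δ) * (min 1 t⁻¹) ^ (1 - δ))) ^ k := fun t ht k => by
    induction k with
    | zero => simp
    | succ k ih =>
      rw [pow_succ, pow_succ (K * _), ← mul_assoc ‖(1 : 𝔸)‖]
      exact (norm_mul_le _ _).trans (mul_le_mul ih (hL t ht) (norm_nonneg _)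
        ((norm_nonneg _).trans ih))
  have hi : IntegrableOn (fun t : ℝ => t ^ (β - 1) •
      (resMul T t ^ (n - N) * (res T t * V) ^ N)) (Ioi 0) := by
    refine integrableOn_of_norm_le_rpow_mul_min (p := β - 1 - β / 2) (q := n - β / 2)
      (C := ‖(1 : 𝔸)‖ * C₄ ^ (n - N) * (‖(1 : 𝔸)‖ * K ^ N)) ?_ (by linarith) (by linarith)
      fun t ht => ?_
    · exact (continuousOn_rpow_Ioi _).smul ((hT.continuousOn_resMul.pow _).mul
        ((hT.continuousOn_res.mul continuousOn_const).pow _))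
    · have hm : 0 < min 1 t⁻¹ := by positivity
      have e1 : (t ^ (-δ) * (min 1 t⁻¹) ^ (1 - δ)) ^ N =
          t ^ (-(β / 2)) * (min 1 t⁻¹) ^ (N - β / 2) := by
        rw [mul_pow, ← Real.rpow_natCast, ← Real.rpow_natCast, ← Real.rpow_mul ht.le,
          ← Real.rpow_mul hm.le, ← hδN]
        ring_nf
      have e2 : ((n - N : ℕ) : ℝ) + (N - β / 2) = n - β / 2 := by
        rw [Nat.cast_sub hNn]; ring
      rw [norm_smul, Real.norm_of_nonneg (Real.rpow_nonneg ht.le _)]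
      have htp := Real.rpow_nonneg ht.le (β - 1)
      calc t ^ (β - 1) * ‖resMul T t ^ (n - N) * (res T t * V) ^ N‖
          ≤ t ^ (β - 1) * ((‖(1 : 𝔸)‖ * C₄ ^ (n - N) * (min 1 t⁻¹) ^ ((n - N : ℕ) : ℝ)) *
            (‖(1 : 𝔸)‖ * (K * (t ^ (-δ) * (min 1 t⁻¹) ^ (1 - δ))) ^ N)) := by
            gcongr
            exact (norm_mul_le _ _).trans (mul_le_mul (hT.norm_resMul_pow_le ht _) (hLpow t ht N)
              (norm_nonneg _) ((norm_nonneg _).trans (hT.norm_resMul_pow_le ht _)))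
        _ = ‖(1 : 𝔸)‖ * C₄ ^ (n - N) * (‖(1 : 𝔸)‖ * K ^ N) * ((t ^ (β - 1) * t ^ (-(β / 2))) *
            ((min 1 t⁻¹) ^ ((n - N : ℕ) : ℝ) * (min 1 t⁻¹) ^ (N - β / 2))) := by
            rw [mul_pow, e1]; ring
        _ = _ := by rw [← Real.rpow_add ht, ← Real.rpow_add hm, e2, ← sub_eq_add_neg]
  refine ⟨(c • ∫ t in Ioi (0 : ℝ), t ^ (β - 1) •
    (resMul T t ^ (n - N) * (res T t * V) ^ N)) * W, ?_⟩
  rw [hc, mul_assoc, ← hW, smul_mul_assoc, ← integral_mul_const_of_integrable hi, balInt]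
  congr 1
  refine setIntegral_congr_fun measurableSet_Ioi fun t ht => ?_
  rw [smul_mul_assoc, hpow t ht]

end Factorization

/-! ### The factorized resolvent estimate for a slowly varying gain -/

section Algebra

variable {𝔸 : Type*} [NormedRing 𝔸] [NormedAlgebra ℂ 𝔸] [CompleteSpace 𝔸] {R : ℝ → 𝔸} {M a : ℝ}
  {μ : Measure ℝ}

/-- A resolvent `S = (λ + A)⁻¹` almost commutes with `f(1 + A)⁻¹` up to a scalar factor. -/
theorem IsPseudoResolvent.exists_mul_inverse_eq (hR : IsPseudoResolvent R)
    (hM : ∀ s, 0 < s → ‖R s‖ ≤ M / s) (ha : 0 ≤ a)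
    (hμ : IntegrableOn (fun s : ℝ => 1 / (1 + s)) (Ioi 0) μ) {G : 𝔸}
    (hVG : cbfMulInv a μ R * G = R 1) {S : 𝔸} {z : ℂ} (hz : 0 ≤ z.re) (hz0 : z ≠ 0)
    (hS : ∀ s : ℝ, 0 ≤ s → S * R (1 + s) = ((s : ℂ) + z)⁻¹ • (S - R (1 + s)))
    (hφ : cbfOp a 0 μ z ≠ 0) : ∃ E : 𝔸, S * G = (cbfOp a 0 μ z)⁻¹ • S - E ∧
      ‖E‖ ≤ ‖(cbfOp a 0 μ z)⁻¹‖ *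
        (2 * M / ‖z‖ * (a + ∫ s in Ioi (0 : ℝ), ‖z‖ / (‖z‖ + s) ∂μ) * ‖G‖) := by
  have hn : 0 < ‖z‖ := norm_pos_iff.2 hz0
  have hM0 := nonneg_of_norm_le hM
  set D := ∫ s in Ioi (0 : ℝ), ((s : ℂ) / ((s : ℂ) + z)) • R (1 + s) ∂μ with hD
  have hcR := hR.continuousOn_one_add hM
  have hi := hR.integrableOn_one_add hM hμ
  have hic := (nonnegBound_complex hz).integrableOn_resMul hμ
  have hpt : ∀ s : ℝ, 0 < s → ‖((s : ℂ) / ((s : ℂ) + z)) • R (1 + s)‖ ≤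
      2 * M / ‖z‖ * (‖z‖ / (‖z‖ + s)) := fun s hs => by
    have h0 : 0 < ‖(s : ℂ) + z‖ := norm_pos_iff.2 (ofReal_add_ne_zero hz hs)
    have h1 := add_norm_le_two_mul hz hs.le
    have h2 : ‖(s : ℂ) / ((s : ℂ) + z)‖ ≤ 2 * (s / (‖z‖ + s)) := by
      rw [norm_div, Complex.norm_real, Real.norm_of_nonneg hs.le, mul_div_assoc',
        div_le_div_iff₀ h0 (by positivity)]
      nlinarith
    calc _ ≤ 2 * (s / (‖z‖ + s)) * (M * (1 / (1 + s))) := by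
          rw [norm_smul]
          gcongr
          exact norm_le_one_add hM hs
      _ = 2 * M / (‖z‖ + s) * (s / (1 + s)) := by ring
      _ ≤ 2 * M / (‖z‖ + s) * 1 := by gcongr; exact (div_le_one (by linarith)).2 (by linarith)
      _ = _ := by field_simp
  have hDi : IntegrableOn (fun s : ℝ => ((s : ℂ) / ((s : ℂ) + z)) • R (1 + s)) (Ioi 0) μ := by
    refine ((integrableOn_div_add hμ hn).const_mul (2 * M / ‖z‖)).mono' ?_ ?_
    · refine ContinuousOn.aestronglyMeasurable ?_ measurableSet_Ioi
      refine ContinuousOn.smul (ContinuousOn.div (by fun_prop) (by fun_prop) fun s hs => ?_) hcR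
      exact ofReal_add_ne_zero hz hs
    · filter_upwards [ae_restrict_mem measurableSet_Ioi] with s hs using hpt s hs
  have hDn : ‖D‖ ≤ 2 * M / ‖z‖ * (a + ∫ s in Ioi (0 : ℝ), ‖z‖ / (‖z‖ + s) ∂μ) := by
    calc ‖D‖ ≤ 2 * M / ‖z‖ * ∫ s in Ioi (0 : ℝ), ‖z‖ / (‖z‖ + s) ∂μ := by
          rw [← integral_const_mul]
          refine norm_integral_le_of_norm_le ((integrableOn_div_add hμ hn).const_mul _) ?_
          filter_upwards [ae_restrict_mem measurableSet_Ioi] with s hs using hpt s hs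
      _ ≤ _ := by gcongr; linarith
  have hST : z • (S * R 1) = S - R 1 := by
    have := hS 0 le_rfl
    rw [add_zero, Complex.ofReal_zero, zero_add] at this
    rw [this, smul_inv_smul₀ hz0]
  -- The integrated resolvent identity, with `s / (s + z) = 1 - z / (s + z)` isolating the defect
  -- `D`. Multiplying by `G` on the right turns `V G` into `T`, and the terms in `T` cancel.
  have hSV : z • (S * cbfMulInv a μ R) = cbfOp a 0 μ z • S - cbfMulInv a μ R + D := by
    have h1 : z • (S * ∫ s in Ioi (0 : ℝ), R (1 + s) ∂μ) =
        (∫ s in Ioi (0 : ℝ), resMul z s ∂μ) • S - (∫ s in Ioi (0 : ℝ), R (1 + s) ∂μ) + D := by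
      have hsub : IntegrableOn (fun s => resMul z s • S - R (1 + s)) (Ioi 0) μ :=
        (hic.smul_const S).sub hi
      rw [← integral_const_mul_of_integrable hi, ← integral_smul, ← integral_smul_const, hD,
        ← integral_sub (hic.smul_const S) hi, ← integral_add hsub hDi]
      refine setIntegral_congr_fun measurableSet_Ioi fun s hs => ?_
      have h0 := ofReal_add_ne_zero hz hs
      change z • (S * R (1 + s)) = resMul z s • S - R (1 + s) + ((s : ℂ) / ((s : ℂ) + z)) • R (1 + s)
      have h2 : (s : ℂ) / ((s : ℂ) + z) = 1 - z / ((s : ℂ) + z) := by field_simp; ring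
      rw [hS s (le_of_lt hs), resMul_complex, smul_smul, ← div_eq_mul_inv, smul_sub, h2, sub_smul,
        one_smul]
      abel
    have h3 : z • (S * (a • R 1)) = a • S - a • R 1 := by
      rw [mul_smul_comm, smul_comm, hST, smul_sub]
    rw [cbfMulInv, mul_add, smul_add, h1, h3, cbfOp, zero_smul, zero_add, add_smul, smul_assoc,
      one_smul]
    abel
  refine ⟨(cbfOp a 0 μ z)⁻¹ • (D * G), ?_, ?_⟩
  · have h := congrArg (· * G) hSV
    simp only [smul_mul_assoc, mul_assoc, hVG, add_mul, sub_mul, hST] at h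
    rw [sub_add_eq_add_sub, sub_left_inj] at h
    nth_rewrite 2 [h]
    rw [smul_add, inv_smul_smul₀ hφ]
    abel
  · rw [norm_smul]
    gcongr
    exact (norm_mul_le _ _).trans (by gcongr)

/-- The resolvent estimate for products of fractional powers of `(1 + A)⁻¹` and of `f(1 + A)` for a
complete Bernstein function `f` comparable to a slowly varying function. -/
theorem IsPseudoResolvent.exists_factor_norm_le (hR : IsPseudoResolvent R)
    (hM : ∀ s, 0 < s → ‖R s‖ ≤ M / s) (ha : 0 ≤ a)
    (hμ : IntegrableOn (fun s : ℝ => 1 / (1 + s)) (Ioi 0) μ)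
    {κ : ℝ → ℝ} (hκ : IsIncreasingSlowlyVarying κ) {k₁ k₂ : ℝ} (hk₁ : 0 < k₁)
    (hk : ∀ r : ℝ, 1 ≤ r → k₁ * κ r ≤ a + ∫ s in Ioi (0 : ℝ), r / (r + s) ∂μ ∧
      a + ∫ s in Ioi (0 : ℝ), r / (r + s) ∂μ ≤ k₂ * κ r)
    {G : 𝔸} {M' : ℝ} (hG : NonnegBound G M') (hGT : Commute G (R 1))
    (hGV : G * cbfMulInv a μ R = R 1) (hVG : cbfMulInv a μ R * G = R 1) {β p : ℝ}
    (hβ : 0 < β) (hp : 0 ≤ p) (K : ℝ) :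
    ∃ C : ℝ, 0 ≤ C ∧ ∀ (S : 𝔸) (z : ℂ), 1 ≤ ‖z‖ → 0 ≤ z.re →
      (∀ s : ℝ, 0 ≤ s → S * R (1 + s) = ((s : ℂ) + z)⁻¹ • (S - R (1 + s))) →
      ‖S‖ ≤ K * (‖z‖ ^ β * (1 / κ ‖z‖)) →
      ∃ N : 𝔸, N * balPow G (1 + p) = S * balPow (R 1) β ∧ ‖N‖ ≤ C * κ ‖z‖ ^ p := by
  obtain ⟨hT, -⟩ := hR.nonnegBound_one hM
  set T := R 1 with hTdef
  set M₁ := ‖(1 : 𝔸)‖ + M with hM₁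
  have hM0 := nonneg_of_norm_le hM
  have hα : 0 < 1 + p := by linarith
  set δ := min β 1 / 2 with hδ
  have hδ0 : 0 < δ := by rw [hδ]; positivity
  have hδβ : δ < β := by
    have : min β 1 ≤ β := min_le_left _ _
    have : 0 < min β 1 := by positivity
    rw [hδ]; linarith
  have hδ1 : δ ≤ 1 := by
    have : min β 1 ≤ 1 := min_le_right _ _
    rw [hδ]; linarith
  have hκ1 := hκ.pos 1 one_pos
  have hk₂ : 0 < k₂ := by
    have := (hk 1 le_rfl).1.trans (hk 1 le_rfl).2
    have : 0 < k₂ * κ 1 := lt_of_lt_of_le (by positivity) this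
    exact (pos_iff_pos_of_mul_pos this).2 hκ1
  obtain ⟨Q, hQ⟩ := hR.exists_balPow_eq_mul_balPow hM ha hμ (fun η hη => by
    obtain ⟨C, hC, h⟩ := hκ.exists_le_rpow hη
    refine ⟨k₂ * C, fun r hr => (hk r hr).2.trans ?_⟩
    rw [mul_assoc]
    gcongr
    exact h r hr) hG hGT hGV hVG hα hβ
  obtain ⟨C₁, hC₁, h1⟩ := exists_norm_mul_balPow_sub_le 𝔸 hβ hδ0 hδ1 hδβ M₁ (‖T‖ + 1)
  obtain ⟨C₃, hC₃, h3⟩ := exists_norm_mul_balPow_sub_le 𝔸 (α := 1 + p) (δ := 1 / 2) hα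
    (by norm_num) (by norm_num) (by linarith) M' (‖G‖ + 2 / (k₁ * κ 1))
  obtain ⟨C₄, hC₄, h4⟩ := exists_norm_balPow_complex_le hβ
  obtain ⟨C₅, hC₅, h5⟩ := exists_le_norm_balPow_complex hα
  obtain ⟨C₆, hC₆, h6⟩ := hκ.exists_rpow_mul_rpow_le zero_le_one hδ0
  obtain ⟨C₇, hC₇, h7⟩ := hκ.exists_rpow_mul_rpow_le zero_le_one one_pos
  obtain ⟨C₈, hC₈, h8⟩ := hκ.exists_rpow_mul_rpow_le zero_le_two one_pos
  set A₁ := C₁ * ‖T‖ * 2 * C₆ + C₄ * |K| with hA₁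
  set A₂ := C₃ * (4 * M * ‖G‖) * (2 * C₇ + 2 * k₂ * C₈) with hA₂
  have hA₁0 : 0 ≤ A₁ := by positivity
  have hA₂0 : 0 ≤ A₂ := by positivity
  refine ⟨C₅ * (2 * k₂) ^ (1 + p) * (A₁ + A₂ * ‖Q‖), by positivity, fun S z hz1 hz hS hSn => ?_⟩
  set r := ‖z‖ with hr
  have hr0 : 0 < r := by linarith
  have hz0 : z ≠ 0 := norm_pos_iff.1 hr0
  have hx : 0 < κ r := hκ.pos r hr0
  set f := a + ∫ s in Ioi (0 : ℝ), r / (r + s) ∂μ with hf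
  obtain ⟨hf1, hf2⟩ := hk r hz1
  have hf0 : 0 < f := lt_of_lt_of_le (by positivity) hf1
  set φ := cbfOp a 0 μ z with hφ
  have hφre : 0 ≤ φ.re := cbfOp_complex_re_nonneg ha le_rfl hμ hz
  have hφl : f ≤ 2 * ‖φ‖ := by
    simpa only [zero_mul, add_zero] using le_norm_cbfOp_complex le_rfl hμ hz hz0 (a := a)
  have hφu : ‖φ‖ ≤ 2 * f := by
    simpa only [zero_mul, add_zero] using norm_cbfOp_complex_le ha le_rfl hμ hz hz0
  have hφ0 : 0 < ‖φ‖ := by linarith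
  have hφne : φ ≠ 0 := norm_pos_iff.1 hφ0
  obtain ⟨E, hE, hEn⟩ := hR.exists_mul_inverse_eq hM ha hμ hVG hz hz0 hS hφne
  rw [← hφ] at hE hEn
  set g := φ⁻¹ with hg
  have hg0 : 0 < ‖g‖ := by rw [hg, norm_inv]; positivity
  have hgre : 0 ≤ g.re := by
    rw [hg, Complex.inv_re]; exact div_nonneg hφre (Complex.normSq_nonneg _)
  have hgf : ‖g‖ * f ≤ 2 := by
    rw [hg, norm_inv, inv_mul_le_iff₀ hφ0]; linarith
  have hgK : ‖g‖ ≤ ‖G‖ + 2 / (k₁ * κ 1) := by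
    have h0 : κ 1 ≤ κ r := hκ.le_of_le one_pos hz1
    have h1 : k₁ * κ 1 ≤ f := le_trans (by gcongr) hf1
    have : ‖g‖ ≤ 2 / (k₁ * κ 1) := by
      rw [le_div_iff₀ (by positivity)]
      exact le_trans (by gcongr) hgf
    linarith [norm_nonneg G]
  have hEn' : ‖E‖ ≤ 4 * M * ‖G‖ * r⁻¹ := by
    calc ‖E‖ ≤ ‖g‖ * (2 * M / r * f * ‖G‖) := hEn
      _ = 2 * M * ‖G‖ * r⁻¹ * (‖g‖ * f) := by ring
      _ ≤ 2 * M * ‖G‖ * r⁻¹ * 2 := by gcongr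
      _ = _ := by ring
  -- The case without powers of `f(B)`: the perturbation estimate for `T`, with `w = z⁻¹`, shows
  -- that `S T ^ β` inherits the gain `1 / κ r`.
  have hSβ : κ r * ‖S * balPow T β‖ ≤ A₁ := by
    set w := z⁻¹ with hw
    have hwn : ‖w‖ = r⁻¹ := norm_inv z
    have hw0 : 0 < ‖w‖ := by rw [hwn]; positivity
    have hwne : w ≠ 0 := norm_pos_iff.1 hw0
    have hw1 : ‖w‖ ≤ 1 := by rw [hwn]; exact inv_le_one_of_one_le₀ hz1
    have hwre : 0 ≤ w.re := by
      rw [hw, Complex.inv_re]; exact div_nonneg hz (Complex.normSq_nonneg _)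
    have hwδ : ‖w‖ ^ δ = r ^ (-δ) := by rw [hwn, Real.inv_rpow hr0.le, Real.rpow_neg hr0.le]
    have hwle : ‖w‖ ≤ ‖w‖ ^ δ := by
      simpa using Real.rpow_le_rpow_of_exponent_ge hw0 hw1 hδ1
    have hRT : S * T = w • S - w • T := by
      have := hS 0 le_rfl
      rwa [add_zero, Complex.ofReal_zero, zero_add, smul_sub] at this
    have b1 := h1 T S (w • T) w hT (by linarith) hwre hwne (by linarith [norm_nonneg T]) hRT
    have e1 : ‖S * balPow T β - balPow w β • S‖ ≤ C₁ * ‖T‖ * 2 * r ^ (-δ) := by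
      refine b1.trans ?_
      rw [norm_smul]
      have : ‖w‖ * ‖w‖ ^ (δ - 1) = ‖w‖ ^ δ := by
        rw [← Real.rpow_one_add' hw0.le (by linarith)]; ring_nf
      calc C₁ * (‖w‖ * ‖T‖ * (1 + ‖w‖ ^ (δ - 1))) =
            C₁ * ‖T‖ * (‖w‖ + ‖w‖ * ‖w‖ ^ (δ - 1)) := by ring
        _ ≤ C₁ * ‖T‖ * (‖w‖ ^ δ + ‖w‖ ^ δ) := by rw [this]; gcongr
        _ = _ := by rw [hwδ]; ring
    have e2 : ‖S‖ ≤ |K| * (r ^ β * (1 / κ r)) := hSn.trans (by gcongr; exact le_abs_self K)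
    have e3 : ‖w‖ ^ β * r ^ β = 1 := by
      rw [hwn, ← Real.mul_rpow (by positivity) hr0.le, inv_mul_cancel₀ hr0.ne', Real.one_rpow]
    have e4 := h6 r hz1
    rw [Real.rpow_one] at e4
    calc κ r * ‖S * balPow T β‖ ≤ κ r * (C₁ * ‖T‖ * 2 * r ^ (-δ) +
          C₄ * ‖w‖ ^ β * (|K| * (r ^ β * (1 / κ r)))) := by
          gcongr
          have : S * balPow T β = (S * balPow T β - balPow w β • S) + balPow w β • S := by abel
          rw [this]
          refine (norm_add_le _ _).trans (add_le_add e1 ?_)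
          rw [norm_smul]
          gcongr
          exact h4 w hwre hwne
      _ = C₁ * ‖T‖ * 2 * (κ r * r ^ (-δ)) + C₄ * |K| * (‖w‖ ^ β * r ^ β) * (κ r * (1 / κ r)) := by
          ring
      _ ≤ _ := by
          rw [e3, mul_one_div_cancel hx.ne', mul_one, mul_one, hA₁]
          gcongr
  set c := balPow g (1 + p) with hc
  have hcle : ‖g‖ ^ (1 + p) ≤ C₅ * ‖c‖ := h5 g hgre (norm_pos_iff.1 hg0)
  have hgp := Real.rpow_pos_of_pos hg0 (1 + p)
  have hc0 : 0 < ‖c‖ := (pos_iff_pos_of_mul_pos (lt_of_lt_of_le hgp hcle)).1 hC₅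
  have hcinv : ‖c‖⁻¹ ≤ C₅ * (2 * k₂) ^ (1 + p) * (κ r * κ r ^ p) := by
    have e1 : ‖φ‖ ^ (1 + p) ≤ (2 * k₂) ^ (1 + p) * (κ r * κ r ^ p) := by
      rw [← Real.rpow_one_add' hx.le (by linarith), ← Real.mul_rpow (by positivity) hx.le]
      exact Real.rpow_le_rpow hφ0.le (by linarith) hα.le
    have e2 : ‖g‖ ^ (1 + p) = (‖φ‖ ^ (1 + p))⁻¹ := by
      rw [hg, norm_inv, Real.inv_rpow hφ0.le]
    have hφp := Real.rpow_pos_of_pos hφ0 (1 + p)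
    rw [inv_le_iff_one_le_mul₀ hc0]
    rw [e2, inv_le_iff_one_le_mul₀ hφp] at hcle
    calc 1 ≤ C₅ * ‖c‖ * ‖φ‖ ^ (1 + p) := hcle
      _ ≤ C₅ * ‖c‖ * ((2 * k₂) ^ (1 + p) * (κ r * κ r ^ p)) := by gcongr
      _ = _ := by ring
  have hEα : κ r * ‖S * balPow G (1 + p) - c • S‖ ≤ A₂ := by
    have b3 := h3 G S E g hG (by have : 0 < 2 / (k₁ * κ 1) := by positivity
                                 linarith) hgre (norm_pos_iff.1 hg0) hgK hE
    have e1 : ‖g‖ ^ ((1 / 2 : ℝ) - 1) ≤ 1 + 2 * k₂ * κ r := by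
      have e0 : ‖g‖⁻¹ ≤ 2 * k₂ * κ r := by rw [hg, norm_inv, inv_inv]; linarith
      rcases le_total 1 ‖g‖ with hh | hh
      · have := Real.rpow_le_one_of_one_le_of_nonpos hh (by norm_num : (1 / 2 : ℝ) - 1 ≤ 0)
        have : 0 ≤ 2 * k₂ * κ r := by positivity
        linarith
      · have := Real.rpow_le_rpow_of_exponent_ge hg0 hh (by norm_num : (-1 : ℝ) ≤ (1 / 2 : ℝ) - 1)
        rw [Real.rpow_neg_one] at this
        linarith
    have e2 := h7 r hz1
    have e3 := h8 r hz1
    rw [Real.rpow_neg_one, Real.rpow_one] at e2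
    rw [Real.rpow_neg_one, Real.rpow_two] at e3
    calc κ r * ‖S * balPow G (1 + p) - c • S‖
        ≤ κ r * (C₃ * (4 * M * ‖G‖ * r⁻¹ * (1 + (1 + 2 * k₂ * κ r)))) := by
          gcongr
          exact b3.trans (by gcongr)
      _ = C₃ * (4 * M * ‖G‖) * (2 * (κ r * r⁻¹) + 2 * k₂ * (κ r ^ 2 * r⁻¹)) := by ring
      _ ≤ _ := by rw [hA₂]; gcongr
  have hcomm : Commute (balPow T β) (balPow G (1 + p)) :=
    hG.commute_balPow (hT.commute_balPow hGT hβ).symm hα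
  -- Formally `N = S T ^ β G ^ (-1 - p)`. Replacing `G ^ (1 + p)` by `c` gives the first term; the
  -- correction is bounded because `T ^ β = Q G ^ (1 + p)` supplies the factor that compensates the
  -- unbounded power.
  refine ⟨c⁻¹ • (S * balPow T β + (c • S - S * balPow G (1 + p)) * Q), ?_, ?_⟩
  · have e : (c • S - S * balPow G (1 + p)) * Q * balPow G (1 + p) =
        c • (S * balPow T β) - S * balPow T β * balPow G (1 + p) := by
      rw [mul_assoc _ Q, ← hQ, sub_mul, smul_mul_assoc, mul_assoc, mul_assoc, hcomm.eq]
    rw [smul_mul_assoc, add_mul, e, add_sub_cancel, inv_smul_smul₀ (norm_pos_iff.1 hc0)]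
  · rw [norm_smul, norm_inv]
    calc ‖c‖⁻¹ * ‖S * balPow T β + (c • S - S * balPow G (1 + p)) * Q‖
        ≤ C₅ * (2 * k₂) ^ (1 + p) * (κ r * κ r ^ p) *
          (‖S * balPow T β‖ + ‖S * balPow G (1 + p) - c • S‖ * ‖Q‖) := by
          gcongr
          refine (norm_add_le _ _).trans ?_
          gcongr
          refine (norm_mul_le _ _).trans_eq ?_
          rw [norm_sub_rev]
      _ = C₅ * (2 * k₂) ^ (1 + p) * κ r ^ p * (κ r * ‖S * balPow T β‖ +
          (κ r * ‖S * balPow G (1 + p) - c • S‖) * ‖Q‖) := by ring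
      _ ≤ C₅ * (2 * k₂) ^ (1 + p) * κ r ^ p * (A₁ + A₂ * ‖Q‖) := by gcongr
      _ = _ := by ring

end Algebra

/-! ### Inverses of bounded injective operators and closures -/

section Operators

variable {X : Type*} [NormedAddCommGroup X] [NormedSpace ℂ X]

theorem ker_ofBounded {G : X →L[ℂ] X} (hG : Function.Injective G) :
    LinearMap.ker (ofBounded G).toFun = ⊥ := by
  refine LinearMap.ker_eq_bot'.2 fun x hx => Subtype.ext ?_
  exact hG ((show G x = 0 from hx).trans (map_zero G).symm)

theorem mem_graph_inverse_ofBounded {G : X →L[ℂ] X} (hG : Function.Injective G) {p : X × X} :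
    p ∈ (ofBounded G).inverse.graph ↔ G p.2 = p.1 := by
  rw [LinearPMap.inverse_graph (ker_ofBounded hG)]
  constructor
  · rintro ⟨q, hq, rfl⟩
    obtain ⟨x, hx, hxq⟩ := (LinearPMap.mem_graph_iff _).1 hq
    change G q.1 = q.2
    rw [← hx, ← hxq]
    rfl
  · intro h
    exact ⟨(p.2, p.1), (LinearPMap.mem_graph_iff _).2 ⟨⟨p.2, trivial⟩, rfl, h⟩, rfl⟩

theorem isBoundedInverse_inverse_ofBounded {G : X →L[ℂ] X} (hG : Function.Injective G) :
    IsBoundedInverse (ofBounded G).inverse G := by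
  refine ⟨fun x => (mem_graph_inverse_ofBounded hG).1 ((ofBounded G).inverse.mem_graph x),
    fun y => ?_⟩
  obtain ⟨x, hx, hxy⟩ := (LinearPMap.mem_graph_iff _).1
    ((mem_graph_inverse_ofBounded hG (p := (G y, y))).2 rfl)
  have hx' : (x : X) = G y := hx
  have h : G y ∈ (ofBounded G).inverse.domain := hx' ▸ x.2
  refine ⟨h, ?_⟩
  have : x = ⟨G y, h⟩ := Subtype.ext hx'
  rw [← this]
  exact hxy

theorem IsBoundedInverse.injective {T : X →ₗ.[ℂ] X} {S : X →L[ℂ] X} (h : IsBoundedInverse T S) :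
    Function.Injective S := by
  intro x y hxy
  obtain ⟨hx, hTx⟩ := h.2 x
  obtain ⟨hy, hTy⟩ := h.2 y
  rw [← hTx, ← hTy]
  congr 1
  exact Subtype.ext hxy

theorem IsBoundedInverse.denseRange {T : X →ₗ.[ℂ] X} {S : X →L[ℂ] X} (h : IsBoundedInverse T S)
    (hT : Dense (T.domain : Set X)) : DenseRange S :=
  hT.mono fun x hx => ⟨T ⟨x, hx⟩, h.1 ⟨x, hx⟩⟩

theorem denseRange_of_denseRange_mul {F G : X →L[ℂ] X} (h : DenseRange (F * G)) : DenseRange F :=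
  Dense.mono (range_comp_subset_range G F) h

theorem injective_of_injective_mul {F G : X →L[ℂ] X} (h : Function.Injective (F * G)) :
    Function.Injective G :=
  Function.Injective.of_comp (f := F) (g := G) h

theorem denseRange_pow {F : X →L[ℂ] X} (h : DenseRange F) (n : ℕ) : DenseRange (F ^ n) := by
  induction n with
  | zero => exact denseRange_id
  | succ n ih =>
    rw [pow_succ]
    exact ih.comp h (F ^ n).continuous

theorem injective_pow {F : X →L[ℂ] X} (h : Function.Injective F) (n : ℕ) :
    Function.Injective (F ^ n) := by
  induction n with
  | zero => exact Function.injective_id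
  | succ n ih =>
    rw [pow_succ]
    exact ih.comp h

/-- The closure of a linear operator parametrized by bounded operators. -/
theorem closure_eq_inverse_ofBounded {P : X →ₗ.[ℂ] X} {T V G : X →L[ℂ] X}
    (hP : ∀ p, p ∈ P.graph ↔ ∃ y, (T y, V y) = p) (hT : DenseRange T) (hGV : G * V = T)
    (hVG : V * G = T) (hG : Function.Injective G) : P.closure = (ofBounded G).inverse := by
  have hcl : (ofBounded G).inverse.IsClosed :=
    (LinearPMap.inverse_closed_iff (ker_ofBounded hG)).2 (isClosed_ofBounded G)
  have hsub : P.graph ≤ (ofBounded G).inverse.graph := by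
    intro p hp
    obtain ⟨y, rfl⟩ := (hP p).1 hp
    exact (mem_graph_inverse_ofBounded hG).2 (congrArg (fun F : X →L[ℂ] X => F y) hGV)
  have hPc : P.IsClosable :=
    LinearPMap.IsClosable.leIsClosable hcl.isClosable (LinearPMap.le_of_le_graph hsub)
  refine LinearPMap.eq_of_eq_graph ?_
  rw [← hPc.graph_closure_eq_closure_graph]
  refine le_antisymm (Submodule.topologicalClosure_minimal _ hsub hcl) fun p hp => ?_
  have hp' := (mem_graph_inverse_ofBounded hG).1 hp
  -- The graph of the inverse consists of the pairs `(G y, y)`. Those with `y` in the range of `V`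
  -- are the pairs `(T y, V y)`, and density of that range makes them dense in the graph.
  have hV : DenseRange V := denseRange_of_denseRange_mul (G := G) (hVG ▸ hT)
  have hcont : Continuous fun y : X => (G y, y) := by fun_prop
  have hmem : (G p.2, p.2) ∈ closure ((fun y : X => (G y, y)) '' range V) :=
    image_closure_subset_closure_image hcont ⟨p.2, hV p.2, rfl⟩
  rw [hp'] at hmem
  refine closure_mono ?_ hmem
  rintro _ ⟨_, ⟨y, rfl⟩, rfl⟩
  exact (hP _).2 ⟨y, Prod.ext (congrArg (fun F : X →L[ℂ] X => F y) hGV.symm) rfl⟩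

variable [CompleteSpace X] {A : X →ₗ.[ℂ] X}

/-- The graph of `f₀(1 + A)`. -/
theorem mem_graph_cbfPre_shift_one {M : ℝ} (hM : ∀ s : ℝ, 0 < s → ‖binv (shift A s)‖ ≤ M / s)
    (hρ : ∀ z : ℂ, z.re ≤ 0 → z ∈ resolventSet A) {a : ℝ} {μ : Measure ℝ}
    (hμ : IntegrableOn (fun s : ℝ => 1 / (1 + s)) (Ioi 0) μ) {p : X × X} :
    p ∈ (cbfPre (shift A 1) a 0 μ).graph ↔
      ∃ y, (binv (shift A 1) y, cbfMulInv a μ (fun s : ℝ => binv (shift A s)) y) = p := by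
  have h1 := exists_isBoundedInverse_shift hρ (z := 1) (by simp)
  have hi := (isPseudoResolvent_binv_shift hρ).integrableOn_one_add hM hμ
  have hiy : ∀ y : X, IntegrableOn (fun s : ℝ => binv (shift A ((1 + s : ℝ) : ℂ)) y) (Ioi 0) μ :=
    fun y => (ContinuousLinearMap.apply ℂ X y).integrable_comp hi
  have hsh : ∀ s : ℝ, binv (shift (shift A 1) (s : ℂ)) = binv (shift A ((1 + s : ℝ) : ℂ)) :=
    fun s => by rw [shift_shift]; push_cast; rfl
  have hV : ∀ y : X, cbfMulInv a μ (fun s : ℝ => binv (shift A s)) y =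
      (a : ℂ) • binv (shift A 1) y + ((0 : ℝ) : ℂ) • y +
        ∫ s in Ioi (0 : ℝ), binv (shift (shift A 1) (s : ℂ)) y ∂μ := fun y => by
    simp only [hsh]
    rw [← ContinuousLinearMap.integral_apply hi y, cbfMulInv]
    simp
  rw [LinearPMap.mem_graph_iff]
  constructor
  · rintro ⟨⟨x, hx, hix⟩, hxp, hp⟩
    refine ⟨shift A 1 ⟨x, hx⟩, Prod.ext ((h1.1 ⟨x, hx⟩).trans hxp) ?_⟩
    rw [← hp, hV, h1.1 ⟨x, hx⟩]
    rfl
  · rintro ⟨y, rfl⟩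
    obtain ⟨hy, hTy⟩ := h1.2 y
    refine ⟨⟨binv (shift A 1) y, hy, ?_⟩, rfl, ?_⟩
    · simp only [hTy, hsh]
      exact hiy y
    · change (a : ℂ) • binv (shift A 1) y + ((0 : ℝ) : ℂ) • shift A 1 ⟨binv (shift A 1) y, hy⟩ +
        ∫ s in Ioi (0 : ℝ), binv (shift (shift A 1) (s : ℂ))
          (shift A 1 ⟨binv (shift A 1) y, hy⟩) ∂μ =
          cbfMulInv a μ (fun s : ℝ => binv (shift A s)) y
      rw [hTy, hV]

end Operators

/-- A linear term would force `Φ` to grow at least like `b t`, whereas `Φ(t)` is at most a multiple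
of `t ^ (1/2)` on `[1, ∞)`. This makes `f(B) B⁻¹` a pure resolvent integral. -/
theorem IsIncreasingSlowlyVarying.eq_zero_of_isStieltjesRep {κ : ℝ → ℝ}
    (hκ : IsIncreasingSlowlyVarying κ) {a b : ℝ} {μ : Measure ℝ}
    (h : IsStieltjesRep (Phi κ) a b μ) : b = 0 := by
  by_contra hb
  have hb0 : 0 < b := lt_of_le_of_ne h.2.1 (Ne.symm hb)
  obtain ⟨C, hC, h1⟩ := hκ.exists_Phi_le
  obtain ⟨C', hC', h2⟩ := hκ.exists_le_rpow (δ := 1 / 2) (by norm_num)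
  -- At `t = q ^ 2` the two growth bounds combine to `b q ≤ C C'`, which this value of `q` violates.
  set q := C * C' / b + 1 with hq
  have hq1 : 1 ≤ q := by
    have : 0 ≤ C * C' / b := by positivity
    linarith
  have hq2 : 1 ≤ q ^ 2 := one_le_pow₀ hq1
  have hint : 0 ≤ ∫ s in Ioi (0 : ℝ), q ^ 2 / (q ^ 2 + s) ∂μ := by
    refine setIntegral_nonneg measurableSet_Ioi fun s hs => ?_
    have : (0 : ℝ) < s := hs
    positivity
  have h3 := h.2.2.2 (q ^ 2) (by linarith)
  have h4 := h1 _ hq2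
  have h5 := h2 _ hq2
  have h6 : (q ^ 2 : ℝ) ^ (1 / 2 : ℝ) = q := by
    rw [← Real.sqrt_eq_rpow, Real.sqrt_sq (by linarith)]
  rw [h6] at h5
  have h7 : b * q ^ 2 ≤ C * (C' * q) := by
    have : C * κ (q ^ 2) ≤ C * (C' * q) := by gcongr
    linarith [h.1]
  have h8 : b * q ≤ C * C' := by
    refine le_of_mul_le_mul_right ?_ (show 0 < q by linarith)
    linarith
  have h9 : b * q = C * C' + b := by rw [hq]; field_simp
  linarith

/-- The resolvent estimate in the case of a slowly varying gain. -/
theorem exists_extension_norm_le {X : Type*} [NormedAddCommGroup X] [NormedSpace ℂ X]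
    [CompleteSpace X] {A : X →ₗ.[ℂ] X} {ω : ℝ} (hω' : ω < Real.pi)
    (hA : IsSectorial A ω) (hρ : ∀ z : ℂ, z.re ≤ 0 → z ∈ resolventSet A) {β p : ℝ} (hβ : 0 < β)
    (hp : 0 ≤ p) {κ : ℝ → ℝ} (hκ : IsIncreasingSlowlyVarying κ) {K : ℝ}
    (hK : ∀ ξ : ℝ,
      ‖binv (shift A (Complex.I * (ξ : ℂ)))‖ ≤ K * ((1 + |ξ|) ^ β * (1 / κ (1 + |ξ|))))
    (hD : Dense (A.domain : Set X)) :
    0 ∈ resolventSet (cbf (shift A 1) (Phi κ)) ∧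
    Dense ((unboundedPow (cbf (shift A 1) (Phi κ)) (1 + p)).domain : Set X) ∧
    ∃ C : ℝ, ∀ z : ℂ, z.re = 0 → 1 ≤ ‖z‖ →
      ∃ N : X →L[ℂ] X,
        (∀ x : (unboundedPow (cbf (shift A 1) (Phi κ)) (1 + p)).domain,
          N (x : X) = binv (shift A z) (fracPow (binv (shift A 1)) β
            (unboundedPow (cbf (shift A 1) (Phi κ)) (1 + p) x))) ∧
        κ ‖z‖ ^ (-p) * ‖N‖ ≤ C := by
  obtain ⟨M, -, hM⟩ := hA.exists_norm_binv_le hω'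
  have hR := isPseudoResolvent_binv_shift hρ
  have h1 := exists_isBoundedInverse_shift hρ (z := 1) (by simp)
  obtain ⟨a, b, μ, hrep, hcbf⟩ := exists_isStieltjesRep_and_cbf_eq hκ.isCBF_Phi (shift A 1)
  have hμ := hrep.integrableOn
  have hb := hκ.eq_zero_of_isStieltjesRep hrep
  subst hb
  have hf : ∀ t : ℝ, 0 < t → Phi κ t = a + ∫ s in Ioi (0 : ℝ), t / (t + s) ∂μ := fun t ht => by
    rw [hrep.2.2.2 t ht, zero_mul, add_zero]
  obtain ⟨k₁, hk₁, hk₁'⟩ := hκ.exists_le_Phi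
  obtain ⟨k₂, hk₂, hk₂'⟩ := hκ.exists_Phi_le
  have hR1 : (fun s : ℝ => binv (shift A s)) 1 = binv (shift A 1) := by
    simp only [Complex.ofReal_one]
  have hT : DenseRange (binv (shift A 1)) := h1.denseRange hD
  obtain ⟨G, M', hG, hGT, hGV, hVG⟩ := hR.exists_nonnegBound_inverse hM (hR1 ▸ hT) hrep.1 hμ
    (by rw [← hf 1 one_pos]; exact hκ.Phi_pos one_pos)
  obtain ⟨C, hC0, hC⟩ := hR.exists_factor_norm_le hM hrep.1 hμ hκ hk₁ (k₂ := k₂) (fun r hr => by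
    have hr0 : 0 < r := by linarith
    rw [← hf r hr0]
    exact ⟨hk₁' r hr0, hk₂' r hr⟩) hG hGT hGV hVG hβ hp (|K| * 2 ^ β)
  rw [Complex.ofReal_one] at hGV hVG hGT
  have hGinj : Function.Injective G := by
    refine injective_of_injective_mul (F := cbfMulInv a μ fun s : ℝ => binv (shift A s)) ?_
    rw [hVG]
    exact h1.injective
  have hGdense : DenseRange G := by
    refine denseRange_of_denseRange_mul (G := cbfMulInv a μ fun s : ℝ => binv (shift A s)) ?_
    rw [hGV]
    exact hT
  have hcbfG : cbf (shift A 1) (Phi κ) = (ofBounded G).inverse := by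
    rw [hcbf]
    exact closure_eq_inverse_ofBounded (fun p => mem_graph_cbfPre_shift_one hM hρ hμ) hT hGV hVG
      hGinj
  have hinv := isBoundedInverse_inverse_ofBounded hGinj
  have hα : 0 < 1 + p := by linarith
  -- An integral power of `G` factors through `G ^ (1 + p)` on both sides, so injectivity and dense
  -- range are inherited from `G`.
  obtain ⟨W, hW, hW'⟩ := hG.exists_pow_eq_mul_balPow hα
  have hPinj : Function.Injective (balPow G (1 + p) : X →L[ℂ] X) :=
    injective_of_injective_mul (F := W) (hW ▸ injective_pow hGinj _)
  have hPdense : DenseRange (balPow G (1 + p) : X →L[ℂ] X) :=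
    denseRange_of_denseRange_mul (G := W) (hW' ▸ denseRange_pow hGdense _)
  have hpow : unboundedPow (cbf (shift A 1) (Phi κ)) (1 + p) =
      (ofBounded (balPow G (1 + p))).inverse := by
    rw [unboundedPow, hcbfG, hinv.binv_eq, fracPow_eq_balPow]
  have hPinv := isBoundedInverse_inverse_ofBounded hPinj
  refine ⟨zero_mem_resolventSet_iff.2 ⟨G, hcbfG ▸ hinv⟩, ?_, ?_⟩
  · rw [hpow]
    refine Dense.mono ?_ hPdense
    rintro _ ⟨y, rfl⟩
    exact (hPinv.2 y).choose
  obtain ⟨c, hc, hpot⟩ := hκ.exists_potter one_pos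
  rw [hpow]
  -- The estimate is obtained in terms of `κ ‖1 - z‖`. Since `‖1 - z‖ ≤ 2 ‖z‖`, the Potter bound
  -- returns to `κ ‖z‖` with this factor.
  refine ⟨C * (c * 2 ^ (1 : ℝ)) ^ p, fun z hz hz1 => ?_⟩
  obtain ⟨hr1, hzr, hrz⟩ := one_le_norm_one_sub hz
  have hS := exists_isBoundedInverse_shift hρ (z := z) hz.ge
  have hzre : 0 ≤ (1 - z).re := by simp [hz]
  have hSR : ∀ s : ℝ, 0 ≤ s → binv (shift A z) * binv (shift A ((1 + s : ℝ) : ℂ)) =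
      ((s : ℂ) + (1 - z))⁻¹ • (binv (shift A z) - binv (shift A ((1 + s : ℝ) : ℂ))) := fun s hs => by
    have hs1 : IsBoundedInverse (shift A ((1 + s : ℝ) : ℂ)) (binv (shift A ((1 + s : ℝ) : ℂ))) :=
      exists_isBoundedInverse_shift hρ (by rw [Complex.ofReal_re]; linarith)
    have h := hS.sub_eq hs1
    have e : ((1 + s : ℝ) : ℂ) - z = (s : ℂ) + (1 - z) := by push_cast; ring
    have hne : (s : ℂ) + (1 - z) ≠ 0 := by
      intro hcon
      have := congrArg Complex.re hcon
      simp only [Complex.add_re, Complex.ofReal_re, Complex.sub_re, Complex.one_re, hz,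
        Complex.zero_re] at this
      linarith
    rw [e] at h
    rw [h, inv_smul_smul₀ hne]
  have hSn : ‖binv (shift A z)‖ ≤ |K| * 2 ^ β * (‖1 - z‖ ^ β * (1 / κ ‖1 - z‖)) := by
    have hzI : z = Complex.I * (z.im : ℂ) := by
      apply Complex.ext <;> simp [hz]
    have hnz : ‖z‖ = |z.im| := by rw [hzI]; simp
    have h2 := hK z.im
    rw [← hzI, ← hnz] at h2
    refine h2.trans ?_
    have h3 : 1 + ‖z‖ ≤ 2 * ‖1 - z‖ := by linarith
    have h4 : 1 / κ (1 + ‖z‖) ≤ 1 / κ ‖1 - z‖ :=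
      one_div_le_one_div_of_le (hκ.pos _ (by linarith)) (hκ.le_of_le (by linarith) hrz)
    have h5 : (1 + ‖z‖) ^ β ≤ 2 ^ β * ‖1 - z‖ ^ β := by
      rw [← Real.mul_rpow zero_le_two (by linarith)]
      exact Real.rpow_le_rpow (by linarith) h3 hβ.le
    have h6 := hκ.pos (1 + ‖z‖) (by linarith)
    calc K * ((1 + ‖z‖) ^ β * (1 / κ (1 + ‖z‖))) ≤
          |K| * ((1 + ‖z‖) ^ β * (1 / κ (1 + ‖z‖))) := by
          gcongr; exact le_abs_self K
      _ ≤ |K| * ((2 ^ β * ‖1 - z‖ ^ β) * (1 / κ ‖1 - z‖)) := by gcongr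
      _ = _ := by ring
  obtain ⟨N, hN, hNn⟩ := hC (binv (shift A z)) (1 - z) hr1 hzre hSR hSn
  refine ⟨N, fun x => ?_, ?_⟩
  · have e1 := hPinv.1 x
    rw [Complex.ofReal_one] at hN
    rw [fracPow_eq_balPow]
    nth_rewrite 1 [← e1]
    exact congrArg (fun F : X →L[ℂ] X => F ((ofBounded (balPow G (1 + p))).inverse x)) hN
  · have hκz := hκ.pos ‖z‖ (by linarith)
    have hκr := hκ.pos ‖1 - z‖ (by linarith)
    have e1 : κ ‖1 - z‖ ≤ c * 2 ^ (1 : ℝ) * κ ‖z‖ :=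
      (hκ.le_of_le (by linarith) (by linarith)).trans (hpot 2 ‖z‖ one_le_two hz1)
    have e2 : κ ‖1 - z‖ ^ p ≤ (c * 2 ^ (1 : ℝ)) ^ p * κ ‖z‖ ^ p := by
      rw [← Real.mul_rpow (by positivity) hκz.le]
      exact Real.rpow_le_rpow hκr.le e1 hp
    calc κ ‖z‖ ^ (-p) * ‖N‖ ≤ κ ‖z‖ ^ (-p) * (C * ((c * 2 ^ (1 : ℝ)) ^ p * κ ‖z‖ ^ p)) := by
          gcongr
          exact hNn.trans (by gcongr)
      _ = C * (c * 2 ^ (1 : ℝ)) ^ p * (κ ‖z‖ ^ (-p) * κ ‖z‖ ^ p) := by ring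
      _ = _ := by rw [← Real.rpow_add hκz, neg_add_cancel, Real.rpow_zero, mul_one]

end SectorialCalculus

end

/-! ### The two resolvent estimates -/

open SectorialCalculus in
theorem proposition3p1 {X : Type*} [NormedAddCommGroup X] [NormedSpace ℂ X] [CompleteSpace X]
    (A : X →ₗ.[ℂ] X) (ω : ℝ) (hω : 0 ≤ ω) (hω' : ω < Real.pi) (hA : IsSectorial A ω)
    (hρ : ∀ z : ℂ, z.re ≤ 0 → z ∈ resolventSet A)
    (β : ℝ) (hβ : 0 < β) (a : ℝ) (ha : 0 ≤ a)
    (ℓ κ : ℝ → ℝ) (hℓ : IsIncreasingSlowlyVarying ℓ) (hκ : IsIncreasingSlowlyVarying κ) :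
    ((∃ C : ℝ, ∀ ξ : ℝ,
        ‖binv (shift A (Complex.I * (ξ : ℂ)))‖ ≤ C * ((1 + |ξ|) ^ β * ℓ (1 + |ξ|))) →
      ∀ ε : ℝ, 0 < ε →
        (ε ≤ 1 → IsCBF (Psi ℓ ε)) ∧
        (IsCBF (Psi ℓ ε) →
          ∃ F : X →L[ℂ] X,
            cbf (ofBounded (binv (shift A 1))) (Psi ℓ ε) = ofBounded F ∧
            ∃ C : ℝ, ∀ z : ℂ, z.re = 0 → 1 ≤ ‖z‖ →
              ℓ ‖z‖ ^ a *
                ‖binv (shift A z) * fracPow (binv (shift A 1)) β * fracPow F (1 + a)‖ ≤ C)) ∧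
    ((∃ C : ℝ, ∀ ξ : ℝ,
        ‖binv (shift A (Complex.I * (ξ : ℂ)))‖ ≤ C * ((1 + |ξ|) ^ β * (1 / κ (1 + |ξ|)))) →
      Dense (A.domain : Set X) →
        IsCBF (Phi κ) ∧
        0 ∈ resolventSet (cbf (shift A 1) (Phi κ)) ∧
        Dense ((unboundedPow (cbf (shift A 1) (Phi κ)) (1 + a)).domain : Set X) ∧
        ∃ C : ℝ, ∀ z : ℂ, z.re = 0 → 1 ≤ ‖z‖ →
          ∃ N : X →L[ℂ] X,
            (∀ x : (unboundedPow (cbf (shift A 1) (Phi κ)) (1 + a)).domain,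
              N (x : X) = binv (shift A z) (fracPow (binv (shift A 1)) β
                (unboundedPow (cbf (shift A 1) (Phi κ)) (1 + a) x))) ∧
            κ ‖z‖ ^ (-a) * ‖N‖ ≤ C) := by
  refine ⟨fun ⟨K, hK⟩ ε hε => ⟨fun hε1 => hℓ.isCBF_Psi hε hε1, fun hΨ => ?_⟩, fun ⟨K, hK⟩ hD => ?_⟩
  · exact exists_norm_binv_mul_fracPow_mul_fracPow_le hω' hA hρ hβ ha hℓ hK hε hΨ
  · exact ⟨hκ.isCBF_Phi, exists_extension_norm_le hω' hA hρ hβ ha hκ hK hD⟩
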